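/- Let $k\ge 1$ be an integer. A tree decomposition of a finite graph $G$ is a pair $\mathcal T=(T,\{X_t\}_{t\in V(T)})$ where $T$ is a tree and $X_t\subseteq V(G)$ for each node $t$, such that every vertex of $G$ lies in some $X_t$, both endpoints of every edge of $G$ lie in a common $X_t$, and for every vertex $v$ the nodes $t$ with $v\in X_t$ induce a connected subgraph of $T$. Its independence number is $\max_t \alpha(G[X_t])$. For an integer $\ell\ge 0$, an $\ell$-refined tree decomposition $(T,\{(X_t,U_t)\}_{t\in V(T)})$ is a tree decomposition together with sets $U_t\subseteq X_t$ with $|U_t|\le \ell$ for all $t$; its residual independence number is $\max_t \alpha(G[X_t\setminus U_t])$. Given a graph $G$ and a weight function $w:V(G)\to\mathbb Q_{\ge 0}$, the problem Max Weight Independent Set asks for an independent set $I$ of $G$ maximizing $\sum_{v\in I}w(v)$. Running times are on a word RAM with words of $O(\ell+\log(|V(G)|+1)+\log(|V(T)|+1))$ bits (take $\ell=0$ in part 2), where the constant depends only on $k$, with unit-cost operations on words and unit-cost copying, addition, subtraction and comparison of rational weights. The graph $G$ is given by its adjacency matrix, the tree $T$ by adjacency lists, and the families $\{X_t\}$ and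 $\{U_t\}$ by their $0/1$ incidence matrices with respect to $V(G)$. 1. There are a program and a constant $C$, both depending only on $k$, such that for every $\ell\ge 0$, every finite graph $G$ with weight function $w:V(G)\to\mathbb Q_{\ge0}$, and every $\ell$-refined tree decomposition $(T,\{(X_t,U_t)\}_{t\in V(T)})$ of $G$ with residual independence number at most $k$, the program, given $G$, $w$ and the decomposition, solves Max Weight Independent Set (it outputs a maximum-weight independent set of $G$) in at most $C\cdot(2^\ell\cdot|V(G)|^{k+1}\cdot|V(T)|+1)$ steps; that is, in time $O(2^\ell\cdot|V(G)|^{k+1}\cdot|V(T)|)$ whenever $V(G)\neq\emptyset$. 2. Likewise, there are a program and a constant $C$, both depending only on $k$, that solve Max Weight Independent Set in at most $C\cdot(|V(G)|^{k+1}\cdot|V(T)|+1)$ steps for every finite graph $G$ with weight function $w:V(G)\to\mathbb Q_{\ge0}$ given with a tree decomposition $(T,\{X_t\}_{t\in V(T)})$ of independence number at most $k$. -/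

import Mathlib

namespace MWIS

/-! ### Tree decompositions, refined tree decompositions, independence numbers -/

section Decompositions

variable {V ι : Type*}

/-- A tree decomposition of the graph `G` whose tree has node set `ι`. -/
structure TreeDecomposition (G : SimpleGraph V) (ι : Type*) where
  tree : SimpleGraph ι
  isTree : tree.IsTree
  bag : ι → Finset V
  exists_mem_bag : ∀ v, ∃ t, v ∈ bag t
  exists_edge_bag : ∀ u v, G.Adj u v → ∃ t, u ∈ bag t ∧ v ∈ bag t
  connected : ∀ v, (tree.induce {t | v ∈ bag t}).Connected

/-- An `ℓ`-refined tree decomposition: each bag `X_t` comes with a set `U_t ⊆ X_t` of at most `ℓ`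
vertices. -/
structure RefinedTreeDecomposition (G : SimpleGraph V) (ι : Type*) (ℓ : ℕ) extends
    TreeDecomposition G ι where
  sub : ι → Finset V
  sub_subset_bag : ∀ t, sub t ⊆ bag t
  card_sub_le : ∀ t, (sub t).card ≤ ℓ

/-- The independence number `max_t α(G[X_t])` of a tree decomposition. -/
noncomputable def TreeDecomposition.indepNumber [Fintype ι] {G : SimpleGraph V}
    (D : TreeDecomposition G ι) : ℕ :=
  Finset.univ.sup fun t => (G.induce (D.bag t : Set V)).indepNum

/-- The residual independence number `max_t α(G[X_t \ U_t])` of a refined tree decomposition. -/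
noncomputable def RefinedTreeDecomposition.residualIndepNumber [Fintype ι] {G : SimpleGraph V}
    {ℓ : ℕ} (D : RefinedTreeDecomposition G ι ℓ) : ℕ :=
  Finset.univ.sup fun t => (G.induce ((D.bag t : Set V) \ (D.sub t : Set V))).indepNum

/-- `I` is an independent set of `G` of maximum weight. -/
def IsMaxWeightIndepSet (G : SimpleGraph V) (w : V → ℚ≥0) (I : Finset V) : Prop :=
  G.IsIndepSet (I : Set V) ∧
    ∀ J : Finset V, G.IsIndepSet (J : Set V) → ∑ v ∈ J, w v ≤ ∑ v ∈ I, w v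

/-- Adjacency lists of a graph; the order inside each list is arbitrary. -/
structure AdjLists (T : SimpleGraph ι) where
  nbrs : ι → List ι
  nodup : ∀ t, (nbrs t).Nodup
  mem_nbrs : ∀ t t', t' ∈ nbrs t ↔ T.Adj t t'

end Decompositions

/-! ### The machine model: a word RAM

Programs are structured word-RAM programs. The memory consists of arrays of natural numbers
(words) and arrays of rational numbers (weights); a program names its arrays by constants, so it
uses finitely many of them, and scalar variables are cells at constant positions. Every
natural number occurring in a computation has to be at most the word bound `B`: an execution in
which some larger number is computed, read or used as an address is stuck. Weights can only be
copied, added, subtracted and compared, and cannot be turned into words. Every single operation,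
memory access, test and constant has unit cost. -/

/-- The unit-cost operations on words. Comparisons return `0` or `1`. -/
inductive WordOp
  | add | sub | mul | div | mod | lt | eq

/-- Values of the word operations: `sub` is truncated subtraction, `div` and `mod` are division
with remainder. -/
def WordOp.apply : WordOp → ℕ → ℕ → ℕ
  | add, x, y => x + y
  | sub, x, y => x - y
  | mul, x, y => x * y
  | div, x, y => x / y
  | mod, x, y => x % y
  | lt, x, y => if x < y then 1 else 0
  | eq, x, y => if x = y then 1 else 0

/-- A memory state: `mem a i` is cell `i` of word array `a`, and `wmem a i` is cell `i` of weight
array `a`. -/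
@[ext]
structure State where
  mem : ℕ → ℕ → ℕ
  wmem : ℕ → ℕ → ℚ

/-- Word expressions; `read a i` is the content of cell `i` of word array `a`. -/
inductive Expr
  | const (c : ℕ)
  | read (a : ℕ) (i : Expr)
  | op (o : WordOp) (e₁ e₂ : Expr)

/-- The value of a word expression. -/
def Expr.eval (s : State) : Expr → ℕ
  | const c => c
  | read a i => s.mem a (i.eval s)
  | op o e₁ e₂ => o.apply (e₁.eval s) (e₂.eval s)

/-- All numbers arising in the evaluation of the expression are at most `B`. -/
def Expr.Fits (B : ℕ) (s : State) : Expr → Prop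
  | const c => c ≤ B
  | read a i => i.Fits B s ∧ s.mem a (i.eval s) ≤ B
  | op o e₁ e₂ => e₁.Fits B s ∧ e₂.Fits B s ∧ o.apply (e₁.eval s) (e₂.eval s) ≤ B

/-- The cost of evaluating a word expression. -/
def Expr.cost : Expr → ℕ
  | const _ => 1
  | read _ i => i.cost + 1
  | op _ e₁ e₂ => e₁.cost + e₂.cost + 1

/-- Weight expressions; `read a i` is the content of cell `i` of weight array `a`. -/
inductive WExpr
  | zero
  | read (a : ℕ) (i : Expr)
  | add (x y : WExpr)
  | sub (x y : WExpr)

/-- The value of a weight expression. -/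
def WExpr.eval (s : State) : WExpr → ℚ
  | zero => 0
  | read a i => s.wmem a (i.eval s)
  | add x y => x.eval s + y.eval s
  | sub x y => x.eval s - y.eval s

/-- All addresses used in the evaluation of the weight expression fit into words. -/
def WExpr.Fits (B : ℕ) (s : State) : WExpr → Prop
  | zero => True
  | read _ i => i.Fits B s
  | add x y => x.Fits B s ∧ y.Fits B s
  | sub x y => x.Fits B s ∧ y.Fits B s

/-- The cost of evaluating a weight expression. -/
def WExpr.cost : WExpr → ℕ
  | zero => 1
  | read _ i => i.cost + 1
  | add x y => x.cost + y.cost + 1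
  | sub x y => x.cost + y.cost + 1

/-- Programs. `store a i e` writes the value of `e` into cell `i` of word array `a`, `wstore`
does the same for weights, `cond` branches on a word being nonzero, `wcond x y` branches on
`x ≤ y` for weights, and `loop e p` repeats `p` while the value of `e` is nonzero. -/
inductive Prog
  | skip
  | store (a : ℕ) (i e : Expr)
  | wstore (a : ℕ) (i : Expr) (x : WExpr)
  | seq (p q : Prog)
  | cond (e : Expr) (p q : Prog)
  | wcond (x y : WExpr) (p q : Prog)
  | loop (e : Expr) (p : Prog)

/-- Write the word `x` into cell `i` of word array `a`. -/
def State.setMem (s : State) (a i x : ℕ) : State :=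
  { s with mem := Function.update s.mem a (Function.update (s.mem a) i x) }

/-- Write the weight `x` into cell `i` of weight array `a`. -/
def State.setWMem (s : State) (a i : ℕ) (x : ℚ) : State :=
  { s with wmem := Function.update s.wmem a (Function.update (s.wmem a) i x) }

/-- `Exec B p s t s'`: on a machine with word bound `B`, the program `p` started in state `s`
halts after exactly `t` steps in state `s'`. -/
inductive Exec (B : ℕ) : Prog → State → ℕ → State → Prop
  | skip (s : State) : Exec B .skip s 1 s
  | store (s : State) (a : ℕ) (i e : Expr) : i.Fits B s → e.Fits B s →
      Exec B (.store a i e) s (i.cost + e.cost + 1) (s.setMem a (i.eval s) (e.eval s))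
  | wstore (s : State) (a : ℕ) (i : Expr) (x : WExpr) : i.Fits B s → x.Fits B s →
      Exec B (.wstore a i x) s (i.cost + x.cost + 1) (s.setWMem a (i.eval s) (x.eval s))
  | seq {p q : Prog} {s s₁ s₂ : State} {t₁ t₂ : ℕ} : Exec B p s t₁ s₁ → Exec B q s₁ t₂ s₂ →
      Exec B (.seq p q) s (t₁ + t₂) s₂
  | condTrue {e : Expr} {p q : Prog} {s s' : State} {t : ℕ} : e.Fits B s → e.eval s ≠ 0 →
      Exec B p s t s' → Exec B (.cond e p q) s (e.cost + t + 1) s'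
  | condFalse {e : Expr} {p q : Prog} {s s' : State} {t : ℕ} : e.Fits B s → e.eval s = 0 →
      Exec B q s t s' → Exec B (.cond e p q) s (e.cost + t + 1) s'
  | wcondTrue {x y : WExpr} {p q : Prog} {s s' : State} {t : ℕ} : x.Fits B s → y.Fits B s →
      x.eval s ≤ y.eval s → Exec B p s t s' →
      Exec B (.wcond x y p q) s (x.cost + y.cost + t + 1) s'
  | wcondFalse {x y : WExpr} {p q : Prog} {s s' : State} {t : ℕ} : x.Fits B s → y.Fits B s →
      ¬ x.eval s ≤ y.eval s → Exec B q s t s' →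
      Exec B (.wcond x y p q) s (x.cost + y.cost + t + 1) s'
  | loopDone {e : Expr} {p : Prog} {s : State} : e.Fits B s → e.eval s = 0 →
      Exec B (.loop e p) s (e.cost + 1) s
  | loopStep {e : Expr} {p : Prog} {s s₁ s₂ : State} {t₁ t₂ : ℕ} : e.Fits B s → e.eval s ≠ 0 →
      Exec B p s t₁ s₁ → Exec B (.loop e p) s₁ t₂ s₂ →
      Exec B (.loop e p) s (e.cost + t₁ + t₂ + 1) s₂

/-! ### Input and output -/

section Encoding

open scoped Classical in
/-- The row-major `0/1` matrix of a relation: cell `a * n + b` is `1` iff `R a b`. -/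
noncomputable def bitMatrix {m n : ℕ} (R : Fin m → Fin n → Prop) : ℕ → ℕ :=
  fun i => if ∃ (a : Fin m) (b : Fin n), i = a * n + b ∧ R a b then 1 else 0

variable {n N : ℕ} {G : SimpleGraph (Fin n)}

/-- The input memory for a weighted graph `G` given with a tree decomposition.
Word array `0`: the numbers `n = |V(G)|` and `N = |V(T)|`.
Word array `1`: the adjacency matrix of `G`.
Word arrays `2` and `3`: the adjacency lists of the tree `T`; array `3` is the concatenation of
the lists of nodes `0, 1, …, N - 1`, and the list of node `t` occupies the cells of array `3` from
`array2[t]` (inclusive) to `array2[t + 1]` (exclusive).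
Word array `4`: the incidence matrix of the bags, with one row for each node.
Weight array `0`: the vertex weights.
All other cells are `0`. -/
noncomputable def treeDecompositionInput (w : Fin n → ℚ≥0) (D : TreeDecomposition G (Fin N))
    (L : AdjLists D.tree) : State where
  mem := fun a => match a with
    | 0 => fun i => if i = 0 then n else if i = 1 then N else 0
    | 1 => bitMatrix G.Adj
    | 2 => fun t => (((List.finRange N).take t).flatMap L.nbrs).length
    | 3 => fun i => (((List.finRange N).flatMap L.nbrs).map Fin.val).getD i 0
    | 4 => bitMatrix fun t v => v ∈ D.bag t
    | _ => fun _ => 0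
  wmem := fun a => match a with
    | 0 => fun i => if h : i < n then (w ⟨i, h⟩ : ℚ) else 0
    | _ => fun _ => 0

/-- The input memory for a weighted graph given with a refined tree decomposition: as for the
underlying tree decomposition, and word array `5` is the incidence matrix of the sets `U_t`. -/
noncomputable def refinedInput {ℓ : ℕ} (w : Fin n → ℚ≥0)
    (D : RefinedTreeDecomposition G (Fin N) ℓ) (L : AdjLists D.tree) : State :=
  let s := treeDecompositionInput w D.toTreeDecomposition L
  { s with mem := Function.update s.mem 5 (bitMatrix fun t v => v ∈ D.sub t) }

/-- The final memory holds, as a `0/1` vector in word array `6`, a maximum-weight independent set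
of `G`. -/
def OutputsMaxWeightIndepSet (G : SimpleGraph (Fin n)) (w : Fin n → ℚ≥0) (s : State) : Prop :=
  ∃ I : Finset (Fin n), (∀ v : Fin n, s.mem 6 v = if v ∈ I then 1 else 0) ∧
    IsMaxWeightIndepSet G w I

end Encoding

end MWIS

/-! The algorithm is dynamic programming over the tree, rooted at node `0` by breadth-first search;
the root gets the fictitious parent `N`, whose bag is empty. An independent subset `J` of a bag
`X_t` splits into `J ∩ U_t`, stored as a bit mask, and `J \ U_t`, stored as at most `k` digits in
base `n + 1`. This gives at most `2^ℓ (n+1)^k` codes at each node. For every trace `K ⊆ X_t ∩ X_{par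
t}` a table entry keeps the best value of a choice `J` with trace `K`, together with a code
attaining it. The value of `J` is the weight of `J \ X_{par t}` plus the entries of the children for
the traces of `J`, so a vertex is paid for only at its topmost node.

Correctness is a certificate argument (`Inst.IsOrder.optimal`) and needs no induction over subtrees.
By `Inst.IsOrder.sum_cval` the local values telescope over the tree: a set `J` whose value at each
node is at most the table entry for its trace weighs at most the root entry, and equality at every
node gives equality of weights. `Inst.Up.step` shows that the tables satisfy the local inequalities
and that every entry is attained. `Inst.Down.step` glues attaining choices from the root downwards
into a set that is tight at every node; the running intersection property `Inst.IsOrder.rip`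
guarantees that later choices do not disturb earlier bags.

For the running time, one code at `t` may cost `O(n (deg t + 1))`, since the degrees of a tree sum
to `2N - 2`. A fresh independence test would cost `n²` per code. Therefore a code is split as `d *
low + y` with top digit `d`: the set of `y` is tested once for all `n + 1` values of `d`, and for
each `d` only the row of the vertex `d - 1` remains to be tested (`Inst.indep_dec_add`). Since the
top digit is counted separately, `Inst.k` is one less than the `k` of the theorem. The unrefined
case is `ℓ = 0` with empty `U_t`.

`Runs` is a Hoare triple with a time bound. Word arrays `6` to `10` hold the solution, the parents
plus one, the order, the decoded set and the recorded codes (`10`); weight array `1` holds the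
tables and cell `0` of weight array `2` the value being computed. The other written word arrays
serve as scalars. -/

namespace MWIS

/-! ### Reasoning about programs -/

attribute [simp] Expr.eval Expr.Fits Expr.cost WExpr.eval WExpr.Fits WExpr.cost WordOp.apply

/-- Whether the program may write to the word array `b`. -/
def Prog.modifies : Prog → ℕ → Bool
  | .skip, _ => false
  | .store a _ _, b => a == b
  | .wstore _ _ _, _ => false
  | .seq p q, b => p.modifies b || q.modifies b
  | .cond _ p q, b => p.modifies b || q.modifies b
  | .wcond _ _ p q, b => p.modifies b || q.modifies b
  | .loop _ p, b => p.modifies b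

/-- Whether the program may write to the weight array `b`. -/
def Prog.wmodifies : Prog → ℕ → Bool
  | .skip, _ => false
  | .store _ _ _, _ => false
  | .wstore a _ _, b => a == b
  | .seq p q, b => p.wmodifies b || q.wmodifies b
  | .cond _ p q, b => p.wmodifies b || q.wmodifies b
  | .wcond _ _ p q, b => p.wmodifies b || q.wmodifies b
  | .loop _ p, b => p.wmodifies b

@[simp] theorem State.setMem_mem (s : State) (a i x b : ℕ) :
    (s.setMem a i x).mem b = if b = a then Function.update (s.mem a) i x else s.mem b := by
  unfold State.setMem
  by_cases h : b = a
  · subst h; simp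
  · simp [h]

@[simp] theorem State.setMem_wmem (s : State) (a i x : ℕ) : (s.setMem a i x).wmem = s.wmem := rfl

@[simp] theorem State.setWMem_wmem (s : State) (a i : ℕ) (x : ℚ) (b : ℕ) :
    (s.setWMem a i x).wmem b = if b = a then Function.update (s.wmem a) i x else s.wmem b := by
  unfold State.setWMem
  by_cases h : b = a
  · subst h; simp
  · simp [h]

@[simp] theorem State.setWMem_mem (s : State) (a i : ℕ) (x : ℚ) : (s.setWMem a i x).mem = s.mem :=
  rfl

/-- `s` and `s'` agree on all arrays that `p` does not write to. -/
def Frame (p : Prog) (s s' : State) : Prop :=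
  (∀ a, p.modifies a = false → s'.mem a = s.mem a) ∧
    ∀ a, p.wmodifies a = false → s'.wmem a = s.wmem a

theorem Frame.refl (p : Prog) (s : State) : Frame p s s := ⟨fun _ _ => rfl, fun _ _ => rfl⟩

theorem Frame.trans {p : Prog} {s s' s'' : State} (h : Frame p s s') (h' : Frame p s' s'') :
    Frame p s s'' :=
  ⟨fun a ha => (h'.1 a ha).trans (h.1 a ha), fun a ha => (h'.2 a ha).trans (h.2 a ha)⟩

theorem Frame.imp {p q : Prog} {s s' : State} (h : Frame p s s')
    (hm : ∀ a, q.modifies a = false → p.modifies a = false)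
    (hw : ∀ a, q.wmodifies a = false → p.wmodifies a = false) : Frame q s s' :=
  ⟨fun a ha => h.1 a (hm a ha), fun a ha => h.2 a (hw a ha)⟩

/-- Since `modifies` and `wmodifies` are computed from the syntax, this reduces the preservation of
an array by a concrete program to `rfl`; all later bookkeeping rests on it. -/
theorem Exec.frame {B : ℕ} {p : Prog} {s s' : State} {t : ℕ} (h : Exec B p s t s') :
    Frame p s s' := by
  induction h with
  | skip s => exact Frame.refl _ _
  | store s a i e hi he =>
    refine ⟨fun b hb => ?_, fun b _ => rfl⟩
    have : b ≠ a := by rintro rfl; simp [Prog.modifies] at hb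
    simp [this]
  | wstore s a i x hi hx =>
    refine ⟨fun b _ => rfl, fun b hb => ?_⟩
    have : b ≠ a := by rintro rfl; simp [Prog.wmodifies] at hb
    simp [this]
  | seq _ _ h1 h2 =>
    refine (h1.imp ?_ ?_).trans (h2.imp ?_ ?_) <;> simp +contextual [Prog.modifies, Prog.wmodifies]
  | condTrue _ _ _ h =>
    exact h.imp (by simp +contextual [Prog.modifies])
      (by simp +contextual [Prog.wmodifies])
  | condFalse _ _ _ h =>
    exact h.imp (by simp +contextual [Prog.modifies])
      (by simp +contextual [Prog.wmodifies])
  | wcondTrue _ _ _ _ h =>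
    exact h.imp (by simp +contextual [Prog.modifies])
      (by simp +contextual [Prog.wmodifies])
  | wcondFalse _ _ _ _ h =>
    exact h.imp (by simp +contextual [Prog.modifies])
      (by simp +contextual [Prog.wmodifies])
  | loopDone _ _ => exact Frame.refl _ _
  | loopStep _ _ _ _ h1 h2 =>
    exact (h1.imp (by simp [Prog.modifies]) (by simp [Prog.wmodifies])).trans h2

/-- The expression evaluates to `v` within the word bound. -/
def Expr.Ev (B : ℕ) (s : State) (e : Expr) (v : ℕ) : Prop := e.Fits B s ∧ e.eval s = v

/-- The weight expression evaluates to `v` within the word bound. -/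
def WExpr.Ev (B : ℕ) (s : State) (e : WExpr) (v : ℚ) : Prop := e.Fits B s ∧ e.eval s = v

/-- `p` started in `s` halts after at most `T` steps in a state satisfying `Q`. -/
def Runs (B : ℕ) (p : Prog) (s : State) (T : ℕ) (Q : State → Prop) : Prop :=
  ∃ t s', Exec B p s t s' ∧ t ≤ T ∧ Q s'

namespace Runs

variable {B : ℕ} {p q : Prog} {s : State} {T T' T₁ T₂ : ℕ} {Q R : State → Prop}

theorem mono (h : Runs B p s T R) (hT : T ≤ T') (hQ : ∀ s', R s' → Frame p s s' → Q s') :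
    Runs B p s T' Q := by
  obtain ⟨t, s', he, ht, hr⟩ := h
  exact ⟨t, s', he, ht.trans hT, hQ s' hr he.frame⟩

theorem weaken (h : Runs B p s T Q) (hT : T ≤ T') : Runs B p s T' Q :=
  h.mono hT fun _ h _ => h

theorem skip (hQ : Q s) : Runs B .skip s 1 Q := ⟨1, s, .skip s, le_rfl, hQ⟩

theorem store {a : ℕ} {i e : Expr} {iv ev : ℕ} (hi : i.Ev B s iv) (he : e.Ev B s ev)
    (hQ : Q (s.setMem a iv ev)) : Runs B (.store a i e) s (i.cost + e.cost + 1) Q := by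
  refine ⟨_, _, .store s a i e hi.1 he.1, le_rfl, ?_⟩
  rwa [hi.2, he.2]

theorem wstore {a : ℕ} {i : Expr} {e : WExpr} {iv : ℕ} {ev : ℚ} (hi : i.Ev B s iv)
    (he : e.Ev B s ev) (hQ : Q (s.setWMem a iv ev)) :
    Runs B (.wstore a i e) s (i.cost + e.cost + 1) Q := by
  refine ⟨_, _, .wstore s a i e hi.1 he.1, le_rfl, ?_⟩
  rwa [hi.2, he.2]

theorem seq (h : Runs B p s T₁ R) (h' : ∀ s', R s' → Frame p s s' → Runs B q s' T₂ Q) :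
    Runs B (.seq p q) s (T₁ + T₂) Q := by
  obtain ⟨t, s', he, ht, hr⟩ := h
  obtain ⟨t', s'', he', ht', hq⟩ := h' s' hr he.frame
  exact ⟨_, _, he.seq he', by omega, hq⟩

theorem store_seq {a : ℕ} {i e : Expr} {iv ev : ℕ} (hi : i.Ev B s iv) (he : e.Ev B s ev)
    (h : Runs B q (s.setMem a iv ev) T Q) :
    Runs B (.seq (.store a i e) q) s (i.cost + e.cost + 1 + T) Q :=
  (Runs.store (Q := fun s' => s' = s.setMem a iv ev) hi he rfl).seq fun _ hs _ => hs ▸ h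

theorem wstore_seq {a : ℕ} {i : Expr} {e : WExpr} {iv : ℕ} {ev : ℚ} (hi : i.Ev B s iv)
    (he : e.Ev B s ev) (h : Runs B q (s.setWMem a iv ev) T Q) :
    Runs B (.seq (.wstore a i e) q) s (i.cost + e.cost + 1 + T) Q :=
  (Runs.wstore (Q := fun s' => s' = s.setWMem a iv ev) hi he rfl).seq fun _ hs _ => hs ▸ h

theorem cond {e : Expr} {v : ℕ} (he : e.Ev B s v) (ht : v ≠ 0 → Runs B p s T Q)
    (hf : v = 0 → Runs B q s T Q) : Runs B (.cond e p q) s (e.cost + T + 1) Q := by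
  by_cases hv : v = 0
  · obtain ⟨t, s', h, h', h''⟩ := hf hv
    exact ⟨_, s', .condFalse he.1 (he.2.trans hv) h, by omega, h''⟩
  · obtain ⟨t, s', h, h', h''⟩ := ht hv
    exact ⟨_, s', .condTrue he.1 (by rwa [he.2]) h, by omega, h''⟩

theorem wcond {x y : WExpr} {v v' : ℚ} (hx : x.Ev B s v) (hy : y.Ev B s v')
    (ht : v ≤ v' → Runs B p s T Q) (hf : ¬ v ≤ v' → Runs B q s T Q) :
    Runs B (.wcond x y p q) s (x.cost + y.cost + T + 1) Q := by
  by_cases hv : v ≤ v'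
  · obtain ⟨t, s', h, h', h''⟩ := ht hv
    exact ⟨_, s', .wcondTrue hx.1 hy.1 (by rwa [hx.2, hy.2]) h, by omega, h''⟩
  · obtain ⟨t, s', h, h', h''⟩ := hf hv
    exact ⟨_, s', .wcondFalse hx.1 hy.1 (by rwa [hx.2, hy.2]) h, by omega, h''⟩

end Runs

/-! ### Scalar variables and counting loops. -/

/-- The scalar variable kept in cell `0` of the word array `a`. -/
def V (a : ℕ) : Expr := .read a (.const 0)

/-- Assignment to a scalar variable. -/
def setV (a : ℕ) (e : Expr) : Prog := .store a (.const 0) e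

@[simp] theorem V_eval (s : State) (a : ℕ) : (V a).eval s = s.mem a 0 := rfl
@[simp] theorem V_fits (B : ℕ) (s : State) (a : ℕ) : (V a).Fits B s ↔ s.mem a 0 ≤ B := by
  simp [V]
@[simp] theorem V_cost (a : ℕ) : (V a).cost = 2 := rfl

local infixl:65 " +ₑ " => Expr.op WordOp.add
local infixl:65 " -ₑ " => Expr.op WordOp.sub
local infixl:70 " *ₑ " => Expr.op WordOp.mul
local infixl:70 " /ₑ " => Expr.op WordOp.div
local infixl:70 " %ₑ " => Expr.op WordOp.mod
local infix:50 " <ₑ " => Expr.op WordOp.lt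
local infixr:40 " ;; " => Prog.seq

/-- Run `body` with the variable `i` taking the values `0, 1, …, b - 1`. -/
def forP (i : ℕ) (b : Expr) (body : Prog) : Prog :=
  setV i (.const 0) ;; .loop (V i <ₑ b) (body ;; setV i (V i +ₑ .const 1))

theorem Runs.setV {B : ℕ} {s : State} {Q : State → Prop} {a : ℕ} {e : Expr} {ev : ℕ}
    (he : e.Ev B s ev) (hQ : Q (s.setMem a 0 ev)) : Runs B (MWIS.setV a e) s (e.cost + 2) Q :=
  (Runs.store (iv := 0) ⟨by simp, by simp⟩ he hQ).weaken (by simp; omega)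

theorem Runs.setV_seq {B T : ℕ} {s : State} {Q : State → Prop} {a : ℕ} {e : Expr} {ev : ℕ}
    {q : Prog} (he : e.Ev B s ev) (h : Runs B q (s.setMem a 0 ev) T Q) :
    Runs B (MWIS.setV a e ;; q) s (e.cost + 2 + T) Q :=
  (Runs.setV (Q := fun s' => s' = s.setMem a 0 ev) he rfl).seq fun _ hs _ => hs ▸ h

theorem Frame.forP_body {i : ℕ} {b : Expr} {body : Prog} {s s' : State} (h : Frame body s s') :
    Frame (forP i b body) s s' :=
  h.imp (by simp +contextual [forP, setV, Prog.modifies])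
    (by simp +contextual [forP, setV, Prog.wmodifies])

theorem Frame.forP_set {i : ℕ} {b : Expr} {body : Prog} (s : State) (x : ℕ) :
    Frame (forP i b body) s (s.setMem i 0 x) := by
  refine ⟨fun a ha => ?_, fun a _ => rfl⟩
  have : a ≠ i := by rintro rfl; simp [forP, MWIS.setV, Prog.modifies] at ha
  simp [this]

/-- The rule for counting loops; `r` bounds the time used so far. -/
theorem Runs.forP {B i m T : ℕ} {b : Expr} {body : Prog} {s : State} (I : ℕ → ℕ → State → Prop)
    (hm : m ≤ B) (hB : 1 ≤ B) (hi : body.modifies i = false)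
    (h0 : I 0 0 (s.setMem i 0 0))
    (hb : ∀ j r s', j ≤ m → I j r s' → s'.mem i 0 = j → Frame (forP i b body) s s' → b.Ev B s' m)
    (hstep : ∀ j r s', j < m → I j r s' → s'.mem i 0 = j → Frame (forP i b body) s s' →
      ∃ T', Runs B body s' T' fun s'' =>
        I (j + 1) (r + T' + b.cost + 10) (s''.setMem i 0 (j + 1)))
    (hT : ∀ r s', I m r s' → r + b.cost + 7 ≤ T) :
    Runs B (MWIS.forP i b body) s T fun s' => ∃ r, I m r s' ∧ s'.mem i 0 = m := by
  -- Induction on the number `d` of remaining rounds. A round costs `T'` for the body, `b.cost + 3`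
  -- for the comparison, `1` for the loop and `6` for the increment; the last, failing test costs
  -- `b.cost + 4` and the initial assignment `3`.
  have key : ∀ d j r s', j + d = m → I j r s' → s'.mem i 0 = j → Frame (MWIS.forP i b body) s s' →
      ∃ t s'' r', Exec B (.loop (V i <ₑ b) (body ;; MWIS.setV i (V i +ₑ .const 1))) s' t s'' ∧
        r + t ≤ r' + b.cost + 4 ∧ I m r' s'' ∧ s''.mem i 0 = m := by
    intro d
    induction d with
    | zero =>
      intro j r s' hj hI hij hf
      obtain rfl : j = m := by omega
      have hbe := hb j r s' le_rfl hI hij hf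
      refine ⟨_, s', r, Exec.loopDone ?_ ?_, ?_, hI, hij⟩
      · simp [hij, hm, hbe.1, hbe.2]
      · simp [hij, hbe.2]
      · simp; omega
    | succ d ih =>
      intro j r s' hj hI hij hf
      have hbe := hb j r s' (by omega) hI hij hf
      obtain ⟨T', t, s₁, hex, ht, hI'⟩ := hstep j r s' (by omega) hI hij hf
      have hs₁ : s₁.mem i 0 = j := by rw [hex.frame.1 i hi, hij]
      have hex2 : Exec B (MWIS.setV i (V i +ₑ .const 1)) s₁ 6 (s₁.setMem i 0 (j + 1)) := by
        have := Exec.store (B := B) s₁ i (.const 0) (V i +ₑ .const 1) (by simp)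
          (by simp [hs₁]; omega)
        simpa [hs₁, MWIS.setV] using this
      obtain ⟨t', s'', r', h1, h2, h3, h4⟩ := ih (j + 1) _ (s₁.setMem i 0 (j + 1)) (by omega) hI'
        (by simp) ((hf.trans hex.frame.forP_body).trans (Frame.forP_set _ _))
      refine ⟨_, s'', r', Exec.loopStep ?_ ?_ (hex.seq hex2) h1, ?_, h3, h4⟩
      · simp only [Expr.Fits, V_fits, hij, hbe.1, V_eval, hbe.2, WordOp.apply]
        refine ⟨by omega, trivial, ?_⟩
        split_ifs <;> omega
      · simp [hij, hbe.2]; omega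
      · simp; omega
  obtain ⟨t, s'', r', h1, h2, h3, h4⟩ := key m 0 0 (s.setMem i 0 0) (by omega) h0 (by simp)
    (Frame.forP_set _ _)
  refine ⟨_, s'', (Exec.store s i (.const 0) (.const 0) (by simp) (by simp)).seq h1, ?_, r', h3, h4⟩
  have := hT r' s'' h3
  simp; omega

/-- The rule for counting loops whose rounds have a uniform time bound. -/
theorem Runs.forP_const {B i m : ℕ} {b : Expr} {body : Prog} {s : State} (I : ℕ → State → Prop)
    (T : ℕ) (hm : m ≤ B) (hB : 1 ≤ B) (hi : body.modifies i = false)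
    (h0 : I 0 (s.setMem i 0 0))
    (hb : ∀ s', Frame (MWIS.forP i b body) s s' → b.Ev B s' m)
    (hstep : ∀ j s', j < m → I j s' → s'.mem i 0 = j → Frame (MWIS.forP i b body) s s' →
      Runs B body s' T fun s'' => I (j + 1) (s''.setMem i 0 (j + 1))) :
    Runs B (MWIS.forP i b body) s (m * (T + b.cost + 10) + b.cost + 7)
      fun s' => I m s' ∧ s'.mem i 0 = m := by
  refine (Runs.forP (fun j r s' => I j s' ∧ r = j * (T + b.cost + 10)) hm hB hi ⟨h0, by simp⟩
    (fun j r s' _ _ _ h => hb s' h) ?_ ?_).mono le_rfl ?_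
  · rintro j r s' hj ⟨hI, hr⟩ hij hf
    exact ⟨T, (hstep j s' hj hI hij hf).mono le_rfl fun s'' h _ => ⟨h, by rw [hr]; ring⟩⟩
  · rintro r s' ⟨_, hr⟩
    rw [hr]
  · rintro s' ⟨r, ⟨h, _⟩, h'⟩ _
    exact ⟨h, h'⟩

/-! ### Dynamic programming over a rooted tree decomposition -/

/-- A weighted graph with a refined tree decomposition whose vertices and nodes are natural numbers
below `n` and `N`; the bags of all other nodes are empty. The residual independence number is at
most `k + 1`. -/
structure Inst where
  (n N k ℓ : ℕ)
  adj : ℕ → ℕ → Prop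
  (X U : ℕ → Finset ℕ)
  w : ℕ → ℚ
  nb : ℕ → List ℕ
  adj_symm : ∀ u v, adj u v → adj v u
  w_nonneg : ∀ v, 0 ≤ w v
  X_sub : ∀ t, X t ⊆ Finset.range n
  X_out : ∀ t, N ≤ t → X t = ∅
  U_sub : ∀ t, U t ⊆ X t
  U_card : ∀ t, (U t).card ≤ ℓ
  resid : ∀ t A, A ⊆ X t → (∀ u ∈ A, ∀ v ∈ A, ¬ adj u v) → (A \ U t).card ≤ k + 1
  cover : ∀ v < n, ∃ t < N, v ∈ X t
  edge : ∀ u < n, ∀ v < n, adj u v → ∃ t < N, u ∈ X t ∧ v ∈ X t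
  N_pos : 0 < N
  nb_lt : ∀ t, ∀ u ∈ nb t, u < N
  nb_symm : ∀ t u, u ∈ nb t → t ∈ nb u
  nb_nodup : ∀ t, (nb t).Nodup
  nb_irrefl : ∀ t, t ∉ nb t
  nb_total : ∑ t ∈ Finset.range N, (nb t).length + 2 = 2 * N
  conn_nodes : ∀ A : Set ℕ, 0 ∈ A → (∀ a ∈ A, ∀ b ∈ nb a, b ∈ A) → ∀ t < N, t ∈ A
  conn : ∀ (v : ℕ) (A : Set ℕ) (s : ℕ), s ∈ A → v ∈ X s →
    (∀ a ∈ A, ∀ b ∈ nb a, v ∈ X b → b ∈ A) → ∀ s', v ∈ X s' → s' ∈ A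

namespace Inst

variable (I : Inst)

/-- `A` is an independent set. -/
def Indep (A : Finset ℕ) : Prop := ∀ u ∈ A, ∀ v ∈ A, ¬ I.adj u v

theorem Indep.mono {I : Inst} {A A' : Finset ℕ} (h : I.Indep A) (h' : A' ⊆ A) : I.Indep A' :=
  fun u hu v hv => h u (h' hu) v (h' hv)

/-- `ord` enumerates the nodes so that every node but the first, which has the parent `N`, comes
after its parent. -/
structure IsOrder (ord par : ℕ → ℕ) : Prop where
  lt : ∀ i < I.N, ord i < I.N
  inj : ∀ i < I.N, ∀ j < I.N, ord i = ord j → i = j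
  root : par (ord 0) = I.N
  step : ∀ i, 0 < i → i < I.N → ∃ j < i, par (ord i) = ord j ∧ ord i ∈ I.nb (ord j)

/-- The children of a node. -/
def children (par : ℕ → ℕ) (t : ℕ) : Finset ℕ := (Finset.range I.N).filter fun u => par u = t

variable {I} {ord par : ℕ → ℕ}

theorem X_lt {t v : ℕ} (h : v ∈ I.X t) : t < I.N := by
  by_contra h'
  simp [I.X_out t (by omega)] at h

/-! ### Rooted trees: parent edges, running intersection, topmost bags. -/

namespace IsOrder

theorem surj (h : I.IsOrder ord par) {t : ℕ} (ht : t < I.N) : ∃ i < I.N, ord i = t := by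
  have hm : Set.MapsTo ord (Finset.range I.N) (Finset.range I.N) := fun i hi => by
    simpa using h.lt i (by simpa using hi)
  have hi : Set.InjOn ord (Finset.range I.N) := fun i hi j hj hij =>
    h.inj i (by simpa using hi) j (by simpa using hj) hij
  have := Finset.surjOn_of_injOn_of_card_le ord hm hi le_rfl
  obtain ⟨i, hi, rfl⟩ := this (show t ∈ (Finset.range I.N : Set ℕ) by simpa using ht)
  exact ⟨i, by simpa using hi, rfl⟩

theorem par_le (h : I.IsOrder ord par) {t : ℕ} (ht : t < I.N) : par t ≤ I.N := by
  obtain ⟨i, hi, rfl⟩ := h.surj ht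
  rcases Nat.eq_zero_or_pos i with rfl | hi0
  · exact h.root.le
  · obtain ⟨j, hj, hp, -⟩ := h.step i hi0 hi
    rw [hp]
    exact (h.lt j (by omega)).le

/-- Double counting. The pairs (node, parent) and (parent, node) are `2 (N - 1)` distinct ordered
adjacent pairs, and by `nb_total` there are no more, so every edge joins a node to its parent. -/
theorem nb_eq (h : I.IsOrder ord par) {t u : ℕ} (ht : t < I.N) (hu : u ∈ I.nb t) :
    par u = t ∨ par t = u := by
  classical
  let E : Finset (Σ _ : ℕ, ℕ) := (Finset.range I.N).sigma fun t => (I.nb t).toFinset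
  have hE : E.card + 2 = 2 * I.N := by
    rw [← I.nb_total, Finset.card_sigma]
    congr 1
    exact Finset.sum_congr rfl fun t _ => List.toFinset_card_of_nodup (I.nb_nodup t)
  let P : Finset (Σ _ : ℕ, ℕ) := (Finset.Ico 1 I.N).image fun i => ⟨ord i, par (ord i)⟩
  let P' : Finset (Σ _ : ℕ, ℕ) := (Finset.Ico 1 I.N).image fun i => ⟨par (ord i), ord i⟩
  have hP : P.card = I.N - 1 := by
    rw [Finset.card_image_of_injOn, Nat.card_Ico]
    intro i hi j hj hij
    simp only [Finset.coe_Ico, Set.mem_Ico] at hi hj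
    exact h.inj i hi.2 j hj.2 (congrArg Sigma.fst hij)
  have hP' : P'.card = I.N - 1 := by
    rw [Finset.card_image_of_injOn, Nat.card_Ico]
    intro i hi j hj hij
    simp only [Finset.coe_Ico, Set.mem_Ico] at hi hj
    simp only [Sigma.mk.injEq, heq_eq_eq] at hij
    exact h.inj i hi.2 j hj.2 hij.2
  have hd : Disjoint P P' := by
    rw [Finset.disjoint_left]
    intro x hx hx'
    simp only [P, P', Finset.mem_image, Finset.mem_Ico] at hx hx'
    obtain ⟨i, ⟨hi, hi'⟩, rfl⟩ := hx
    obtain ⟨i₂, ⟨hi₂, hi₂'⟩, he⟩ := hx'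
    simp only [Sigma.mk.injEq, heq_eq_eq] at he
    obtain ⟨j, hj, hp, -⟩ := h.step i (by omega) hi'
    obtain ⟨j₂, hj₂, hp₂, -⟩ := h.step i₂ (by omega) hi₂'
    have h1 := h.inj i₂ hi₂' j (by omega) (he.2.trans hp)
    have h2 := h.inj i hi' j₂ (by omega) (he.1.symm.trans hp₂)
    omega
  have hsub : P ∪ P' ⊆ E := by
    intro x hx
    simp only [P, P', E, Finset.mem_union, Finset.mem_image, Finset.mem_Ico, Finset.mem_sigma,
      Finset.mem_range, List.mem_toFinset] at hx ⊢
    rcases hx with ⟨i, ⟨hi, hi'⟩, rfl⟩ | ⟨i, ⟨hi, hi'⟩, rfl⟩ <;>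
      obtain ⟨j, hj, hp, hn⟩ := h.step i (by omega) hi'
    · exact ⟨h.lt i hi', by simpa [hp] using I.nb_symm _ _ hn⟩
    · exact ⟨by simpa [hp] using h.lt j (by omega), by simpa [hp] using hn⟩
  have heq : P ∪ P' = E := by
    refine Finset.eq_of_subset_of_card_le hsub ?_
    rw [Finset.card_union_of_disjoint hd]
    omega
  have hx : (⟨t, u⟩ : Σ _ : ℕ, ℕ) ∈ P ∪ P' := by
    rw [heq]; simp [E, ht, hu]
  simp only [P, P', Finset.mem_union, Finset.mem_image, Finset.mem_Ico, Sigma.mk.injEq,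
    heq_eq_eq] at hx
  rcases hx with ⟨i, _, rfl, rfl⟩ | ⟨i, _, rfl, rfl⟩
  · exact Or.inr rfl
  · exact Or.inl rfl

theorem par_lt_of_ne (h : I.IsOrder ord par) {j : ℕ} (hj : j < I.N) (h0 : 0 < j) :
    par (ord j) < I.N := by
  obtain ⟨i, hi, hp, -⟩ := h.step j h0 hj
  rw [hp]; exact h.lt i (by omega)

/-- The running intersection property. -/
theorem rip (h : I.IsOrder ord par) {i j v : ℕ} (hij : i < j) (hj : j < I.N)
    (hvi : v ∈ I.X (ord i)) (hvj : v ∈ I.X (ord j)) : v ∈ I.X (par (ord j)) := by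
  by_contra hv
  -- The nodes related to `ord j` by iterating `r` form the subtree below `ord j`. Requiring `x < N`
  -- ends every chain at the fictitious parent `N` of the root.
  let r : ℕ → ℕ → Prop := fun x y => x < I.N ∧ par x = y
  have hA : ∀ a, Relation.ReflTransGen r a (ord j) → ∀ i' < I.N, ord i' = a → j ≤ i' := by
    intro a ha
    induction ha using Relation.ReflTransGen.head_induction_on with
    | refl => intro i' hi' he; exact (h.inj _ hi' _ hj he).ge
    | head hxy hy ih =>
      rintro i' hi' rfl
      obtain ⟨-, rfl⟩ := hxy
      rcases Nat.eq_zero_or_pos i' with rfl | h0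
      · rw [h.root] at hy
        have := h.lt j hj
        rcases hy.cases_head with he | ⟨c, hc, -⟩
        · omega
        · exact absurd hc.1 (lt_irrefl _)
      · obtain ⟨j', hj', hp, -⟩ := h.step i' h0 hi'
        have := ih j' (by omega) hp.symm
        omega
  -- The subtree is closed under neighbours whose bags contain `v`: the only edge leaving it goes
  -- from `ord j` to its parent, whose bag misses `v`. So it would contain `ord i`, although all its
  -- nodes have index at least `j`.
  have := I.conn v {a | Relation.ReflTransGen r a (ord j)} (ord j) .refl hvj ?_ _ hvi
  · have := hA _ this i (by omega) rfl
    omega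
  · intro a ha b hb hvb
    have haN : a < I.N := I.nb_lt b a (I.nb_symm _ _ hb)
    rcases h.nb_eq haN hb with hp | hp
    · exact .head ⟨X_lt hvb, hp⟩ ha
    · rcases Relation.ReflTransGen.cases_head ha with rfl | ⟨c, ⟨-, hc⟩, hc'⟩
      · exact absurd (hp ▸ hvb) hv
      · rw [← hp, hc]; exact hc'

theorem ne_root (h : I.IsOrder ord par) {t : ℕ} (ht : t < I.N) (hr : t ≠ ord 0) :
    par t < I.N := by
  obtain ⟨j, hj, rfl⟩ := h.surj ht
  exact h.par_lt_of_ne hj (by rcases Nat.eq_zero_or_pos j with rfl | h0; exacts [absurd rfl hr, h0])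

/-- Every vertex lies in exactly one bag that is not followed by a bag of the parent. -/
theorem exists_top (h : I.IsOrder ord par) {v : ℕ} (hv : v < I.n) :
    ∃ t < I.N, ∀ t' < I.N, (v ∈ I.X t' ∧ v ∉ I.X (par t')) ↔ t' = t := by
  classical
  have hex : ∃ i, i < I.N ∧ v ∈ I.X (ord i) := by
    obtain ⟨t, ht, hvt⟩ := I.cover v hv
    obtain ⟨i, hi, rfl⟩ := h.surj ht
    exact ⟨i, hi, hvt⟩
  -- The topmost bag is the first one in the order that contains `v`; `rip` excludes all later
  -- candidates.
  obtain ⟨hiN, hvi⟩ := Nat.find_spec hex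
  have hmin : ∀ j < Nat.find hex, v ∉ I.X (ord j) := fun j hj hvj =>
    Nat.find_min hex hj ⟨by omega, hvj⟩
  generalize Nat.find hex = i at *
  refine ⟨ord i, h.lt i hiN, fun t' ht' => ⟨?_, ?_⟩⟩
  · rintro ⟨h1, h2⟩
    obtain ⟨j, hj, rfl⟩ := h.surj ht'
    rcases lt_trichotomy i j with hij | rfl | hij
    · exact absurd (h.rip hij hj hvi h1) h2
    · rfl
    · exact absurd h1 (hmin j hij)
  · rintro rfl
    refine ⟨hvi, fun hp => ?_⟩
    rcases Nat.eq_zero_or_pos i with rfl | h0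
    · rw [h.root, I.X_out _ le_rfl] at hp
      simp at hp
    · obtain ⟨j, hj, hpj, -⟩ := h.step i h0 hiN
      exact hmin j hj (hpj ▸ hp)

/-- By `exists_top` each vertex of `O` is counted at exactly one node. -/
theorem sum_top (h : I.IsOrder ord par) {O : Finset ℕ} (hO : O ⊆ Finset.range I.n) (w : ℕ → ℚ) :
    ∑ t ∈ Finset.range I.N, ∑ v ∈ (O ∩ I.X t) \ I.X (par t), w v = ∑ v ∈ O, w v := by
  have : ∀ t, ∑ v ∈ (O ∩ I.X t) \ I.X (par t), w v =
      ∑ v ∈ O, if v ∈ I.X t ∧ v ∉ I.X (par t) then w v else 0 := by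
    intro t
    rw [← Finset.sum_filter]
    congr 1
    ext v; simp [and_assoc]
  simp only [this]
  rw [Finset.sum_comm]
  refine Finset.sum_congr rfl fun v hv => ?_
  obtain ⟨t, ht, hu⟩ := h.exists_top (Finset.mem_range.1 (hO hv))
  rw [Finset.sum_eq_single t, if_pos ((hu t ht).2 rfl)]
  · intro t' ht' hne
    rw [if_neg]
    rwa [hu t' (Finset.mem_range.1 ht')]
  · intro h'; simp [ht] at h'

/-- Every node other than the root is the child of exactly one node. -/
theorem sum_children (h : I.IsOrder ord par) (f : ℕ → ℚ) :
    f (ord 0) + ∑ t ∈ Finset.range I.N, ∑ u ∈ I.children par t, f u =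
      ∑ t ∈ Finset.range I.N, f t := by
  have h0 := h.lt 0 I.N_pos
  have h1 : ∀ t ∈ Finset.range I.N, ∑ u ∈ I.children par t, f u =
      ∑ u ∈ (Finset.range I.N).erase (ord 0), if par u = t then f u else 0 := by
    intro t ht
    rw [← Finset.sum_filter]
    congr 1
    ext u
    simp only [children, Finset.mem_filter, Finset.mem_range, Finset.mem_erase]
    refine ⟨fun hu => ⟨⟨?_, hu.1⟩, hu.2⟩, fun hu => ⟨hu.1.2, hu.2⟩⟩
    rintro rfl
    have := h.root.symm.trans hu.2
    simp at ht; omega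
  rw [Finset.sum_congr rfl h1, Finset.sum_comm,
    ← Finset.add_sum_erase _ _ (Finset.mem_range.2 h0)]
  congr 1
  refine Finset.sum_congr rfl fun u hu => ?_
  simp only [Finset.mem_erase, Finset.mem_range] at hu
  rw [Finset.sum_ite_eq, if_pos]
  exact Finset.mem_range.2 (h.ne_root hu.2 hu.1)

end IsOrder

/-! ### Local optimality as a certificate for global optimality. -/

/-- The value of the choice `J` at the node `t`, without the weight of the vertices that also
belong to the bag of the parent; `μ u K` is the value contributed by the child `u`. -/
def cval (I : Inst) (par : ℕ → ℕ) (μ : ℕ → Finset ℕ → ℚ) (t : ℕ) (J : Finset ℕ) : ℚ :=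
  ∑ v ∈ J \ I.X (par t), I.w v + ∑ u ∈ I.children par t, μ u (J ∩ I.X u ∩ I.X t)

/-- Telescoping, valid for arbitrary `μ`: each non-root node contributes its term both as a child
inside some `cval` and on the right, so only the root term is left over, and its trace is empty
because the bag of `N` is. -/
theorem IsOrder.sum_cval (h : I.IsOrder ord par) {O : Finset ℕ} (hO : O ⊆ Finset.range I.n)
    (μ : ℕ → Finset ℕ → ℚ) :
    ∑ t ∈ Finset.range I.N, I.cval par μ t (O ∩ I.X t) + μ (ord 0) ∅ =
      ∑ v ∈ O, I.w v + ∑ t ∈ Finset.range I.N, μ t (O ∩ I.X t ∩ I.X (par t)) := by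
  have h1 : ∑ t ∈ Finset.range I.N, ∑ u ∈ I.children par t, μ u (O ∩ I.X t ∩ I.X u ∩ I.X t) =
      ∑ t ∈ Finset.range I.N, ∑ u ∈ I.children par t, μ u (O ∩ I.X u ∩ I.X (par u)) := by
    refine Finset.sum_congr rfl fun t _ => Finset.sum_congr rfl fun u hu => ?_
    rw [(Finset.mem_filter.1 hu).2]
    congr 1
    ext v; simp only [Finset.mem_inter]; tauto
  have h2 := h.sum_children fun u => μ u (O ∩ I.X u ∩ I.X (par u))
  simp only [h.root, I.X_out _ le_rfl, Finset.inter_empty] at h2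
  simp only [cval, Finset.sum_add_distrib, h.sum_top hO, h1]
  linarith

/-- A set that is locally optimal at every node is a maximum-weight independent set. -/
theorem IsOrder.optimal (h : I.IsOrder ord par) {μ : ℕ → Finset ℕ → ℚ} {O : Finset ℕ}
    (hO : O ⊆ Finset.range I.n)
    (hle : ∀ t < I.N, ∀ J ⊆ I.X t, I.Indep J → I.cval par μ t J ≤ μ t (J ∩ I.X t ∩ I.X (par t)))
    (heq : ∀ t < I.N, I.Indep (O ∩ I.X t) ∧
      I.cval par μ t (O ∩ I.X t) = μ t (O ∩ I.X t ∩ I.X (par t))) :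
    I.Indep O ∧ ∀ J ⊆ Finset.range I.n, I.Indep J → ∑ v ∈ J, I.w v ≤ ∑ v ∈ O, I.w v := by
  constructor
  · intro u hu v hv huv
    obtain ⟨t, ht, hut, hvt⟩ := I.edge u (by simpa using hO hu) v (by simpa using hO hv) huv
    exact (heq t ht).1 u (Finset.mem_inter.2 ⟨hu, hut⟩) v (Finset.mem_inter.2 ⟨hv, hvt⟩) huv
  -- Both weights are compared with `μ (ord 0) ∅`: it bounds the weight of `J` and equals the weight
  -- of `O`.
  · intro J hJ hJi
    have h1 := h.sum_cval hO μ
    have h2 := h.sum_cval hJ μ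
    have h3 : ∑ t ∈ Finset.range I.N, I.cval par μ t (J ∩ I.X t) ≤
        ∑ t ∈ Finset.range I.N, μ t (J ∩ I.X t ∩ I.X (par t)) := by
      refine Finset.sum_le_sum fun t ht => ?_
      have := hle t (Finset.mem_range.1 ht) (J ∩ I.X t) Finset.inter_subset_right
        (hJi.mono Finset.inter_subset_left)
      rwa [Finset.inter_assoc J, Finset.inter_self] at this
    rw [Finset.sum_congr rfl fun t ht => (heq t (Finset.mem_range.1 ht)).2] at h1
    linarith

end Inst

/-! ### Encoding subsets of a bag by numbers -/

/-- The number of elements of `S` below `v`. -/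
def cnt (S : Finset ℕ) (v : ℕ) : ℕ := (S.filter (· < v)).card

theorem cnt_zero (S : Finset ℕ) : cnt S 0 = 0 := by simp [cnt]

theorem cnt_succ (S : Finset ℕ) (v : ℕ) : cnt S (v + 1) = cnt S v + if v ∈ S then 1 else 0 := by
  unfold cnt
  have : S.filter (· < v + 1) = S.filter (· < v) ∪ if v ∈ S then {v} else ∅ := by
    ext x
    split_ifs with h
    · simp only [Finset.mem_filter, Finset.mem_union, Finset.mem_singleton]
      constructor
      · rintro ⟨h1, h2⟩
        by_cases hx : x = v
        · exact Or.inr hx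
        · exact Or.inl ⟨h1, by omega⟩
      · rintro (⟨h1, h2⟩ | rfl)
        · exact ⟨h1, by omega⟩
        · exact ⟨h, by omega⟩
    · simp only [Finset.mem_filter, Finset.union_empty]
      refine and_congr_right fun h1 => ⟨fun h2 => ?_, fun h2 => by omega⟩
      rcases Nat.lt_succ_iff_lt_or_eq.1 h2 with h3 | rfl
      exacts [h3, absurd h1 h]
  rw [this, Finset.card_union_of_disjoint]
  · split_ifs <;> simp
  · split_ifs <;> simp

theorem cnt_le (S : Finset ℕ) (v : ℕ) : cnt S v ≤ S.card := Finset.card_filter_le _ _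

theorem cnt_eq_card {S : Finset ℕ} {n : ℕ} (h : S ⊆ Finset.range n) : cnt S n = S.card := by
  unfold cnt
  rw [Finset.filter_true_of_mem]
  intro x hx; simpa using h hx

theorem cnt_lt_card {S : Finset ℕ} {v : ℕ} (h : v ∈ S) : cnt S v < S.card := by
  have := cnt_succ S v
  rw [if_pos h] at this
  have := cnt_le S (v + 1)
  omega

/-- The bit mask of `S ∩ U` among the elements of `U` below `j`. -/
def encMask (S U : Finset ℕ) : ℕ → ℕ
  | 0 => 0
  | j + 1 => encMask S U j + if j ∈ U ∧ j ∈ S then 2 ^ cnt U j else 0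

/-- The elements of `S \ U` below `j` as digits in base `n + 1`. -/
def encDigits (n : ℕ) (S U : Finset ℕ) : ℕ → ℕ
  | 0 => 0
  | j + 1 => if j ∉ U ∧ j ∈ S then encDigits n S U j * (n + 1) + (j + 1) else encDigits n S U j

theorem encMask_lt (S U : Finset ℕ) (j : ℕ) : encMask S U j < 2 ^ cnt U j := by
  induction j with
  | zero => simp [encMask]
  | succ j ih =>
    rw [encMask, cnt_succ]
    by_cases hU : j ∈ U <;> by_cases hS : j ∈ S <;> simp [hU, hS, pow_succ] <;> omega

/-- The arbitrary higher bits `r` make the induction work, since each step moves the top bit of the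
mask into `r`; later `r` is the digit part of a code. -/
theorem encMask_bit (S U : Finset ℕ) (j r : ℕ) : ∀ v < j, v ∈ U →
    ((r * 2 ^ cnt U j + encMask S U j) / 2 ^ cnt U v % 2 = 1 ↔ v ∈ S) := by
  induction j generalizing r with
  | zero => intro v hv; omega
  | succ j ih =>
    intro v hv hU
    by_cases hjU : j ∈ U
    · have h : r * 2 ^ cnt U (j + 1) + encMask S U (j + 1) =
          (2 * r + if j ∈ S then 1 else 0) * 2 ^ cnt U j + encMask S U j := by
        rw [encMask, cnt_succ]
        by_cases hS : j ∈ S <;> simp [hjU, hS, pow_succ] <;> ring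
      rw [h]
      rcases Nat.lt_succ_iff_lt_or_eq.1 hv with hlt | rfl
      · exact ih _ v hlt hU
      · rw [add_comm, Nat.add_mul_div_right _ _ (by positivity),
          Nat.div_eq_of_lt (encMask_lt S U v)]
        by_cases hS : v ∈ S <;> simp [hS, Nat.add_mod]
    · have hvj : v < j := by
        rcases Nat.lt_succ_iff_lt_or_eq.1 hv with hlt | rfl
        exacts [hlt, absurd hU hjU]
      rw [encMask, cnt_succ]
      simp only [hjU, false_and, if_false, add_zero]
      exact ih r v hvj hU

theorem encDigits_lt {n : ℕ} (S U : Finset ℕ) {j : ℕ} (hj : j ≤ n) :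
    encDigits n S U j < (n + 1) ^ cnt (S \ U) j := by
  induction j with
  | zero => simp [encDigits]
  | succ j ih =>
    have := ih (by omega)
    rw [encDigits, cnt_succ]
    by_cases h : j ∉ U ∧ j ∈ S
    · rw [if_pos h, if_pos (by simpa using h.symm), pow_succ]
      nlinarith
    · rw [if_neg h, if_neg (by rw [Finset.mem_sdiff]; tauto)]
      simpa using this

/-- A vertex `v` is written as the digit `v + 1`, so the zeros in unused positions never stand for a
vertex. Each new element becomes the lowest digit and shifts the others up. -/
theorem encDigits_digit {n : ℕ} (S U : Finset ℕ) {j : ℕ} (hj : j ≤ n) (v : ℕ) :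
    (∃ i, encDigits n S U j / (n + 1) ^ i % (n + 1) = v + 1) ↔ v < j ∧ v ∈ S ∧ v ∉ U := by
  induction j with
  | zero => simp [encDigits]
  | succ j ih =>
    have ih := ih (by omega)
    rw [encDigits]
    by_cases h : j ∉ U ∧ j ∈ S
    · rw [if_pos h]
      have h0 : (encDigits n S U j * (n + 1) + (j + 1)) / (n + 1) ^ 0 % (n + 1) = j + 1 := by
        rw [pow_zero, Nat.div_one, Nat.mul_add_mod_of_lt (by omega)]
      have hs : ∀ i, (encDigits n S U j * (n + 1) + (j + 1)) / (n + 1) ^ (i + 1) =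
          encDigits n S U j / (n + 1) ^ i := by
        intro i
        rw [pow_succ', ← Nat.div_div_eq_div_mul, Nat.add_comm (_ * _),
          Nat.add_mul_div_right _ _ (by omega), Nat.div_eq_of_lt (show j + 1 < n + 1 by omega), zero_add]
      constructor
      · rintro ⟨_ | i, hi⟩
        · rw [h0] at hi
          obtain rfl : j = v := by omega
          exact ⟨by omega, h.2, h.1⟩
        · rw [hs] at hi
          have := ih.1 ⟨i, hi⟩
          exact ⟨by omega, this.2⟩
      · rintro ⟨h1, h2⟩
        rcases Nat.lt_succ_iff_lt_or_eq.1 h1 with h3 | rfl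
        · obtain ⟨i, hi⟩ := ih.2 ⟨h3, h2⟩
          exact ⟨i + 1, by rw [hs]; exact hi⟩
        · exact ⟨0, h0⟩
    · rw [if_neg h, ih]
      constructor
      · rintro ⟨h1, h2⟩; exact ⟨by omega, h2⟩
      · rintro ⟨h1, h2⟩
        rcases Nat.lt_succ_iff_lt_or_eq.1 h1 with h3 | rfl
        exacts [⟨h3, h2⟩, absurd h2.symm h]

/-! ### Codes relative to a bag, and the role of the top digit. -/

namespace Inst

variable (I : Inst)

/-- The code of the subset `S` of the bag of `t`. -/
def enc (t : ℕ) (S : Finset ℕ) : ℕ :=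
  encDigits I.n S (I.U t) I.n * 2 ^ (I.U t).card + encMask S (I.U t) I.n

/-- The subset of the bag of `t` with code `z`. -/
def dec (t z : ℕ) : Finset ℕ :=
  (Finset.range I.n).filter fun v =>
    (v ∈ I.U t ∧ z / 2 ^ cnt (I.U t) v % 2 = 1) ∨
      (v ∈ I.X t ∧ ∃ i < I.k + 1, z / 2 ^ (I.U t).card / (I.n + 1) ^ i % (I.n + 1) = v + 1)

/-- The number of codes with top digit `0`. -/
def low (t : ℕ) : ℕ := 2 ^ (I.U t).card * (I.n + 1) ^ I.k

variable {I}

theorem lt_n {t v : ℕ} (h : v ∈ I.X t) : v < I.n := by simpa using I.X_sub t h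

theorem dec_sub (t z : ℕ) : I.dec t z ⊆ I.X t := by
  intro v hv
  simp only [dec, Finset.mem_filter] at hv
  rcases hv.2 with h | h
  exacts [I.U_sub t h.1, h.1]

theorem U_sub_range (t : ℕ) : I.U t ⊆ Finset.range I.n := (I.U_sub t).trans (I.X_sub t)

theorem enc_lt {t : ℕ} {S : Finset ℕ} (h : (S \ I.U t).card ≤ I.k + 1) :
    I.enc t S < I.low t * (I.n + 1) := by
  have h1 := encMask_lt S (I.U t) I.n
  rw [cnt_eq_card (U_sub_range t)] at h1
  have h2 : encDigits I.n S (I.U t) I.n < (I.n + 1) ^ (I.k + 1) :=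
    (encDigits_lt S (I.U t) le_rfl).trans_le
      (Nat.pow_le_pow_right (by omega) ((cnt_le _ _).trans h))
  calc I.enc t S < (encDigits I.n S (I.U t) I.n + 1) * 2 ^ (I.U t).card := by
        unfold enc; rw [add_mul]; omega
    _ ≤ (I.n + 1) ^ (I.k + 1) * 2 ^ (I.U t).card := Nat.mul_le_mul_right _ h2
    _ = I.low t * (I.n + 1) := by unfold low; ring

/-- Only this direction is needed. Codes outside the image of `enc` also decode to subsets of the
bag, so enumerating them is redundant but harmless. -/
theorem dec_enc {t : ℕ} {S : Finset ℕ} (hS : S ⊆ I.X t) (h : (S \ I.U t).card ≤ I.k + 1) :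
    I.dec t (I.enc t S) = S := by
  have hc := cnt_eq_card (U_sub_range (I := I) t)
  have h1 := encMask_lt S (I.U t) I.n
  have hdiv : I.enc t S / 2 ^ (I.U t).card = encDigits I.n S (I.U t) I.n := by
    rw [hc] at h1
    unfold enc
    rw [Nat.add_comm, Nat.add_mul_div_right _ _ (by positivity), Nat.div_eq_of_lt h1, zero_add]
  ext v
  simp only [dec, Finset.mem_filter, Finset.mem_range, hdiv]
  have hdig := encDigits_digit S (I.U t) (le_refl I.n) v
  have hbit := encMask_bit S (I.U t) I.n (encDigits I.n S (I.U t) I.n) v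
  rw [hc] at hbit
  constructor
  · rintro ⟨hv, ⟨hU, hb⟩ | ⟨hX, i, -, hi⟩⟩
    · exact (hbit hv hU).1 hb
    · exact (hdig.1 ⟨i, hi⟩).2.1
  · intro hv
    refine ⟨lt_n (hS hv), ?_⟩
    by_cases hU : v ∈ I.U t
    · exact Or.inl ⟨hU, (hbit (lt_n (hS hv)) hU).2 hv⟩
    · obtain ⟨i, hi⟩ := hdig.2 ⟨lt_n (hS hv), hv, hU⟩
      refine Or.inr ⟨hS hv, i, ?_, hi⟩
      by_contra hik
      have h2 : encDigits I.n S (I.U t) I.n < (I.n + 1) ^ i :=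
        (encDigits_lt S (I.U t) le_rfl).trans_le
          (Nat.pow_le_pow_right (by omega) ((cnt_le _ _).trans (by omega)))
      rw [Nat.div_eq_of_lt h2] at hi
      simp at hi

theorem Indep.dec_enc {t : ℕ} {S : Finset ℕ} (h : I.Indep S) (hS : S ⊆ I.X t) :
    I.dec t (I.enc t S) = S := Inst.dec_enc hS (I.resid t S hS h)

/-- The effect of the top digit. -/
theorem mem_dec_add {t d y : ℕ} (hd : d ≤ I.n) (hy : y < I.low t) (v : ℕ) :
    v ∈ I.dec t (d * I.low t + y) ↔ v ∈ I.dec t y ∨ (v ∈ I.X t ∧ d = v + 1) := by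
  have hq : (d * I.low t + y) / 2 ^ (I.U t).card =
      d * (I.n + 1) ^ I.k + y / 2 ^ (I.U t).card := by
    rw [show d * I.low t + y = y + (d * (I.n + 1) ^ I.k) * 2 ^ (I.U t).card by unfold low; ring,
      Nat.add_mul_div_right _ _ (by positivity), Nat.add_comm]
  have hyq : y / 2 ^ (I.U t).card < (I.n + 1) ^ I.k := by
    rw [Nat.div_lt_iff_lt_mul (by positivity), mul_comm]; exact hy
  have hbit : ∀ v ∈ I.U t, (d * I.low t + y) / 2 ^ cnt (I.U t) v % 2 =
      y / 2 ^ cnt (I.U t) v % 2 := by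
    intro v hv
    -- The bit of `v` lies strictly below `2 ^ |U_t|`, so `d * low` is an even multiple of `2 ^ cnt`
    -- and does not affect it.
    obtain ⟨c, hc⟩ := Nat.exists_eq_add_of_lt (cnt_lt_card hv)
    rw [show d * I.low t + y =
      y + (2 * (d * (I.n + 1) ^ I.k * 2 ^ c)) * 2 ^ cnt (I.U t) v by unfold low; rw [hc]; ring,
      Nat.add_mul_div_right _ _ (by positivity)]
    omega
  have hdig : ∀ i < I.k, (d * (I.n + 1) ^ I.k + y / 2 ^ (I.U t).card) / (I.n + 1) ^ i %
      (I.n + 1) = y / 2 ^ (I.U t).card / (I.n + 1) ^ i % (I.n + 1) := by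
    intro i hi
    obtain ⟨c, hc⟩ := Nat.exists_eq_add_of_lt hi
    rw [show d * (I.n + 1) ^ I.k + y / 2 ^ (I.U t).card =
      y / 2 ^ (I.U t).card + ((I.n + 1) * (d * (I.n + 1) ^ c)) * (I.n + 1) ^ i by rw [hc]; ring,
      Nat.add_mul_div_right _ _ (by positivity), Nat.add_mul_mod_self_left]
  have htop : (d * (I.n + 1) ^ I.k + y / 2 ^ (I.U t).card) / (I.n + 1) ^ I.k % (I.n + 1) = d := by
    rw [Nat.add_comm, Nat.add_mul_div_right _ _ (by positivity), Nat.div_eq_of_lt hyq, zero_add,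
      Nat.mod_eq_of_lt (by omega)]
  simp only [dec, Finset.mem_filter, Finset.mem_range, hq]
  constructor
  · rintro ⟨hv, ⟨hU, hb⟩ | ⟨hX, i, hi, hb⟩⟩
    · exact Or.inl ⟨hv, Or.inl ⟨hU, by rwa [hbit v hU] at hb⟩⟩
    · rcases Nat.lt_succ_iff_lt_or_eq.1 hi with hi' | rfl
      · exact Or.inl ⟨hv, Or.inr ⟨hX, i, hi, by rwa [hdig i hi'] at hb⟩⟩
      · exact Or.inr ⟨hX, by rwa [htop] at hb⟩
  · rintro (⟨hv, ⟨hU, hb⟩ | ⟨hX, i, hi, hb⟩⟩ | ⟨hX, rfl⟩)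
    · exact ⟨hv, Or.inl ⟨hU, by rwa [hbit v hU]⟩⟩
    · rcases Nat.lt_succ_iff_lt_or_eq.1 hi with hi' | rfl
      · exact ⟨hv, Or.inr ⟨hX, i, hi, by rwa [hdig i hi']⟩⟩
      · rw [Nat.div_eq_of_lt hyq] at hb; simp at hb
    · exact ⟨lt_n hX, Or.inr ⟨hX, I.k, by omega, htop⟩⟩

end Inst

/-! ### The input in memory -/

open scoped Classical in
/-- The truth value of a proposition as a word. -/
noncomputable def flag (p : Prop) : ℕ := if p then 1 else 0

theorem flag_le (p : Prop) : flag p ≤ 1 := by unfold flag; split_ifs <;> simp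

@[simp] theorem flag_eq_zero {p : Prop} : flag p = 0 ↔ ¬ p := by unfold flag; split_ifs <;> simp_all

@[simp] theorem flag_eq_one {p : Prop} : flag p = 1 ↔ p := by unfold flag; split_ifs <;> simp_all

theorem flag_mul (p q : Prop) : flag p * flag q = flag (p ∧ q) := by
  unfold flag; split_ifs <;> simp_all

theorem one_sub_flag (p : Prop) : 1 - flag p = flag (¬ p) := by
  unfold flag; split_ifs <;> simp_all

theorem flag_of {p : Prop} (h : p) : flag p = 1 := flag_eq_one.2 h

theorem flag_of_not {p : Prop} (h : ¬ p) : flag p = 0 := flag_eq_zero.2 h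

/-- No input array is written to. -/
def Prog.keepsInput (p : Prog) : Bool :=
  !(p.modifies 0 || p.modifies 1 || p.modifies 2 || p.modifies 3 || p.modifies 4 ||
    p.modifies 5 || p.wmodifies 0)

namespace Inst

variable (I : Inst)

/-- The memory contains the input. -/
structure Holds (s : State) : Prop where
  n : s.mem 0 0 = I.n
  N : s.mem 0 1 = I.N
  adj : ∀ u < I.n, ∀ v < I.n, s.mem 1 (u * I.n + v) = flag (I.adj u v)
  off : ∀ t < I.N, s.mem 2 (t + 1) = s.mem 2 t + (I.nb t).length
  off_le : ∀ t ≤ I.N, s.mem 2 t ≤ 2 * I.N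
  nbr : ∀ t < I.N, ∀ (i : ℕ) (h : i < (I.nb t).length), s.mem 3 (s.mem 2 t + i) = (I.nb t)[i]
  X : ∀ t ≤ I.N, ∀ v < I.n, s.mem 4 (t * I.n + v) = flag (v ∈ I.X t)
  U : ∀ t ≤ I.N, ∀ v < I.n, s.mem 5 (t * I.n + v) = flag (v ∈ I.U t)
  w : ∀ v < I.n, s.wmem 0 v = I.w v

/-- The word bound is large enough. -/
structure Fit (B : ℕ) : Prop where
  main : 4 * (2 ^ I.ℓ * (I.n + 1) ^ (I.k + 2) * (I.N + 1)) ≤ B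
  digits : I.k + 1 ≤ B

variable {I} {B : ℕ} {s s' : State}

theorem Holds.congr (h : I.Holds s) (h0 : s'.mem 0 = s.mem 0) (h1 : s'.mem 1 = s.mem 1)
    (h2 : s'.mem 2 = s.mem 2) (h3 : s'.mem 3 = s.mem 3) (h4 : s'.mem 4 = s.mem 4)
    (h5 : s'.mem 5 = s.mem 5) (hw : s'.wmem 0 = s.wmem 0) : I.Holds s' := by
  constructor <;> simp only [h0, h1, h2, h3, h4, h5, hw]
  exacts [h.n, h.N, h.adj, h.off, h.off_le, h.nbr, h.X, h.U, h.w]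

theorem Holds.frame {p : Prog} (h : I.Holds s) (hf : Frame p s s') (hp : p.keepsInput = true) :
    I.Holds s' := by
  simp only [Prog.keepsInput, Bool.not_eq_true', Bool.or_eq_false_iff] at hp
  exact h.congr (hf.1 _ (by simp [hp])) (hf.1 _ (by simp [hp])) (hf.1 _ (by simp [hp]))
    (hf.1 _ (by simp [hp])) (hf.1 _ (by simp [hp])) (hf.1 _ (by simp [hp])) (hf.2 _ (by simp [hp]))

theorem Holds.setMem (h : I.Holds s) {a : ℕ} (ha : 5 < a) (i x : ℕ) : I.Holds (s.setMem a i x) := by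
  apply h.congr <;> simp <;> intro h' <;> omega

theorem Holds.setWMem (h : I.Holds s) {a : ℕ} (ha : 0 < a) (i : ℕ) (x : ℚ) :
    I.Holds (s.setWMem a i x) := by
  apply h.congr <;> simp
  omega

theorem Fit.base (hB : I.Fit B) : 4 * ((I.n + 1) * (I.N + 1)) ≤ B := by
  refine le_trans ?_ hB.main
  refine Nat.mul_le_mul_left _ (Nat.mul_le_mul_right _ ?_)
  calc I.n + 1 = 1 * (I.n + 1) ^ 1 := by ring
    _ ≤ _ := Nat.mul_le_mul Nat.one_le_two_pow (Nat.pow_le_pow_right (by omega) (by omega))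

theorem Fit.addr (hB : I.Fit B) {t v : ℕ} (ht : t ≤ I.N) (hv : v < I.n) : t * I.n + v ≤ B := by
  have := hB.base
  nlinarith

theorem Fit.n_le (hB : I.Fit B) : 4 * (I.n + 1) ≤ B := by
  have := hB.base
  nlinarith

theorem Fit.N_le (hB : I.Fit B) : 4 * (I.N + 1) ≤ B := by
  have := hB.base
  nlinarith

theorem low_mul_le (t : ℕ) : I.low t * (I.n + 1) ≤ 2 ^ I.ℓ * (I.n + 1) ^ (I.k + 1) := by
  unfold low
  rw [mul_assoc, ← pow_succ]
  exact Nat.mul_le_mul_right _ (Nat.pow_le_pow_right (by omega) (I.U_card t))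

theorem Fit.code_succ (hB : I.Fit B) {t : ℕ} :
    4 * (I.low t * (I.n + 1) * (I.n + 1) * (I.N + 1)) ≤ B := by
  refine le_trans (Nat.mul_le_mul_left _ (Nat.mul_le_mul_right _ ?_)) hB.main
  rw [pow_succ _ (I.k + 1), ← mul_assoc]
  exact Nat.mul_le_mul_right _ (low_mul_le t)

theorem Fit.code (hB : I.Fit B) {t z u : ℕ} (hz : z < I.low t * (I.n + 1)) (hu : u ≤ I.N) :
    z * (I.N + 1) + u ≤ B := by
  have h1 := hB.code_succ (t := t)
  have h2 : (z + 1) * (I.N + 1) ≤ I.low t * (I.n + 1) * (I.N + 1) := Nat.mul_le_mul_right _ hz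
  have h3 : I.low t * (I.n + 1) * (I.N + 1) ≤ I.low t * (I.n + 1) * (I.n + 1) * (I.N + 1) :=
    Nat.mul_le_mul_right _ (Nat.le_mul_of_pos_right _ (by omega))
  have h4 : (z + 1) * (I.N + 1) = z * (I.N + 1) + I.N + 1 := by ring
  omega

theorem Fit.code' (hB : I.Fit B) {t z : ℕ} (hz : z < I.low t * (I.n + 1)) : z * (I.n + 1) ≤ B := by
  have h1 := hB.code_succ (t := t)
  have h2 : z * (I.n + 1) ≤ I.low t * (I.n + 1) * (I.n + 1) := Nat.mul_le_mul_right _ hz.le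
  have h3 : I.low t * (I.n + 1) * (I.n + 1) ≤ I.low t * (I.n + 1) * (I.n + 1) * (I.N + 1) :=
    Nat.le_mul_of_pos_right _ (by omega)
  omega

end Inst

/-! ### Decoding -/

/-- Write the `0/1` vector of the set with code `V 16` at the node `V 14` into array `9`. -/
def decP (k : ℕ) : Prog :=
  setV 17 (V 16) ;;
  forP 18 (V 0) (.cond (.read 5 (V 14 *ₑ V 0 +ₑ V 18))
    (.store 9 (V 18) (V 17 %ₑ .const 2) ;; setV 17 (V 17 /ₑ .const 2))
    (.store 9 (V 18) (.const 0))) ;;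
  forP 19 (.const (k + 1)) (
    setV 20 (V 17 %ₑ (V 0 +ₑ .const 1)) ;;
    setV 17 (V 17 /ₑ (V 0 +ₑ .const 1)) ;;
    .cond (V 20) (.cond (.read 4 (V 14 *ₑ V 0 +ₑ (V 20 -ₑ .const 1)))
      (.store 9 (V 20 -ₑ .const 1) (.const 1)) .skip) .skip)

/-- Cell `17` holds what remains of the code: it is halved once per element of `U_t`, after which
exactly the digits are left. The two loop invariants are the two disjuncts in `dec`, the second with
the digits read so far. -/
theorem Inst.Holds.decP {I : Inst} {B t z : ℕ} {s : State} (hs : I.Holds s) (hB : I.Fit B)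
    (ht : t ≤ I.N) (h14 : s.mem 14 0 = t) (h16 : s.mem 16 0 = z) (hz : z ≤ B) :
    Runs B (decP I.k) s (100 * (I.n + I.k + 1)) fun s' =>
      ∀ v < I.n, s'.mem 9 v = flag (v ∈ I.dec t z) := by
  have hnB := hB.n_le
  have hNB := hB.N_le
  have hkB := hB.digits
  have hn := hs.n
  refine Runs.weaken (Runs.setV_seq (ev := z) ⟨by simp [h16, hz], by simp [h16]⟩
    (Runs.seq (T₂ := (I.k + 1) * 51 + 8) (Runs.forP_const (m := I.n) (fun j s' =>
      (∀ v < j, s'.mem 9 v = flag (v ∈ I.U t ∧ z / 2 ^ cnt (I.U t) v % 2 = 1)) ∧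
        s'.mem 17 0 = z / 2 ^ cnt (I.U t) j) 23 (by omega) (by omega) rfl ?_ ?_ ?_) ?_)) ?_
  · simp [cnt_zero]
  · intro s' hf
    have := (hs.setMem (show 5 < 17 by norm_num) 0 z).frame hf rfl
    exact ⟨by simp [this.n]; omega, by simp [this.n]⟩
  · rintro j s' hj ⟨h9, h17⟩ h18 hf
    have hs' := (hs.setMem (show 5 < 17 by norm_num) 0 z).frame hf rfl
    have h14' : s'.mem 14 0 = t := by rw [hf.1 14 rfl]; simpa using h14
    have hn' := hs'.n
    have hU := hs'.U t ht j hj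
    have hfl := flag_le (j ∈ I.U t)
    have ha := hB.addr ht hj
    have hdz : z / 2 ^ cnt (I.U t) j ≤ B := (Nat.div_le_self _ _).trans hz
    refine Runs.weaken (Runs.cond (v := flag (j ∈ I.U t)) (T := 13)
      ⟨by simp [h14', hn', h18, hU]; omega, by simp [h14', hn', h18, hU]⟩ ?_ ?_) (by simp)
    · intro hv
      have hj' : j ∈ I.U t := by simpa using hv
      refine Runs.weaken (Runs.store_seq (iv := j) (ev := z / 2 ^ cnt (I.U t) j % 2)
        ⟨by simp [h18]; omega, by simp [h18]⟩ ⟨by simp [h17]; omega, by simp [h17]⟩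
        (Runs.setV (ev := z / 2 ^ cnt (I.U t) j / 2)
          ⟨by simp [h17]; omega, by simp [h17]⟩ ?_)) (by simp)
      refine ⟨?_, ?_⟩
      · intro v hv
        simp only [State.setMem_mem]
        simp only [Nat.reduceEqDiff, if_false, if_true]
        rcases Nat.lt_succ_iff_lt_or_eq.1 hv with hv | rfl
        · simpa [hv.ne] using h9 v hv
        · simp only [Function.update_self, hj', true_and]
          unfold flag; split_ifs <;> omega
      · simp [cnt_succ, hj', pow_succ, Nat.div_div_eq_div_mul]
    · intro hv
      have hj' : j ∉ I.U t := by simpa using hv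
      refine Runs.weaken (Runs.store (iv := j) (ev := 0)
        ⟨by simp [h18]; omega, by simp [h18]⟩ ⟨by simp, by simp⟩ ?_) (by simp)
      refine ⟨?_, ?_⟩
      · intro v hv
        simp only [State.setMem_mem]
        simp only [Nat.reduceEqDiff, if_false, if_true]
        rcases Nat.lt_succ_iff_lt_or_eq.1 hv with hv | rfl
        · simpa [hv.ne] using h9 v hv
        · simp [hj', flag]
      · simp [cnt_succ, hj', h17]
  · rintro s1 ⟨⟨h9, h17⟩, -⟩ hf1
    rw [cnt_eq_card (Inst.U_sub_range t)] at h17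
    have hs1 := (hs.setMem (show 5 < 17 by norm_num) 0 z).frame hf1 rfl
    have h14' : s1.mem 14 0 = t := by rw [hf1.1 14 rfl]; simpa using h14
    refine (Runs.forP_const (m := I.k + 1) (fun j s' =>
      (∀ v < I.n, s'.mem 9 v = flag (v ∈ I.U t ∧ z / 2 ^ cnt (I.U t) v % 2 = 1 ∨
        (v ∈ I.X t ∧ ∃ i < j, z / 2 ^ (I.U t).card / (I.n + 1) ^ i % (I.n + 1) = v + 1))) ∧
        s'.mem 17 0 = z / 2 ^ (I.U t).card / (I.n + 1) ^ j) 40 (by omega) (by omega) rfl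
        ?_ ?_ ?_).mono le_rfl ?_
    · simpa [h17] using h9
    · intro s' _
      exact ⟨by simp; omega, by simp⟩
    · rintro j s' hj ⟨h9, h17⟩ h19 hf
      have hs' := hs1.frame hf rfl
      have h14' : s'.mem 14 0 = t := by rw [hf.1 14 rfl]; simpa using h14'
      have hn' := hs'.n
      set q := z / 2 ^ (I.U t).card / (I.n + 1) ^ j with hq
      have hqB : q ≤ B := (Nat.div_le_self _ _).trans ((Nat.div_le_self _ _).trans hz)
      have hdB : q / (I.n + 1) ≤ B := (Nat.div_le_self _ _).trans hqB
      have hd : q % (I.n + 1) < I.n + 1 := Nat.mod_lt _ (by omega)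
      have h17' : q / (I.n + 1) = z / 2 ^ (I.U t).card / (I.n + 1) ^ (j + 1) := by
        rw [hq, pow_succ, Nat.div_div_eq_div_mul _ ((I.n + 1) ^ j)]
      refine Runs.weaken (Runs.setV_seq (ev := q % (I.n + 1)) ⟨by simp [h17, hn']; omega,
        by simp [h17, hn']⟩ (Runs.setV_seq (ev := q / (I.n + 1)) ⟨by simp [h17, hn']; omega,
        by simp [h17, hn']⟩ (Runs.cond (v := q % (I.n + 1)) (T := 18)
          ⟨by simp; omega, by simp⟩ ?_ ?_))) (by simp)
      · intro hq0
        have hvn : q % (I.n + 1) - 1 < I.n := by omega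
        have hX := hs'.X t ht _ hvn
        have ha := hB.addr ht hvn
        have hfl := flag_le (q % (I.n + 1) - 1 ∈ I.X t)
        refine Runs.weaken (Runs.cond (v := flag (q % (I.n + 1) - 1 ∈ I.X t)) (T := 6)
          ⟨by simp [h14', hn', hX]; omega, by simp [h14', hn', hX]⟩ ?_ ?_) (by simp)
        · intro hv
          have hv : q % (I.n + 1) - 1 ∈ I.X t := by simpa using hv
          refine Runs.weaken (Runs.store (iv := q % (I.n + 1) - 1) (ev := 1)
            ⟨by simp; omega, by simp⟩ ⟨by simp; omega, by simp⟩ ⟨?_, ?_⟩) (by simp)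
          · intro v hvn
            simp only [State.setMem_mem, Nat.reduceEqDiff, if_false, if_true]
            by_cases hvq : v = q % (I.n + 1) - 1
            · rw [hvq, Function.update_self, flag_of]
              rw [← hvq]
              exact Or.inr ⟨hvq ▸ hv, j, by omega, by rw [← hq]; omega⟩
            · rw [Function.update_of_ne hvq, h9 v hvn]
              refine congrArg flag (propext (or_congr_right (and_congr_right fun _ => ?_)))
              refine ⟨fun ⟨i, hi, hi'⟩ => ⟨i, by omega, hi'⟩, fun ⟨i, hi, hi'⟩ => ?_⟩
              rcases Nat.lt_succ_iff_lt_or_eq.1 hi with hi | rfl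
              · exact ⟨i, hi, hi'⟩
              · rw [← hq] at hi'; omega
          · simpa using h17'
        · intro hv
          have hv : q % (I.n + 1) - 1 ∉ I.X t := by simpa using hv
          refine Runs.weaken (Runs.skip ⟨?_, ?_⟩) (by simp)
          · intro v hvn
            simp only [State.setMem_mem, Nat.reduceEqDiff, if_false]
            rw [h9 v hvn]
            refine congrArg flag (propext (or_congr_right (and_congr_right fun hvX => ?_)))
            refine ⟨fun ⟨i, hi, hi'⟩ => ⟨i, by omega, hi'⟩, fun ⟨i, hi, hi'⟩ => ?_⟩
            rcases Nat.lt_succ_iff_lt_or_eq.1 hi with hi | rfl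
            · exact ⟨i, hi, hi'⟩
            · rw [← hq] at hi'
              rw [hi'] at hv
              exact absurd hvX hv
          · simpa using h17'
      · intro hq0
        refine Runs.weaken (Runs.skip ⟨?_, ?_⟩) (by simp)
        · intro v hvn
          simp only [State.setMem_mem, Nat.reduceEqDiff, if_false]
          rw [h9 v hvn]
          refine congrArg flag (propext (or_congr_right (and_congr_right fun hvX => ?_)))
          refine ⟨fun ⟨i, hi, hi'⟩ => ⟨i, by omega, hi'⟩, fun ⟨i, hi, hi'⟩ => ?_⟩
          rcases Nat.lt_succ_iff_lt_or_eq.1 hi with hi | rfl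
          · exact ⟨i, hi, hi'⟩
          · rw [← hq] at hi'; omega
        · simpa using h17'
    · rintro s' ⟨⟨h, -⟩, -⟩ _ v hv
      rw [h v hv]
      congr 1
      simp [Inst.dec, hv]
  · simp; omega

/-! ### Encoding -/

/-- The product of the entries at `V 31` of the vector in the array `arr` and of the incidence
vectors of the bags of `V 32` and `V 33`. -/
def interE (arr : ℕ) : Expr :=
  .read arr (V 31) *ₑ .read 4 (V 32 *ₑ V 0 +ₑ V 31) *ₑ .read 4 (V 33 *ₑ V 0 +ₑ V 31)

/-- Put into `V 30` the code at the node `V 32` of the intersection of the set in the array `arr`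
with the bags of the nodes `V 32` and `V 33`. -/
def encP (arr : ℕ) : Prog :=
  setV 27 (.const 0) ;; setV 28 (.const 1) ;; setV 29 (.const 0) ;;
  forP 31 (V 0) (.cond (.read 5 (V 32 *ₑ V 0 +ₑ V 31))
    (setV 27 (V 27 +ₑ V 28 *ₑ interE arr) ;; setV 28 (V 28 *ₑ .const 2))
    (.cond (interE arr) (setV 29 (V 29 *ₑ (V 0 +ₑ .const 1) +ₑ (V 31 +ₑ .const 1))) .skip)) ;;
  setV 30 (V 29 *ₑ V 28 +ₑ V 27)

/-- The bound `hc` on the residual part keeps all intermediate digit numbers within words; the mask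
and its place value are at most `2 ^ |U_a|`. -/
theorem Inst.Holds.encP {I : Inst} {B a b arr : ℕ} {s : State} (hs : I.Holds s) (hB : I.Fit B)
    (harr : arr = 6 ∨ arr = 9) (ha : a ≤ I.N) (hb : b ≤ I.N) (h32 : s.mem 32 0 = a)
    (h33 : s.mem 33 0 = b) {A S : Finset ℕ} (hA : ∀ v < I.n, s.mem arr v = flag (v ∈ A))
    (hS : S = A ∩ I.X a ∩ I.X b) (hc : (S \ I.U a).card ≤ I.k + 1) :
    Runs B (encP arr) s (100 * (I.n + 1)) fun s' => s'.mem 30 0 = I.enc a S := by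
  have hnB := hB.n_le
  have hNB := hB.N_le
  have hcs := hB.code_succ (t := a)
  have hlow : I.low a * (I.n + 1) = 2 ^ (I.U a).card * (I.n + 1) ^ (I.k + 1) := by
    unfold Inst.low; ring
  have hZ : 4 * (I.low a * (I.n + 1)) ≤ B := by
    refine le_trans (Nat.mul_le_mul_left _ ?_) hcs
    rw [mul_assoc _ (I.n + 1) (I.N + 1)]
    exact Nat.le_mul_of_pos_right _ (by positivity)
  have hp1 : 2 ^ (I.U a).card ≤ I.low a * (I.n + 1) := by
    rw [hlow]; exact Nat.le_mul_of_pos_right _ (by positivity)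
  have hp2 : (I.n + 1) ^ (I.k + 1) ≤ I.low a * (I.n + 1) := by
    rw [hlow]; exact Nat.le_mul_of_pos_left _ (by positivity)
  have hdig : ∀ j ≤ I.n, encDigits I.n S (I.U a) j ≤ I.low a * (I.n + 1) := fun j hj =>
    ((encDigits_lt S (I.U a) hj).le.trans
      (Nat.pow_le_pow_right (by omega) ((cnt_le _ _).trans hc))).trans hp2
  have hcnt : ∀ j, 2 ^ cnt (I.U a) j ≤ I.low a * (I.n + 1) := fun j =>
    (Nat.pow_le_pow_right (by omega) (cnt_le _ _)).trans hp1
  have harr' : arr ≠ 27 ∧ arr ≠ 28 ∧ arr ≠ 29 ∧ arr ≠ 30 ∧ arr ≠ 31 := by omega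
  obtain ⟨ha27, ha28, ha29, ha30, ha31⟩ := harr'
  set s0 := ((s.setMem 27 0 0).setMem 28 0 1).setMem 29 0 0 with hs0d
  have hs0 : I.Holds s0 := ((hs.setMem (by norm_num) _ _).setMem (by norm_num) _ _).setMem
    (by norm_num) _ _
  have h32' : s0.mem 32 0 = a := by simpa [hs0d] using h32
  have h33' : s0.mem 33 0 = b := by simpa [hs0d] using h33
  have hA' : ∀ v < I.n, s0.mem arr v = flag (v ∈ A) := by
    simpa [hs0d, ha27, ha28, ha29] using hA
  refine Runs.weaken (Runs.setV_seq (ev := 0) ⟨by simp, by simp⟩ (Runs.setV_seq (ev := 1)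
    ⟨by simp; omega, by simp⟩ (Runs.setV_seq (ev := 0) ⟨by simp, by simp⟩
    (Runs.seq (T₂ := 10) (Runs.forP_const (m := I.n) (fun j s' =>
      s'.mem 27 0 = encMask S (I.U a) j ∧ s'.mem 28 0 = 2 ^ cnt (I.U a) j ∧
        s'.mem 29 0 = encDigits I.n S (I.U a) j) 48 (by omega) (by omega) rfl ?_ ?_ ?_) ?_)))) ?_
  · simp [cnt_zero, encMask, encDigits]
  · intro s' hf
    have := hs0.frame hf rfl
    exact ⟨by simp [this.n]; omega, by simp [this.n]⟩
  · rintro j s' hj ⟨h27, h28, h29⟩ h31 hf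
    have hs' := hs0.frame hf rfl
    have h32 : s'.mem 32 0 = a := by rw [hf.1 32 rfl]; exact h32'
    have h33 : s'.mem 33 0 = b := by rw [hf.1 33 rfl]; exact h33'
    have hAj : s'.mem arr j = flag (j ∈ A) := by
      rw [hf.1 arr (by rcases harr with rfl | rfl <;> rfl)]; exact hA' j hj
    have hn' := hs'.n
    have hU := hs'.U a ha j hj
    have hXa := hs'.X a ha j hj
    have hXb := hs'.X b hb j hj
    have hada := hB.addr ha hj
    have hadb := hB.addr hb hj
    have hfl := flag_le (j ∈ I.U a)
    have hflS := flag_le (j ∈ S)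
    -- The product of the three incidence bits is the indicator of `S`.
    have hprod : flag (j ∈ A) * flag (j ∈ I.X a) * flag (j ∈ I.X b) = flag (j ∈ S) := by
      rw [flag_mul, flag_mul, hS]; congr 1; simp [and_assoc]
    have hprod' : flag (j ∈ A) * flag (j ∈ I.X a) ≤ 1 := by rw [flag_mul]; exact flag_le _
    have hfA := flag_le (j ∈ A)
    have hfXa := flag_le (j ∈ I.X a)
    have hfXb := flag_le (j ∈ I.X b)
    have hcj := hcnt j
    have hcj1 := hcnt (j + 1)
    have hdj := hdig j hj.le
    have hdj1 := hdig (j + 1) hj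
    have hmj := encMask_lt S (I.U a) j
    have hmj1 := encMask_lt S (I.U a) (j + 1)
    have hcs := cnt_succ (I.U a) j
    have hinter : ∀ s'' : State, s''.mem 4 = s'.mem 4 → s''.mem 0 = s'.mem 0 →
        s''.mem arr = s'.mem arr → s''.mem 31 = s'.mem 31 → s''.mem 32 = s'.mem 32 →
        s''.mem 33 = s'.mem 33 → (interE arr).Ev B s'' (flag (j ∈ S)) := by
      intro s'' e1 e2 e3 e4 e5 e6
      constructor
      · simp [interE, e1, e2, e3, e4, e5, e6, h31, h32, h33, hn', hAj, hXa, hXb, hprod]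
        omega
      · simp [interE, e1, e2, e3, e4, e5, e6, h31, h32, h33, hn', hAj, hXa, hXb, hprod]
    have hi := hinter s' rfl rfl rfl rfl rfl rfl
    refine Runs.weaken (Runs.cond (v := flag (j ∈ I.U a)) (T := 38)
      ⟨by simp [h32, hn', h31, hU]; omega, by simp [h32, hn', h31, hU]⟩ ?_ ?_) (by simp)
    · intro hv
      have hj' : j ∈ I.U a := by simpa using hv
      rw [if_pos hj'] at hcs
      have h2 : 2 ^ cnt (I.U a) (j + 1) = 2 ^ cnt (I.U a) j * 2 := by rw [hcs, pow_succ]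
      have hm1 : encMask S (I.U a) (j + 1) = encMask S (I.U a) j +
          2 ^ cnt (I.U a) j * flag (j ∈ S) := by
        rw [encMask]; unfold flag; by_cases h : j ∈ S <;> simp [hj', h]
      have hle : 2 ^ cnt (I.U a) j * flag (j ∈ S) ≤ B := by omega
      refine Runs.weaken (Runs.setV_seq (ev := encMask S (I.U a) (j + 1))
        ⟨by simp [h27, h28, hi.1, hi.2]; omega, by simp [h27, h28, hi.2, hm1]⟩
        (Runs.setV (ev := 2 ^ cnt (I.U a) (j + 1))
          ⟨by simp [h28]; omega, by simp [h28, h2]⟩ ?_)) (by simp [interE])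
      simp [h29, encDigits, hj']
    · intro hv
      have hj' : j ∉ I.U a := by simpa using hv
      rw [if_neg hj', add_zero] at hcs
      have hm1 : encMask S (I.U a) (j + 1) = encMask S (I.U a) j := by
        rw [encMask]; simp [hj']
      refine Runs.weaken (Runs.cond (v := flag (j ∈ S)) (T := 14) hi ?_ ?_) (by simp [interE])
      · intro hv
        have hjS : j ∈ S := by simpa using hv
        have hd1 : encDigits I.n S (I.U a) (j + 1) =
            encDigits I.n S (I.U a) j * (I.n + 1) + (j + 1) := by
          rw [encDigits, if_pos ⟨hj', hjS⟩]
        refine Runs.weaken (Runs.setV (ev := encDigits I.n S (I.U a) (j + 1))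
          ⟨by simp [h29, hn', h31]; omega, by simp [h29, hn', h31, hd1]⟩ ?_) (by simp)
        simp [hcs, hm1, h27, h28]
      · intro hv
        have hjS : j ∉ S := by simpa using hv
        have hd1 : encDigits I.n S (I.U a) (j + 1) = encDigits I.n S (I.U a) j := by
          rw [encDigits, if_neg (by tauto)]
        refine Runs.weaken (Runs.skip ?_) (by simp)
        simp [hcs, hm1, h27, h28, h29, hd1]
  · rintro s1 ⟨⟨h27, h28, h29⟩, -⟩ hf
    have hlt := Inst.enc_lt hc
    have heq : encDigits I.n S (I.U a) I.n * 2 ^ cnt (I.U a) I.n + encMask S (I.U a) I.n =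
        I.enc a S := by
      rw [cnt_eq_card (Inst.U_sub_range a)]; rfl
    have h1 := hcnt I.n
    have h2 := hdig I.n le_rfl
    refine Runs.weaken (Runs.setV (ev := I.enc a S)
      ⟨by simp [h27, h28, h29]; omega, by simp [h27, h28, h29, heq]⟩ ?_) (by simp)
    simp
  · simp; omega

/-! ### Testing independence -/

/-- Clear the flag `V 21` if the vertex `V 22` is in the set in array `9` and has a neighbour in
it. -/
def rowP : Prog :=
  forP 23 (V 0) (.cond (.read 9 (V 22) *ₑ .read 9 (V 23) *ₑ .read 1 (V 22 *ₑ V 0 +ₑ V 23))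
    (setV 21 (.const 0)) .skip)

theorem Inst.Holds.rowP {I : Inst} {B u : ℕ} {s : State} (hs : I.Holds s) (hB : I.Fit B)
    {J : Finset ℕ} (hJ : J ⊆ Finset.range I.n) (h9 : ∀ v < I.n, s.mem 9 v = flag (v ∈ J))
    (hu : u < I.n) (h22 : s.mem 22 0 = u) {P : Prop} (h21 : s.mem 21 0 = flag P) :
    Runs B rowP s (100 * (I.n + 1)) fun s' =>
      s'.mem 21 0 = flag (P ∧ (u ∈ J → ∀ v ∈ J, ¬ I.adj u v)) := by
  have hnB := hB.n_le
  have hbase := hB.base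
  refine (Runs.forP_const (m := I.n) (fun j s' =>
    s'.mem 21 0 = flag (P ∧ (u ∈ J → ∀ v ∈ J, v < j → ¬ I.adj u v))) 22 (by omega) (by omega) rfl
      ?_ ?_ ?_).mono (by simp; omega) ?_
  · simp [h21]
  · intro s' hf
    have := hs.frame hf rfl
    exact ⟨by simp [this.n]; omega, by simp [this.n]⟩
  · intro j s' hj h21 h23 hf
    have hs' := hs.frame hf rfl
    have h22' : s'.mem 22 0 = u := by rw [hf.1 22 rfl]; exact h22
    have h9' : ∀ v < I.n, s'.mem 9 v = flag (v ∈ J) := by rw [hf.1 9 rfl]; exact h9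
    have h9u := h9' u hu
    have h9j := h9' j hj
    have hn' := hs'.n
    have hadj := hs'.adj u hu j hj
    -- Addresses in the adjacency matrix go up to about `n²`, which `Fit.main` covers because its
    -- exponent `k + 2` is at least `2`.
    have ha : u * I.n + j ≤ B := by
      have h1 : (u + 1) * I.n ≤ I.n * I.n := Nat.mul_le_mul_right _ hu
      have h2 : 4 * (2 ^ 0 * (I.n + 1) ^ 2 * 1) ≤ B :=
        le_trans (Nat.mul_le_mul_left _ (Nat.mul_le_mul (Nat.mul_le_mul
          (Nat.pow_le_pow_right (by omega) (by omega))
          (Nat.pow_le_pow_right (by omega) (by omega))) (by omega))) hB.main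
      nlinarith
    have e1 := flag_mul (u ∈ J) (j ∈ J)
    have e2 := flag_mul (u ∈ J ∧ j ∈ J) (I.adj u j)
    have f1 := flag_le (u ∈ J)
    have f2 := flag_le (j ∈ J)
    have f3 := flag_le (u ∈ J ∧ j ∈ J)
    have f4 := flag_le (I.adj u j)
    have f5 := flag_le ((u ∈ J ∧ j ∈ J) ∧ I.adj u j)
    refine Runs.weaken (Runs.cond (v := flag ((u ∈ J ∧ j ∈ J) ∧ I.adj u j)) (T := 3)
      ⟨by simp [h22', h23, hn', h9u, h9j, hadj, e1, e2]; omega,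
        by simp [h22', h23, hn', h9u, h9j, hadj, e1, e2]⟩ ?_ ?_) (by simp)
    · intro hv
      have hv : (u ∈ J ∧ j ∈ J) ∧ I.adj u j := by simpa [and_assoc] using hv
      refine Runs.weaken (Runs.setV (ev := 0) ⟨by simp, by simp⟩ ?_) (by simp)
      simp only [State.setMem_mem, Nat.reduceEqDiff, if_false, if_true, Function.update_self]
      symm
      rw [flag_eq_zero]
      exact fun h => h.2 hv.1.1 j hv.1.2 (by omega) hv.2
    · intro hv
      have hv : ¬ ((u ∈ J ∧ j ∈ J) ∧ I.adj u j) := by simpa using hv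
      refine Runs.weaken (Runs.skip ?_) (by simp)
      simp only [State.setMem_mem, Nat.reduceEqDiff, if_false, h21]
      refine congrArg flag (propext (and_congr_right fun _ => ?_))
      refine ⟨fun h hu v hvJ hvj => ?_, fun h hu v hvJ hvj => h hu v hvJ (by omega)⟩
      rcases Nat.lt_succ_iff_lt_or_eq.1 hvj with hvj | rfl
      · exact h hu v hvJ hvj
      · exact fun h => hv ⟨⟨hu, hvJ⟩, h⟩
  · rintro s' ⟨h, -⟩ _
    rw [h]
    refine congrArg flag (propext (and_congr_right fun _ => ?_))
    exact ⟨fun h hu v hv => h hu v hv (by simpa using hJ hv), fun h hu v hv _ => h hu v hv⟩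

/-- Set the flag `V 21` to whether the set in array `9` is independent. -/
def indepP : Prog := setV 21 (.const 1) ;; forP 22 (V 0) rowP

theorem Inst.Holds.indepP {I : Inst} {B : ℕ} {s : State} (hs : I.Holds s) (hB : I.Fit B)
    {J : Finset ℕ} (hJ : J ⊆ Finset.range I.n) (h9 : ∀ v < I.n, s.mem 9 v = flag (v ∈ J)) :
    Runs B indepP s (112 * (I.n + 1) ^ 2) fun s' => s'.mem 21 0 = flag (I.Indep J) := by
  have hnB := hB.n_le
  refine (Runs.setV_seq (ev := 1) ⟨by simp; omega, by simp⟩ (Runs.forP_const (m := I.n)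
    (fun j s' => s'.mem 21 0 = flag (∀ u ∈ J, u < j → ∀ v ∈ J, ¬ I.adj u v))
    (100 * (I.n + 1)) (by omega) (by omega) rfl ?_ ?_ ?_)).mono (by simp; nlinarith) ?_
  · simp [flag]
  · intro s' hf
    have := (hs.setMem (by norm_num) _ _).frame hf rfl
    exact ⟨by simp [this.n]; omega, by simp [this.n]⟩
  · intro j s' hj h21 h22 hf
    have hs' := (hs.setMem (by norm_num) _ _).frame hf rfl
    have h9' : ∀ v < I.n, s'.mem 9 v = flag (v ∈ J) := by rw [hf.1 9 rfl]; simpa using h9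
    refine (hs'.rowP hB hJ h9' hj h22 h21).mono le_rfl fun s'' h _ => ?_
    simp only [State.setMem_mem, Nat.reduceEqDiff, if_false, h]
    refine congrArg flag (propext ⟨fun h u hu huj => ?_, fun h => ⟨fun u hu huj => h u hu (by omega),
      fun hj => h j hj (by omega)⟩⟩)
    rcases Nat.lt_succ_iff_lt_or_eq.1 huj with huj | rfl
    exacts [h.1 u hu huj, h.2 hu]
  · rintro s' ⟨h, -⟩ _
    rw [h]
    refine congrArg flag (propext ⟨fun h u hu => h u hu (by simpa using hJ hu), fun h u hu _ => h u hu⟩)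

/-! ### The number of codes -/

/-- The expression `(n + 1) ^ k`. -/
def powE : ℕ → Expr
  | 0 => .const 1
  | k + 1 => powE k *ₑ (V 0 +ₑ .const 1)

theorem powE_ev {B k n : ℕ} {s : State} (hn : s.mem 0 0 = n) (h : (n + 1) ^ (k + 1) ≤ B) :
    (powE k).Ev B s ((n + 1) ^ k) := by
  have h1 : n + 1 ≤ B := le_trans (Nat.le_self_pow (by omega) _) h
  induction k with
  | zero => exact ⟨by simp [powE]; omega, by simp [powE]⟩
  | succ k ih =>
    have h2 : (n + 1) ^ (k + 1) ≤ (n + 1) ^ (k + 1 + 1) := Nat.pow_le_pow_right (by omega) (by omega)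
    have ih := ih (h2.trans h)
    rw [pow_succ] at h2
    exact ⟨by simp [powE, ih.1, ih.2, hn]; omega, by simp [powE, ih.2, hn, pow_succ]⟩

theorem powE_cost (k : ℕ) : (powE k).cost = 5 * k + 1 := by
  induction k with
  | zero => simp [powE]
  | succ k ih => simp [powE, ih]; ring

/-- Put into `V 26` the number of codes with top digit `0` at the node `V 14`. -/
def lowP (k : ℕ) : Prog :=
  setV 26 (.const 1) ;;
  forP 18 (V 0) (.cond (.read 5 (V 14 *ₑ V 0 +ₑ V 18)) (setV 26 (V 26 *ₑ .const 2)) .skip) ;;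
  setV 26 (V 26 *ₑ powE k)

theorem Inst.Holds.lowP {I : Inst} {B t : ℕ} {s : State} (hs : I.Holds s) (hB : I.Fit B)
    (ht : t ≤ I.N) (h14 : s.mem 14 0 = t) :
    Runs B (lowP I.k) s (100 * (I.n + I.k + 1)) fun s' => s'.mem 26 0 = I.low t := by
  have hnB := hB.n_le
  have hNB := hB.N_le
  have hcs := hB.code_succ (t := t)
  have hlow : I.low t * (I.n + 1) = 2 ^ (I.U t).card * (I.n + 1) ^ (I.k + 1) := by
    unfold Inst.low; ring
  have hZ : 4 * (I.low t * (I.n + 1)) ≤ B := by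
    refine le_trans (Nat.mul_le_mul_left _ ?_) hcs
    rw [mul_assoc _ (I.n + 1) (I.N + 1)]
    exact Nat.le_mul_of_pos_right _ (by positivity)
  have hp1 : 2 ^ (I.U t).card ≤ I.low t * (I.n + 1) := by
    rw [hlow]; exact Nat.le_mul_of_pos_right _ (by positivity)
  have hp2 : (I.n + 1) ^ (I.k + 1) ≤ I.low t * (I.n + 1) := by
    rw [hlow]; exact Nat.le_mul_of_pos_left _ (by positivity)
  have hcnt : ∀ j, 2 ^ cnt (I.U t) j ≤ I.low t * (I.n + 1) := fun j =>
    (Nat.pow_le_pow_right (by omega) (cnt_le _ _)).trans hp1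
  have hs0 := hs.setMem (show 5 < 26 by norm_num) 0 1
  refine Runs.weaken (Runs.setV_seq (ev := 1) ⟨by simp; omega, by simp⟩ (Runs.seq
    (T₂ := 5 * I.k + 6)
    (Runs.forP_const (m := I.n) (fun j s' => s'.mem 26 0 = 2 ^ cnt (I.U t) j) 16 (by omega)
      (by omega) rfl ?_ ?_ ?_) ?_)) ?_
  · simp [cnt_zero]
  · intro s' hf
    have := hs0.frame hf rfl
    exact ⟨by simp [this.n]; omega, by simp [this.n]⟩
  · intro j s' hj h26 h18 hf
    have hs' := hs0.frame hf rfl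
    have h14' : s'.mem 14 0 = t := by rw [hf.1 14 rfl]; simpa using h14
    have hn' := hs'.n
    have hU := hs'.U t ht j hj
    have hfl := flag_le (j ∈ I.U t)
    have ha := hB.addr ht hj
    have hcs := cnt_succ (I.U t) j
    have hc1 := hcnt j
    refine Runs.weaken (Runs.cond (v := flag (j ∈ I.U t)) (T := 6)
      ⟨by simp [h14', hn', h18, hU]; omega, by simp [h14', hn', h18, hU]⟩ ?_ ?_) (by simp)
    · intro hv
      have hj' : j ∈ I.U t := by simpa using hv
      rw [if_pos hj'] at hcs
      refine Runs.weaken (Runs.setV (ev := 2 ^ cnt (I.U t) j * 2)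
        ⟨by simp [h26]; omega, by simp [h26]⟩ ?_) (by simp)
      simp [hcs, pow_succ]
    · intro hv
      have hj' : j ∉ I.U t := by simpa using hv
      rw [if_neg hj'] at hcs
      exact Runs.weaken (Runs.skip (by simp [hcs, h26])) (by simp)
  · rintro s' ⟨h26, -⟩ hf
    have hs' := hs0.frame hf rfl
    rw [cnt_eq_card (Inst.U_sub_range t)] at h26
    have hp := powE_ev (B := B) (k := I.k) hs'.n (by omega)
    have h1 : I.low t ≤ I.low t * (I.n + 1) := Nat.le_mul_of_pos_right _ (by omega)
    have h2 : 2 ^ (I.U t).card * (I.n + 1) ^ I.k = I.low t := rfl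
    refine Runs.weaken (Runs.setV (ev := I.low t)
      ⟨by simp [h26, hp.1, hp.2, h2]; omega, by simp [h26, hp.2, h2]⟩ ?_)
      (by simp [powE_cost]; omega)
    simp
  · simp; omega

/-! ### Evaluating one choice at a node -/

/-- The address `code * (N + 1) + node` of a table entry. -/
def addrE (c u : Expr) : Expr := c *ₑ (.read 0 (.const 1) +ₑ .const 1) +ₑ u

/-- The weight of the set in array `9` outside the bag of `V 15`. -/
def weightP : Prog :=
  .wstore 2 (.const 0) .zero ;;
  forP 35 (V 0) (.cond (.read 9 (V 35) *ₑ (.const 1 -ₑ .read 4 (V 15 *ₑ V 0 +ₑ V 35)))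
    (.wstore 2 (.const 0) (.add (.read 2 (.const 0)) (.read 0 (V 35)))) .skip)

/-- Add the table entries of the neighbours of `V 14`. -/
def gatherP : Prog :=
  forP 13 (.read 2 (V 14 +ₑ .const 1) -ₑ .read 2 (V 14)) (
    setV 32 (.read 3 (.read 2 (V 14) +ₑ V 13)) ;;
    setV 33 (V 14) ;;
    encP 9 ;;
    .wstore 2 (.const 0) (.add (.read 2 (.const 0)) (.read 1 (addrE (V 30) (V 32)))))

/-- Update the table of the node `V 14` with parent `V 15` by the choice `V 16`. -/
def bodyP : Prog :=
  weightP ;; gatherP ;;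
  setV 32 (V 14) ;; setV 33 (V 15) ;; encP 9 ;;
  .wcond (.read 1 (addrE (V 30) (V 14))) (.read 2 (.const 0))
    (.wstore 1 (addrE (V 30) (V 14)) (.read 2 (.const 0)) ;;
      .store 10 (addrE (V 30) (V 14)) (V 16)) .skip

namespace Inst

variable {I : Inst} {B : ℕ} {s : State}

/-- The table address of the subset `K` of the bag of `u`. -/
def ad (I : Inst) (u : ℕ) (K : Finset ℕ) : ℕ := I.enc u K * (I.N + 1) + u

/-- The value of the choice `J` at `t` computed from the table `m`. -/
def lval (I : Inst) (p : ℕ) (m : ℕ → ℚ) (t : ℕ) (J : Finset ℕ) : ℚ :=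
  ∑ v ∈ J \ I.X p, I.w v + ((I.nb t).map fun u => m (I.ad u (J ∩ I.X u ∩ I.X t))).sum

theorem Holds.addrE (hs : I.Holds s) (hB : I.Fit B) {c u : Expr} {K : Finset ℕ} {a : ℕ}
    (ha : a ≤ I.N) (hK : (K \ I.U a).card ≤ I.k + 1) (hc : c.Ev B s (I.enc a K))
    (hu : u.Ev B s a) : (addrE c u).Ev B s (I.ad a K) := by
  have h1 := hB.code (Inst.enc_lt hK) ha
  have h2 := hB.N_le
  have hN := hs.N
  constructor
  · simp [MWIS.addrE, hc.1, hc.2, hu.1, hu.2, hN]; omega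
  · simp [MWIS.addrE, hc.2, hu.2, hN, ad]

/-- A trace of an independent set is an independent subset of `X_a`, hence has a code at `a`. -/
theorem resid_inter {J : Finset ℕ} (hJ : I.Indep J) (a b : ℕ) :
    ((J ∩ I.X a ∩ I.X b) \ I.U a).card ≤ I.k + 1 := by
  refine I.resid a _ ?_ (hJ.mono ?_) <;> intro v <;> simp only [Finset.mem_inter] <;> tauto

theorem Holds.weightP (hs : I.Holds s) (hB : I.Fit B) {p : ℕ} {J : Finset ℕ} (hp : p ≤ I.N)
    (h15 : s.mem 15 0 = p) (hJ : J ⊆ Finset.range I.n)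
    (h9 : ∀ v < I.n, s.mem 9 v = flag (v ∈ J)) :
    Runs B weightP s (36 * I.n + 12) fun s' => s'.wmem 2 0 = ∑ v ∈ J \ I.X p, I.w v := by
  have hnB := hB.n_le
  have hNB := hB.N_le
  have hs0 := hs.setWMem (show 0 < 2 by norm_num) 0 0
  refine (Runs.wstore_seq (iv := 0) (ev := 0) ⟨by simp, by simp⟩ ⟨by simp, by simp⟩
    (Runs.forP_const (m := I.n) (fun j s' => s'.wmem 2 0 =
      ∑ v ∈ Finset.range j, if v ∈ J \ I.X p then I.w v else 0) 24 (by omega) (by omega) rfl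
      ?_ ?_ ?_)).mono (by simp; omega) ?_
  · simp
  · intro s' hf
    have := hs0.frame hf rfl
    exact ⟨by simp [this.n]; omega, by simp [this.n]⟩
  · intro j s' hj h2 h35 hf
    have hs' := hs0.frame hf rfl
    have h15' : s'.mem 15 0 = p := by rw [hf.1 15 rfl]; simpa using h15
    have h9' : s'.mem 9 j = flag (j ∈ J) := by rw [hf.1 9 rfl]; simpa using h9 j hj
    have hn' := hs'.n
    have hX := hs'.X p hp j hj
    have hw := hs'.w j hj
    have ha := hB.addr hp hj
    have e1 := one_sub_flag (j ∈ I.X p)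
    have e2 := flag_mul (j ∈ J) (j ∉ I.X p)
    have f1 := flag_le (j ∈ J)
    have f2 := flag_le (j ∈ I.X p)
    have f3 := flag_le (j ∉ I.X p)
    have f4 := flag_le (j ∈ J ∧ j ∉ I.X p)
    refine Runs.weaken (Runs.cond (v := flag (j ∈ J ∧ j ∉ I.X p)) (T := 8)
      ⟨by simp [h15', h35, hn', h9', hX, e1, e2]; omega, by simp [h15', h35, hn', h9', hX, e1, e2]⟩
      ?_ ?_) (by simp)
    · intro hv
      have hv : j ∈ J ∧ j ∉ I.X p := by simpa using hv
      refine Runs.weaken (Runs.wstore (iv := 0)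
        (ev := (∑ v ∈ Finset.range j, if v ∈ J \ I.X p then I.w v else 0) + I.w j)
        ⟨by simp, by simp⟩ ⟨by simp [h35]; omega, by simp [h2, h35, hw]⟩ ?_) (by simp)
      simp [Finset.sum_range_succ, hv]
    · intro hv
      have hv : ¬ (j ∈ J ∧ j ∉ I.X p) := by simpa using hv
      refine Runs.weaken (Runs.skip ?_) (by simp)
      rw [Finset.sum_range_succ, if_neg (by simpa using hv)]
      simpa using h2
  · rintro s' ⟨h, -⟩ _
    rw [h, ← Finset.sum_filter]
    congr 1
    ext v
    simp only [Finset.mem_filter, Finset.mem_range, Finset.mem_sdiff, and_iff_right_iff_imp]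
    exact fun hv => by simpa using hJ hv.1

/-- The sum runs over all neighbours, so the program need not tell the parent from the children;
`IsOrder.lval_eq` shows that the parent adds nothing. The trace is coded at `u`, matching the key
under which a child `u` has stored its entry. -/
theorem Holds.gatherP (hs : I.Holds s) (hB : I.Fit B) {t : ℕ} {J : Finset ℕ} (ht : t < I.N)
    (h14 : s.mem 14 0 = t) (hJ : I.Indep J) (h9 : ∀ v < I.n, s.mem 9 v = flag (v ∈ J)) :
    Runs B gatherP s ((I.nb t).length * (100 * (I.n + 1) + 60) + 16) fun s' => s'.wmem 2 0 =
      s.wmem 2 0 + ((I.nb t).map fun u => s.wmem 1 (I.ad u (J ∩ I.X u ∩ I.X t))).sum := by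
  have hNB := hB.N_le
  have hoff := hs.off t ht
  have ho1 := hs.off_le t ht.le
  have ho2 := hs.off_le (t + 1) ht
  refine (Runs.forP_const (m := (I.nb t).length) (fun j s' => s'.wmem 2 0 =
      s.wmem 2 0 + (((I.nb t).take j).map fun u => s.wmem 1 (I.ad u (J ∩ I.X u ∩ I.X t))).sum)
      (100 * (I.n + 1) + 40) (by omega) (by omega) rfl ?_ ?_ ?_).mono ?_ ?_
  · simp
  · intro s' hf
    have h2' : s'.mem 2 = s.mem 2 := by rw [hf.1 2 rfl]
    have h14' : s'.mem 14 0 = t := by rw [hf.1 14 rfl]; exact h14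
    exact ⟨by simp [h14', h2', hoff]; omega, by simp [h14', h2', hoff]⟩
  · intro j s' hj hw h13 hf
    have hs' := hs.frame hf rfl
    have hw1 : s'.wmem 1 = s.wmem 1 := hf.2 1 rfl
    have h14' : s'.mem 14 0 = t := by rw [hf.1 14 rfl]; exact h14
    have h2' : s'.mem 2 = s.mem 2 := by rw [hf.1 2 rfl]
    have h9' : ∀ v < I.n, s'.mem 9 v = flag (v ∈ J) := by rw [hf.1 9 rfl]; exact h9
    have hnbr := hs'.nbr t ht j hj
    rw [h2'] at hnbr
    have hu : (I.nb t)[j] < I.N := I.nb_lt t _ (List.getElem_mem hj)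
    set u := (I.nb t)[j] with hud
    have hs1 : I.Holds ((s'.setMem 32 0 u).setMem 33 0 t) :=
      (hs'.setMem (by norm_num) _ _).setMem (by norm_num) _ _
    refine Runs.weaken (Runs.setV_seq (ev := u)
      ⟨by simp [h14', h2', h13, hnbr]; omega, by simp [h14', h2', h13, hnbr]⟩
      (Runs.setV_seq (ev := t) ⟨by simp [h14']; omega, by simp [h14']⟩
      (Runs.seq (T₂ := 16) (hs1.encP hB (Or.inr rfl) hu.le ht.le (by simp) (by simp)
        (A := J) (by simpa using h9') rfl (resid_inter hJ u t)) ?_))) (by simp; omega)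
    intro s2 h30 hf2
    have hs2 := hs1.frame hf2 rfl
    have h32 : s2.mem 32 0 = u := by rw [hf2.1 32 rfl]; simp
    have hw2 : s2.wmem 2 = s'.wmem 2 := by rw [hf2.2 2 rfl]; simp
    have hw1' : s2.wmem 1 = s.wmem 1 := by rw [hf2.2 1 rfl]; simpa using hw1
    have hcode := hB.code (Inst.enc_lt (resid_inter hJ u t)) hu.le
    have hcode' := Nat.le_mul_of_pos_right (I.enc u (J ∩ I.X u ∩ I.X t)) (show 0 < I.N + 1 by omega)
    have had := hs2.addrE hB (c := V 30) (u := V 32) hu.le (resid_inter hJ u t)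
      ⟨by rw [V_fits, h30]; omega, h30⟩ ⟨by simp [h32]; omega, by simp [h32]⟩
    refine Runs.weaken (Runs.wstore (iv := 0)
      (ev := s'.wmem 2 0 + s.wmem 1 (I.ad u (J ∩ I.X u ∩ I.X t)))
      ⟨by simp, by simp⟩ ⟨by simp [had.1], by simp [had.2, hw2, hw1']⟩ ?_) (by simp [MWIS.addrE])
    rw [← List.take_append_getElem hj]
    simp [hw, add_assoc, ← hud]
  · simp; nlinarith
  · rintro s' ⟨h, -⟩ _
    simpa using h

/-- Ties overwrite. Since values are nonnegative and fresh entries are `0`, the first choice with a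
given trace is therefore always recorded, even when its value is `0`. -/
theorem Holds.bodyP (hs : I.Holds s) (hB : I.Fit B) {t p z : ℕ} {J : Finset ℕ} (ht : t < I.N)
    (hp : p ≤ I.N) (h14 : s.mem 14 0 = t) (h15 : s.mem 15 0 = p) (h16 : s.mem 16 0 = z)
    (hz : z ≤ B) (hJ : I.Indep J) (hJX : J ⊆ I.X t)
    (h9 : ∀ v < I.n, s.mem 9 v = flag (v ∈ J)) :
    Runs B bodyP s (300 * ((I.n + 1) * ((I.nb t).length + 1))) fun s' =>
      if s.wmem 1 (I.ad t (J ∩ I.X t ∩ I.X p)) ≤ I.lval p (s.wmem 1) t J then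
        s'.wmem 1 = Function.update (s.wmem 1) (I.ad t (J ∩ I.X t ∩ I.X p))
          (I.lval p (s.wmem 1) t J) ∧
        s'.mem 10 = Function.update (s.mem 10) (I.ad t (J ∩ I.X t ∩ I.X p)) z
      else s'.wmem 1 = s.wmem 1 ∧ s'.mem 10 = s.mem 10 := by
  have hNB := hB.N_le
  refine Runs.weaken (Runs.seq (T₂ := ((I.nb t).length * (100 * (I.n + 1) + 60) + 16) +
      (8 + 100 * (I.n + 1) + 50)) (hs.weightP hB hp h15 (hJX.trans (I.X_sub t)) h9) ?_) ?_
  · intro s1 hw1 hf1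
    have hs1 := hs.frame hf1 rfl
    have h14' : s1.mem 14 0 = t := by rw [hf1.1 14 rfl]; exact h14
    have h9' : ∀ v < I.n, s1.mem 9 v = flag (v ∈ J) := by rw [hf1.1 9 rfl]; exact h9
    refine Runs.seq (hs1.gatherP hB ht h14' hJ h9') ?_
    intro s2 hw2 hf2
    have hs2 := hs1.frame hf2 rfl
    have h14'' : s2.mem 14 0 = t := by rw [hf2.1 14 rfl]; exact h14'
    have h15'' : s2.mem 15 0 = p := by rw [hf2.1 15 rfl, hf1.1 15 rfl]; exact h15
    have h16'' : s2.mem 16 0 = z := by rw [hf2.1 16 rfl, hf1.1 16 rfl]; exact h16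
    have h9'' : ∀ v < I.n, s2.mem 9 v = flag (v ∈ J) := by rw [hf2.1 9 rfl]; exact h9'
    have hm : s2.wmem 1 = s.wmem 1 := by rw [hf2.2 1 rfl, hf1.2 1 rfl]
    have hg : s2.mem 10 = s.mem 10 := by rw [hf2.1 10 rfl, hf1.1 10 rfl]
    have hval : s2.wmem 2 0 = I.lval p (s.wmem 1) t J := by
      rw [hw2, hw1, hf1.2 1 rfl]; rfl
    have hs3 : I.Holds ((s2.setMem 32 0 t).setMem 33 0 p) :=
      (hs2.setMem (by norm_num) _ _).setMem (by norm_num) _ _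
    refine Runs.weaken (Runs.setV_seq (ev := t) ⟨by simp [h14'']; omega, by simp [h14'']⟩
      (Runs.setV_seq (ev := p) ⟨by simp [h15'']; omega, by simp [h15'']⟩
      (Runs.seq (T₂ := 50) (hs3.encP hB (Or.inr rfl) ht.le hp (by simp) (by simp)
        (A := J) (by simpa using h9'') rfl (resid_inter hJ t p)) ?_))) (by simp; omega)
    intro s4 h30 hf4
    have hs4 := hs3.frame hf4 rfl
    have h14 : s4.mem 14 0 = t := by rw [hf4.1 14 rfl]; simpa using h14''
    have h16 : s4.mem 16 0 = z := by rw [hf4.1 16 rfl]; simpa using h16''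
    have hm4 : s4.wmem 1 = s.wmem 1 := by rw [hf4.2 1 rfl]; simpa using hm
    have hg4 : s4.mem 10 = s.mem 10 := by rw [hf4.1 10 rfl]; simpa using hg
    have hv4 : s4.wmem 2 0 = I.lval p (s.wmem 1) t J := by rw [hf4.2 2 rfl]; simpa using hval
    have hcode := hB.code (Inst.enc_lt (resid_inter hJ t p)) ht.le
    have hcode' := Nat.le_mul_of_pos_right (I.enc t (J ∩ I.X t ∩ I.X p)) (show 0 < I.N + 1 by omega)
    have had := hs4.addrE hB (c := V 30) (u := V 14) ht.le (resid_inter hJ t p)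
      ⟨by rw [V_fits, h30]; omega, h30⟩ ⟨by simp [h14]; omega, by simp [h14]⟩
    refine Runs.weaken (Runs.wcond (v := s.wmem 1 (I.ad t (J ∩ I.X t ∩ I.X p)))
      (v' := I.lval p (s.wmem 1) t J) (T := 30) ⟨had.1, by simp [had.2, hm4]⟩
      ⟨by simp, by simp [hv4]⟩ ?_ ?_) (by simp [MWIS.addrE])
    · intro hle
      simp only [if_pos hle]
      have had' := (hs4.setWMem (show 0 < 1 by norm_num) (I.ad t (J ∩ I.X t ∩ I.X p))
        (I.lval p (s.wmem 1) t J)).addrE hB (c := V 30) (u := V 14) ht.le (resid_inter hJ t p)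
        ⟨by rw [V_fits, State.setWMem_mem, h30]; omega, h30⟩ ⟨by simp [h14]; omega, by simp [h14]⟩
      refine Runs.weaken (Runs.wstore_seq had (ev := I.lval p (s.wmem 1) t J)
        ⟨by simp, by simp [hv4]⟩ (Runs.store had' (ev := z) ⟨by simp [h16, hz], by simp [h16]⟩ ?_))
        (by simp [MWIS.addrE])
      simp [hm4, hg4]
    · intro hle
      simp only [if_neg hle]
      exact Runs.weaken (Runs.skip ⟨hm4, hg4⟩) (by simp)
  · nlinarith

end Inst

/-! ### Enumerating the choices at a node -/

/-- Process the code `V 25 * V 26 + V 24` at the node `V 14`; the flag `V 34` tells whether the code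
`V 24` belongs to an independent set. -/
def stepP (k : ℕ) : Prog :=
  setV 16 (V 25 *ₑ V 26 +ₑ V 24) ;; decP k ;; setV 21 (V 34) ;;
  .cond (V 25) (setV 22 (V 25 -ₑ .const 1) ;; rowP) .skip ;;
  .cond (V 21) bodyP .skip

/-- Process all codes that differ from `V 24` in the top digit. -/
def roundP (k : ℕ) : Prog :=
  setV 16 (V 24) ;; decP k ;; indepP ;; setV 34 (V 21) ;;
  forP 25 (V 0 +ₑ .const 1) (stepP k)

/-- Process all codes at the node `V 14` with parent `V 15`. -/
def enumP (k : ℕ) : Prog := lowP k ;; forP 24 (V 26) (roundP k)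

namespace Inst

variable {I : Inst} {B : ℕ} {s : State}

/-! ### Invariants of the enumeration at one node. -/

/-- The tables `m` and `g` contain the best choices at `t` among the codes in `Z`, and otherwise
agree with `m₀` and `g₀`. -/
structure Tab (I : Inst) (p t : ℕ) (m₀ : ℕ → ℚ) (g₀ : ℕ → ℕ) (Z : Set ℕ) (m : ℕ → ℚ)
    (g : ℕ → ℕ) : Prop where
  off : ∀ c u, u ≤ I.N → u ≠ t →
    m (c * (I.N + 1) + u) = m₀ (c * (I.N + 1) + u) ∧ g (c * (I.N + 1) + u) = g₀ (c * (I.N + 1) + u)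
  ge : ∀ z ∈ Z, I.Indep (I.dec t z) →
    I.lval p m₀ t (I.dec t z) ≤ m (I.ad t (I.dec t z ∩ I.X t ∩ I.X p))
  wit : ∀ c, (∃ z < I.low t * (I.n + 1), I.Indep (I.dec t z) ∧
      I.ad t (I.dec t z ∩ I.X t ∩ I.X p) = c * (I.N + 1) + t ∧ g (c * (I.N + 1) + t) = z ∧
      m (c * (I.N + 1) + t) = I.lval p m₀ t (I.dec t z)) ∨
    (m (c * (I.N + 1) + t) = 0 ∧ ∀ z ∈ Z, I.Indep (I.dec t z) →
      I.ad t (I.dec t z ∩ I.X t ∩ I.X p) ≠ c * (I.N + 1) + t)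

/-- The tables of different nodes are interleaved: the node is the residue of the address modulo `N
+ 1`. -/
theorem addr_inj {N c c' u u' : ℕ} (hu : u ≤ N) (hu' : u' ≤ N)
    (h : c * (N + 1) + u = c' * (N + 1) + u') : c = c' ∧ u = u' := by
  have h1 : (c * (N + 1) + u) / (N + 1) = c := by
    rw [Nat.add_comm, Nat.add_mul_div_right _ _ (by omega), Nat.div_eq_of_lt (by omega), zero_add]
  have h2 : (c' * (N + 1) + u') / (N + 1) = c' := by
    rw [Nat.add_comm, Nat.add_mul_div_right _ _ (by omega), Nat.div_eq_of_lt (by omega), zero_add]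
  obtain rfl : c = c' := by rw [← h1, h, h2]
  exact ⟨rfl, by omega⟩

/-- A node is not its own neighbour, so evaluating a choice at `t` reads no entry of the table being
filled. The values stay those computed from the initial table throughout the enumeration. -/
theorem lval_congr {p t : ℕ} {m m' : ℕ → ℚ} (J : Finset ℕ)
    (h : ∀ c u, u ≤ I.N → u ≠ t → m (c * (I.N + 1) + u) = m' (c * (I.N + 1) + u)) :
    I.lval p m t J = I.lval p m' t J := by
  unfold lval
  congr 2
  refine List.map_congr_left fun u hu => h _ _ (I.nb_lt t u hu).le ?_
  rintro rfl
  exact I.nb_irrefl _ hu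

theorem lval_nonneg {p t : ℕ} {m : ℕ → ℚ} (J : Finset ℕ) (h : ∀ a, 0 ≤ m a) :
    0 ≤ I.lval p m t J := by
  refine add_nonneg (Finset.sum_nonneg fun v _ => I.w_nonneg v) (List.sum_nonneg ?_)
  simp only [List.mem_map]
  rintro _ ⟨u, -, rfl⟩
  exact h _

namespace Tab

variable {p t z : ℕ} {m₀ m : ℕ → ℚ} {g₀ g : ℕ → ℕ} {Z Z' : Set ℕ}

theorem subset (h : I.Tab p t m₀ g₀ Z m g) (hZ : ∀ z ∈ Z', I.Indep (I.dec t z) → z ∈ Z) :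
    I.Tab p t m₀ g₀ Z' m g :=
  ⟨h.off, fun z hz hi => h.ge z (hZ z hz hi) hi, fun c => (h.wit c).imp id
    fun h' => ⟨h'.1, fun z hz hi => h'.2 z (hZ z hz hi) hi⟩⟩

theorem empty (h : ∀ c, m₀ (c * (I.N + 1) + t) = 0) : I.Tab p t m₀ g₀ ∅ m₀ g₀ :=
  ⟨fun _ _ _ _ => ⟨rfl, rfl⟩, fun z hz => absurd hz (Set.notMem_empty z),
    fun c => Or.inr ⟨h c, fun z hz => absurd hz (Set.notMem_empty z)⟩⟩

theorem update (h : I.Tab p t m₀ g₀ Z m g) (ht : t ≤ I.N) (hz : z < I.low t * (I.n + 1))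
    (hi : I.Indep (I.dec t z))
    (hle : m (I.ad t (I.dec t z ∩ I.X t ∩ I.X p)) ≤ I.lval p m₀ t (I.dec t z)) :
    I.Tab p t m₀ g₀ (insert z Z)
      (Function.update m (I.ad t (I.dec t z ∩ I.X t ∩ I.X p)) (I.lval p m₀ t (I.dec t z)))
      (Function.update g (I.ad t (I.dec t z ∩ I.X t ∩ I.X p)) z) := by
  constructor
  · intro c u hu hut
    have hne : c * (I.N + 1) + u ≠ I.ad t (I.dec t z ∩ I.X t ∩ I.X p) := fun he =>
      hut (addr_inj hu ht he).2
    rw [Function.update_of_ne hne, Function.update_of_ne hne]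
    exact h.off c u hu hut
  · intro z' hz' hi'
    by_cases he : I.ad t (I.dec t z' ∩ I.X t ∩ I.X p) = I.ad t (I.dec t z ∩ I.X t ∩ I.X p)
    · rw [he, Function.update_self]
      rcases hz' with rfl | hz'
      · exact le_rfl
      · exact (he ▸ h.ge z' hz' hi').trans hle
    · rw [Function.update_of_ne he]
      rcases hz' with rfl | hz'
      · exact absurd rfl he
      · exact h.ge z' hz' hi'
  · intro c
    by_cases he : c * (I.N + 1) + t = I.ad t (I.dec t z ∩ I.X t ∩ I.X p)
    · rw [he, Function.update_self, Function.update_self]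
      exact Or.inl ⟨z, hz, hi, rfl, rfl, rfl⟩
    · rw [Function.update_of_ne he, Function.update_of_ne he]
      refine (h.wit c).imp id fun h' => ⟨h'.1, ?_⟩
      rintro z' (rfl | hz') hi'
      · exact fun h => he h.symm
      · exact h'.2 z' hz' hi'

/-- The entry exceeds a nonnegative value, so it cannot be a fresh `0` and already has a witness. -/
theorem keep (h : I.Tab p t m₀ g₀ Z m g) (hm : ∀ a, 0 ≤ m₀ a)
    (hle : ¬ m (I.ad t (I.dec t z ∩ I.X t ∩ I.X p)) ≤ I.lval p m₀ t (I.dec t z)) :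
    I.Tab p t m₀ g₀ (insert z Z) m g := by
  refine ⟨h.off, ?_, fun c => ?_⟩
  · rintro z' (rfl | hz') hi'
    · exact le_of_not_ge hle
    · exact h.ge z' hz' hi'
  · refine (h.wit c).imp id fun h' => ⟨h'.1, ?_⟩
    rintro z' (rfl | hz') hi' he
    · rw [he, h'.1] at hle
      exact hle (lval_nonneg _ hm)
    · exact h'.2 z' hz' hi' he

end Tab

/-- The top digit adds at most the vertex `d - 1`, so any new conflict involves that vertex. The
guard `d - 1 ∈ dec` is needed because the digit may name a vertex outside the bag. -/
theorem indep_dec_add {t d y : ℕ} (hd : d ≤ I.n) (hy : y < I.low t) :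
    I.Indep (I.dec t (d * I.low t + y)) ↔ I.Indep (I.dec t y) ∧ (d ≠ 0 →
      d - 1 ∈ I.dec t (d * I.low t + y) →
        ∀ v ∈ I.dec t (d * I.low t + y), ¬ I.adj (d - 1) v) := by
  have hmem := mem_dec_add (I := I) hd hy
  constructor
  · intro h
    exact ⟨h.mono fun v hv => (hmem v).2 (Or.inl hv), fun _ hm v hv => h _ hm v hv⟩
  · rintro ⟨h1, h2⟩ u hu v hv huv
    rcases (hmem u).1 hu with hu' | ⟨-, rfl⟩
    · rcases (hmem v).1 hv with hv' | ⟨-, rfl⟩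
      · exact h1 u hu' v hv' huv
      · exact h2 (by omega) (by simpa using hv) u hu (I.adj_symm _ _ (by simpa using huv))
    · exact h2 (by omega) (by simpa using hu) v hv (by simpa using huv)

/-- A bound for the time spent on one code at `t`. -/
def unit (I : Inst) (t : ℕ) : ℕ := (I.k + 1) * ((I.n + 1) * ((I.nb t).length + 1))

theorem unit_ge (t : ℕ) : (I.n + 1) * ((I.nb t).length + 1) ≤ I.unit t ∧ I.n + 1 ≤ I.unit t ∧
    I.n + I.k + 1 ≤ I.unit t := by
  unfold unit
  have h : I.n + 1 ≤ (I.n + 1) * ((I.nb t).length + 1) := Nat.le_mul_of_pos_right _ (by omega)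
  refine ⟨Nat.le_mul_of_pos_left _ (by omega), h.trans (Nat.le_mul_of_pos_left _ (by omega)), ?_⟩
  refine le_trans ?_ (Nat.mul_le_mul_left _ h)
  nlinarith

theorem Fit.low_le (hB : I.Fit B) (t : ℕ) : I.low t ≤ B := by
  have h1 := hB.code_succ (t := t)
  refine le_trans ?_ h1
  rw [mul_assoc, mul_assoc, mul_left_comm]
  exact Nat.le_mul_of_pos_right _ (by positivity)

/-- Independence is decided from the stored flag of `y` and one row of the adjacency matrix, hence
in time linear in `n`. For `d = 0` the set is that of `y` and the flag alone decides. -/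
theorem Holds.stepP (hs : I.Holds s) (hB : I.Fit B) {t p y d : ℕ} (ht : t < I.N) (hp : p ≤ I.N)
    (h14 : s.mem 14 0 = t) (h15 : s.mem 15 0 = p) (h24 : s.mem 24 0 = y) (h25 : s.mem 25 0 = d)
    (h26 : s.mem 26 0 = I.low t) (h34 : s.mem 34 0 = flag (I.Indep (I.dec t y)))
    (hy : y < I.low t) (hd : d ≤ I.n) {m₀ : ℕ → ℚ} {g₀ : ℕ → ℕ} {Z : Set ℕ} (hm : ∀ a, 0 ≤ m₀ a)
    (hT : I.Tab p t m₀ g₀ Z (s.wmem 1) (s.mem 10)) :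
    Runs B (stepP I.k) s (550 * I.unit t) fun s' =>
      I.Tab p t m₀ g₀ (insert (d * I.low t + y) Z) (s'.wmem 1) (s'.mem 10) := by
  have hnB := hB.n_le
  have hlB := hB.low_le t
  obtain ⟨hu1, hu2, hu3⟩ := unit_ge (I := I) t
  set z := d * I.low t + y with hz
  have hzlt : z < I.low t * (I.n + 1) := by
    have : d * I.low t ≤ I.n * I.low t := Nat.mul_le_mul_right _ hd
    have e : I.low t * (I.n + 1) = I.n * I.low t + I.low t := by ring
    omega
  have hzB : z ≤ B := by
    have := hB.code' hzlt
    nlinarith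
  have hs0 := hs.setMem (show 5 < 16 by norm_num) 0 z
  refine Runs.weaken (Runs.setV_seq (ev := z) ⟨by simp [h24, h25, h26]; omega,
    by simp [h24, h25, h26, hz]⟩ (Runs.seq (T₂ := 4 + (100 * (I.n + 1) + 9) + (300 *
      ((I.n + 1) * ((I.nb t).length + 1)) + 3))
    (hs0.decP hB ht.le (by simpa using h14) (by simp) hzB) ?_)) ?_
  · intro s1 h9 hf1
    have hs1 := hs0.frame hf1 rfl
    have h34' : s1.mem 34 0 = flag (I.Indep (I.dec t y)) := by rw [hf1.1 34 rfl]; simpa using h34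
    have h25' : s1.mem 25 0 = d := by rw [hf1.1 25 rfl]; simpa using h25
    have hs1' := hs1.setMem (show 5 < 21 by norm_num) 0 (flag (I.Indep (I.dec t y)))
    have hfl := flag_le (I.Indep (I.dec t y))
    refine Runs.weaken (Runs.setV_seq (ev := flag (I.Indep (I.dec t y))) ⟨by simp [h34']; omega,
      by simp [h34']⟩ (Runs.seq (T₁ := 100 * (I.n + 1) + 9)
      (T₂ := 300 * ((I.n + 1) * ((I.nb t).length + 1)) + 3)
      (R := fun s' => s'.mem 21 0 = flag (I.Indep (I.dec t z))) ?_ ?_)) (by simp; omega)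
    · refine Runs.weaken (Runs.cond (v := d) (T := 100 * (I.n + 1) + 6) ⟨by simp [h25']; omega,
        by simp [h25']⟩ ?_ ?_) (by simp; omega)
      · intro hd0
        have hs2 := hs1'.setMem (show 5 < 22 by norm_num) 0 (d - 1)
        refine (Runs.setV_seq (ev := d - 1) ⟨by simp [h25']; omega, by simp [h25']⟩
          (hs2.rowP hB (J := I.dec t z) (u := d - 1) ((dec_sub t z).trans (I.X_sub t))
          (by simpa using h9) (by omega) (by simp) (P := I.Indep (I.dec t y)) (by simp))).mono
          (by simp; omega) ?_
        intro s2 h _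
        rw [h, hz, indep_dec_add hd hy]
        simp only [hd0, ne_eq, not_false_eq_true, true_imp_iff]
      · intro hd0
        refine Runs.weaken (Runs.skip ?_) (by omega)
        simp [hz, hd0]
    · intro s2 h21 hf2
      have hs2 := hs1'.frame hf2 rfl
      have e14 : s2.mem 14 0 = t := by
        rw [hf2.1 14 rfl]; simp; rw [hf1.1 14 rfl]; simpa using h14
      have e15 : s2.mem 15 0 = p := by
        rw [hf2.1 15 rfl]; simp; rw [hf1.1 15 rfl]; simpa using h15
      have e16 : s2.mem 16 0 = z := by
        rw [hf2.1 16 rfl]; simp; rw [hf1.1 16 rfl]; simp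
      have e9 : ∀ v < I.n, s2.mem 9 v = flag (v ∈ I.dec t z) := by
        rw [hf2.1 9 rfl]; simpa using h9
      have ew : s2.wmem 1 = s.wmem 1 := by
        rw [hf2.2 1 rfl]; simp; rw [hf1.2 1 rfl]; simp
      have eg : s2.mem 10 = s.mem 10 := by
        rw [hf2.1 10 rfl]; simp; rw [hf1.1 10 rfl]; simp
      have hfl := flag_le (I.Indep (I.dec t z))
      refine Runs.weaken (Runs.cond (v := flag (I.Indep (I.dec t z)))
        (T := 300 * ((I.n + 1) * ((I.nb t).length + 1)))
        ⟨by simp [h21]; omega, by simp [h21]⟩ ?_ ?_) (by simp; omega)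
      · intro hi
        have hi : I.Indep (I.dec t z) := by simpa using hi
        refine (hs2.bodyP hB ht hp e14 e15 e16 hzB hi (dec_sub t z) e9).mono le_rfl ?_
        intro s' h _
        rw [ew, eg, lval_congr (m' := m₀) _ fun c u hu hut => (hT.off c u hu hut).1] at h
        split_ifs at h with hle
        · rw [h.1, h.2]
          exact hT.update ht.le hzlt hi hle
        · rw [h.1, h.2]
          exact hT.keep hm hle
      · intro hi
        have hi : ¬ I.Indep (I.dec t z) := by simpa using hi
        refine Runs.weaken (Runs.skip ?_) (Nat.succ_le_of_lt (by positivity))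
        rw [ew, eg]
        refine hT.subset ?_
        rintro z' (rfl | hz') hi'
        exacts [absurd hi' hi, hz']
  · simp; omega

/-- The codes processed before the code `d * low + y`. -/
def before (I : Inst) (t y d : ℕ) : Set ℕ :=
  {z | ∃ d' y', z = d' * I.low t + y' ∧ (y' < y ∧ d' ≤ I.n ∨ y' = y ∧ d' < d)}

/-- The quadratic independence test of `y` is spread over the `n + 1` codes of the round, which is
why it fits into `(n + 1) * unit t`. -/
theorem Holds.roundP (hs : I.Holds s) (hB : I.Fit B) {t p y : ℕ} (ht : t < I.N) (hp : p ≤ I.N)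
    (h14 : s.mem 14 0 = t) (h15 : s.mem 15 0 = p) (h24 : s.mem 24 0 = y)
    (h26 : s.mem 26 0 = I.low t) (hy : y < I.low t) {m₀ : ℕ → ℚ} {g₀ : ℕ → ℕ}
    (hm : ∀ a, 0 ≤ m₀ a) (hT : I.Tab p t m₀ g₀ (I.before t y 0) (s.wmem 1) (s.mem 10)) :
    Runs B (roundP I.k) s (850 * ((I.n + 1) * I.unit t)) fun s' =>
      I.Tab p t m₀ g₀ (I.before t (y + 1) 0) (s'.wmem 1) (s'.mem 10) := by
  have hnB := hB.n_le
  obtain ⟨hu1, hu2, hu3⟩ := unit_ge (I := I) t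
  have hyB : y ≤ B := by
    have h1 := hB.code' (t := t) (z := y)
      (hy.trans_le (Nat.le_mul_of_pos_right _ (by omega)))
    nlinarith
  have hs0 := hs.setMem (show 5 < 16 by norm_num) 0 y
  refine Runs.weaken (Runs.setV_seq (ev := y) ⟨by simp [h24]; omega, by simp [h24]⟩
    (Runs.seq (T₂ := 112 * (I.n + 1) ^ 2 + (4 + ((I.n + 1) * (550 * I.unit t + 14) + 11)))
    (hs0.decP hB ht.le (by simpa using h14) (by simp) hyB) ?_)) ?_
  · intro s1 h9 hf1
    have hs1 := hs0.frame hf1 rfl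
    refine Runs.seq (hs1.indepP hB ((dec_sub t y).trans (I.X_sub t)) h9) ?_
    intro s2 h21 hf2
    have hs2 := hs1.frame hf2 rfl
    have hfl := flag_le (I.Indep (I.dec t y))
    have hs3 := hs2.setMem (show 5 < 34 by norm_num) 0 (flag (I.Indep (I.dec t y)))
    have e14 : s2.mem 14 0 = t := by rw [hf2.1 14 rfl, hf1.1 14 rfl]; simpa using h14
    have e15 : s2.mem 15 0 = p := by rw [hf2.1 15 rfl, hf1.1 15 rfl]; simpa using h15
    have e24 : s2.mem 24 0 = y := by rw [hf2.1 24 rfl, hf1.1 24 rfl]; simpa using h24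
    have e26 : s2.mem 26 0 = I.low t := by rw [hf2.1 26 rfl, hf1.1 26 rfl]; simpa using h26
    have ew : s2.wmem 1 = s.wmem 1 := by rw [hf2.2 1 rfl, hf1.2 1 rfl]; simp
    have eg : s2.mem 10 = s.mem 10 := by rw [hf2.1 10 rfl, hf1.1 10 rfl]; simp
    refine (Runs.setV_seq (ev := flag (I.Indep (I.dec t y))) ⟨by simp [h21]; omega, by simp [h21]⟩
      (Runs.forP_const (m := I.n + 1) (fun j s' =>
        I.Tab p t m₀ g₀ (I.before t y j) (s'.wmem 1) (s'.mem 10)) (550 * I.unit t) (by omega)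
        (by omega) rfl ?_ ?_ ?_)).mono (by simp) ?_
    · simpa [ew, eg] using hT
    · intro s' hf
      have := (hs3.frame hf rfl).n
      exact ⟨by simp [this]; omega, by simp [this]⟩
    · intro d s' hd hT' h25 hf
      have hs' := hs3.frame hf rfl
      have e14' : s'.mem 14 0 = t := by rw [hf.1 14 rfl]; simpa using e14
      have e15' : s'.mem 15 0 = p := by rw [hf.1 15 rfl]; simpa using e15
      have e24' : s'.mem 24 0 = y := by rw [hf.1 24 rfl]; simpa using e24
      have e26' : s'.mem 26 0 = I.low t := by rw [hf.1 26 rfl]; simpa using e26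
      have e34' : s'.mem 34 0 = flag (I.Indep (I.dec t y)) := by rw [hf.1 34 rfl]; simp
      refine (hs'.stepP hB ht hp e14' e15' e24' h25 e26' e34' hy (by omega) hm hT').mono le_rfl ?_
      intro s'' hT'' _
      simp only [State.setMem_wmem, State.setMem_mem, Nat.reduceEqDiff, if_false]
      refine hT''.subset ?_
      rintro z ⟨d', y', rfl, h | ⟨rfl, h⟩⟩ _
      · exact Or.inr ⟨d', y', rfl, Or.inl h⟩
      · rcases Nat.lt_succ_iff_lt_or_eq.1 h with h | rfl
        · exact Or.inr ⟨d', y', rfl, Or.inr ⟨rfl, h⟩⟩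
        · exact Or.inl rfl
    · rintro s' ⟨h, -⟩ _
      refine h.subset ?_
      rintro z ⟨d', y', rfl, h | ⟨rfl, h⟩⟩ _
      · rcases Nat.lt_succ_iff_lt_or_eq.1 h.1 with h' | rfl
        · exact ⟨d', y', rfl, Or.inl ⟨h', h.2⟩⟩
        · exact ⟨d', y', rfl, Or.inr ⟨rfl, by omega⟩⟩
      · omega
  · have h1 : I.unit t ≤ (I.n + 1) * I.unit t := Nat.le_mul_of_pos_left _ (by omega)
    have h2 : (I.n + 1) ^ 2 ≤ (I.n + 1) * I.unit t := by
      rw [pow_two]; exact Nat.mul_le_mul_left _ hu2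
    simp only [V_cost]
    nlinarith

theorem low_pos (t : ℕ) : 0 < I.low t := by unfold low; positivity

theorem Holds.enumP (hs : I.Holds s) (hB : I.Fit B) {t p : ℕ} (ht : t < I.N) (hp : p ≤ I.N)
    (h14 : s.mem 14 0 = t) (h15 : s.mem 15 0 = p) (hm : ∀ a, 0 ≤ s.wmem 1 a)
    (h0 : ∀ c, s.wmem 1 (c * (I.N + 1) + t) = 0) :
    Runs B (enumP I.k) s (1000 * (I.low t * ((I.n + 1) * I.unit t))) fun s' =>
      I.Tab p t (s.wmem 1) (s.mem 10) {z | z < I.low t * (I.n + 1)} (s'.wmem 1) (s'.mem 10) := by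
  have hnB := hB.n_le
  obtain ⟨hu1, hu2, hu3⟩ := unit_ge (I := I) t
  have hlB := hB.low_le t
  refine Runs.weaken (Runs.seq (T₂ := I.low t * (850 * ((I.n + 1) * I.unit t) + 12) + 9)
    (hs.lowP hB ht.le h14) ?_) ?_
  · intro s1 h26 hf1
    have hs1 := hs.frame hf1 rfl
    refine (Runs.forP_const (m := I.low t) (fun j s' =>
      I.Tab p t (s.wmem 1) (s.mem 10) (I.before t j 0) (s'.wmem 1) (s'.mem 10))
      (850 * ((I.n + 1) * I.unit t)) hlB (by omega) rfl ?_ ?_ ?_).mono (by simp) ?_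
    · simp only [State.setMem_wmem, State.setMem_mem, Nat.reduceEqDiff, if_false]
      rw [hf1.1 10 rfl, hf1.2 1 rfl]
      refine (Tab.empty h0).subset ?_
      rintro z ⟨d', y', rfl, h | h⟩ _ <;> omega
    · intro s' hf
      have e26 : s'.mem 26 0 = I.low t := by rw [hf.1 26 rfl, h26]
      exact ⟨by simp [e26, hlB], by simp [e26]⟩
    · intro y s' hy hT h24 hf
      have hs' := hs1.frame hf rfl
      have e14 : s'.mem 14 0 = t := by rw [hf.1 14 rfl, hf1.1 14 rfl, h14]
      have e15 : s'.mem 15 0 = p := by rw [hf.1 15 rfl, hf1.1 15 rfl, h15]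
      have e26 : s'.mem 26 0 = I.low t := by rw [hf.1 26 rfl, h26]
      refine (hs'.roundP hB ht hp e14 e15 h24 e26 hy hm hT).mono le_rfl ?_
      intro s'' h _
      simpa using h
    · rintro s' ⟨h, -⟩ _
      refine h.subset ?_
      intro z hz _
      -- Division by `low t` splits an arbitrary code into its top digit and the rest.
      refine ⟨z / I.low t, z % I.low t, ?_, Or.inl ⟨Nat.mod_lt _ (low_pos t), ?_⟩⟩
      · rw [mul_comm]; exact (Nat.div_add_mod _ _).symm
      · have := Nat.div_lt_of_lt_mul hz
        omega
  · have h1 : I.unit t ≤ (I.n + 1) * I.unit t := Nat.le_mul_of_pos_left _ (by omega)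
    have h2 : (I.n + 1) * I.unit t ≤ I.low t * ((I.n + 1) * I.unit t) :=
      Nat.le_mul_of_pos_left _ (low_pos t)
    have h3 : I.low t ≤ I.low t * ((I.n + 1) * I.unit t) :=
      Nat.le_mul_of_pos_right _ (by omega)
    nlinarith

end Inst

/-! ### The two passes over the tree -/

/-- The number of nodes. -/
def numE : Expr := .read 0 (.const 1)

/-- Fill the tables of all nodes, children before parents. -/
def upP (k : ℕ) : Prog :=
  forP 12 numE (setV 14 (.read 8 (numE -ₑ .const 1 -ₑ V 12)) ;;
    setV 15 (.read 7 (V 14) -ₑ .const 1) ;; enumP k)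

/-- Add the set in array `9` to the set in array `6`. -/
def unionP : Prog :=
  forP 18 (V 0) (.cond (.read 9 (V 18)) (.store 6 (V 18) (.const 1)) .skip)

/-- Extend the solution in array `6` to all nodes, parents before children. -/
def downP (k : ℕ) : Prog :=
  forP 12 numE (setV 14 (.read 8 (V 12)) ;; setV 15 (.read 7 (V 14) -ₑ .const 1) ;;
    setV 32 (V 14) ;; setV 33 (V 15) ;; encP 6 ;;
    setV 16 (.read 10 (addrE (V 30) (V 14))) ;; decP k ;; unionP)

namespace Inst

variable {I : Inst} {B : ℕ} {s : State} {ord par : ℕ → ℕ}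

/-! ### The upward pass. -/

/-- The arrays `8` and `7` contain the order and the parents. -/
structure Ordered (I : Inst) (ord par : ℕ → ℕ) (s : State) : Prop where
  ord : ∀ i < I.N, s.mem 8 i = ord i
  par : ∀ t < I.N, s.mem 7 t = par t + 1

theorem Ordered.congr {s' : State} (h : I.Ordered ord par s) (h8 : s'.mem 8 = s.mem 8)
    (h7 : s'.mem 7 = s.mem 7) : I.Ordered ord par s' :=
  ⟨by rw [h8]; exact h.ord, by rw [h7]; exact h.par⟩

/-- The tables `m` and `g` are correct at the node `t`. -/
structure Local (I : Inst) (par : ℕ → ℕ) (m : ℕ → ℚ) (g : ℕ → ℕ) (t : ℕ) : Prop where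
  le : ∀ J ⊆ I.X t, I.Indep J →
    I.cval par (fun u K => m (I.ad u K)) t J ≤ m (I.ad t (J ∩ I.X t ∩ I.X (par t)))
  wit : ∀ J ⊆ I.X t, I.Indep J → ∃ z < I.low t * (I.n + 1),
    g (I.ad t (J ∩ I.X t ∩ I.X (par t))) = z ∧ I.Indep (I.dec t z) ∧
    I.dec t z ∩ I.X t ∩ I.X (par t) = J ∩ I.X t ∩ I.X (par t) ∧
    m (I.ad t (J ∩ I.X t ∩ I.X (par t))) = I.cval par (fun u K => m (I.ad u K)) t (I.dec t z)

theorem cval_congr {m m' : ℕ → ℚ} {t : ℕ} (J : Finset ℕ)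
    (h : ∀ u ∈ I.children par t, ∀ K, m (I.ad u K) = m' (I.ad u K)) :
    I.cval par (fun u K => m (I.ad u K)) t J = I.cval par (fun u K => m' (I.ad u K)) t J := by
  unfold cval
  congr 1
  exact Finset.sum_congr rfl fun u hu => h u hu _

theorem Local.congr {m m' : ℕ → ℚ} {g g' : ℕ → ℕ} {t : ℕ} (h : I.Local par m g t)
    (ht : ∀ K, m' (I.ad t K) = m (I.ad t K) ∧ g' (I.ad t K) = g (I.ad t K))
    (hc : ∀ u ∈ I.children par t, ∀ K, m' (I.ad u K) = m (I.ad u K)) : I.Local par m' g' t := by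
  constructor
  · intro J hJ hi
    rw [cval_congr J hc, (ht _).1]
    exact h.le J hJ hi
  · intro J hJ hi
    obtain ⟨z, hz, h1, h2, h3, h4⟩ := h.wit J hJ hi
    refine ⟨z, hz, by rw [(ht _).2, h1], h2, h3, ?_⟩
    rw [cval_congr _ hc, (ht _).1, h4]

/-- The children are among the neighbours, and the entries of the remaining neighbours vanish by
`h0`; in the upward pass that concerns the parent, which is not processed yet. -/
theorem IsOrder.lval_eq (h : I.IsOrder ord par) {t : ℕ} (ht : t < I.N) {m : ℕ → ℚ} (J : Finset ℕ)
    (h0 : ∀ u ∈ I.nb t, par u ≠ t → ∀ K, m (I.ad u K) = 0) :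
    I.lval (par t) m t J = I.cval par (fun u K => m (I.ad u K)) t J := by
  unfold lval cval
  congr 1
  rw [← List.sum_toFinset _ (I.nb_nodup t)]
  symm
  refine Finset.sum_subset ?_ ?_
  · intro u hu
    simp only [children, Finset.mem_filter, Finset.mem_range] at hu
    obtain ⟨j, hj, rfl⟩ := h.surj hu.1
    rcases Nat.eq_zero_or_pos j with rfl | hj0
    · have := h.root.symm.trans hu.2; omega
    · obtain ⟨i, -, hp, hn⟩ := h.step j hj0 hj
      rw [List.mem_toFinset, ← hu.2, hp]
      exact hn
  · intro u hu hu'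
    rw [List.mem_toFinset] at hu
    refine h0 u hu (fun hp => hu' ?_) _
    simp [children, hp, I.nb_lt t u hu]

/-- The tables after `i` rounds of the first pass. -/
structure Up (I : Inst) (ord par : ℕ → ℕ) (i : ℕ) (m : ℕ → ℚ) (g : ℕ → ℕ) : Prop where
  nonneg : ∀ a, 0 ≤ m a
  zero : ∀ j, j + i < I.N → ∀ c, m (c * (I.N + 1) + ord j) = 0
  done : ∀ j < I.N, I.N ≤ j + i → I.Local par m g (ord j)

theorem IsOrder.par_idx (h : I.IsOrder ord par) {i j : ℕ} (hi : i < I.N) (hj : j < I.N)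
    (hp : par (ord j) = ord i) : i < j := by
  rcases Nat.eq_zero_or_pos j with rfl | hj0
  · have := h.root.symm.trans hp
    have := h.lt i hi
    omega
  · obtain ⟨i', hi', hp', -⟩ := h.step j hj0 hj
    rw [hp] at hp'
    rwa [h.inj i hi i' (by omega) hp']

/-- Children have larger indices, so their tables are finished and are not touched in this round;
the parent has a smaller index, so its table is still zero. Hence the enumerated values are the
values `cval` for the new table as well. -/
theorem Up.step (h : I.IsOrder ord par) {i j : ℕ} (hj : j + i + 1 = I.N) {m m' : ℕ → ℚ}
    {g g' : ℕ → ℕ} (hU : I.Up ord par i m g)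
    (hT : I.Tab (par (ord j)) (ord j) m g {z | z < I.low (ord j) * (I.n + 1)} m' g') :
    I.Up ord par (i + 1) m' g' := by
  have hjN : j < I.N := by omega
  have htN := h.lt j hjN
  have hoff : ∀ u < I.N, u ≠ ord j → ∀ K, m' (I.ad u K) = m (I.ad u K) ∧
      g' (I.ad u K) = g (I.ad u K) := fun u hu hne K => hT.off _ _ hu.le hne
  have hchild : ∀ j', j ≤ j' → j' < I.N → ∀ u ∈ I.children par (ord j'), u ≠ ord j ∧ u < I.N := by
    intro j' hjj hj' u hu
    simp only [children, Finset.mem_filter, Finset.mem_range] at hu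
    refine ⟨?_, hu.1⟩
    rintro rfl
    have := h.par_idx hj' hjN hu.2
    omega
  have hlc : ∀ J, I.lval (par (ord j)) m (ord j) J =
      I.cval par (fun u K => m' (I.ad u K)) (ord j) J := by
    intro J
    rw [h.lval_eq htN J]
    · refine cval_congr J fun u hu K => ?_
      have := hchild j le_rfl hjN u hu
      exact ((hoff u this.2 this.1 K).1).symm
    · intro u hu hne K
      rcases h.nb_eq htN hu with hp | hp
      · exact absurd hp hne
      · obtain ⟨j', hj', rfl⟩ := h.surj (I.nb_lt _ u hu)
        have := h.par_idx hj' hjN hp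
        exact hU.zero j' (by omega) _
  constructor
  · intro a
    have ha : a = a / (I.N + 1) * (I.N + 1) + a % (I.N + 1) := (Nat.div_add_mod' _ _).symm
    have hlt : a % (I.N + 1) ≤ I.N := Nat.lt_succ_iff.1 (Nat.mod_lt _ (by omega))
    rw [ha]
    by_cases he : a % (I.N + 1) = ord j
    · rw [he]
      rcases hT.wit (a / (I.N + 1)) with ⟨z, -, -, -, -, hv⟩ | hv
      · rw [hv]; exact lval_nonneg _ hU.nonneg
      · rw [hv.1]
    · rw [(hT.off _ _ hlt he).1]
      exact hU.nonneg _
  · intro j' hj' c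
    have hne : ord j' ≠ ord j := fun he => by
      have := h.inj _ (by omega) _ hjN he; omega
    rw [(hT.off c _ (h.lt j' (by omega)).le hne).1]
    exact hU.zero j' (by omega) c
  · intro j' hj' hle
    by_cases hjj : j' = j
    · subst hjj
      have hcode : ∀ J ⊆ I.X (ord j'), I.Indep J → ∃ z < I.low (ord j') * (I.n + 1),
          I.dec (ord j') z = J := fun J hJ hi =>
        ⟨_, enc_lt (I.resid _ J hJ hi), hi.dec_enc hJ⟩
      constructor
      · intro J hJ hi
        obtain ⟨z, hz, rfl⟩ := hcode J hJ hi
        rw [← hlc]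
        exact hT.ge z hz hi
      · intro J hJ hi
        -- The entry for the trace of `J` has been reached, since `J` itself has a code; this
        -- excludes the untouched case. Equal addresses give equal codes of traces, and decoding
        -- gives equal traces.
        rcases hT.wit (I.enc (ord j') (J ∩ I.X (ord j') ∩ I.X (par (ord j')))) with
          ⟨z, hz, h1, h2, h3, h4⟩ | h'
        · refine ⟨z, hz, h3, h1, ?_, by rw [← hlc]; exact h4⟩
          have he := (addr_inj htN.le htN.le h2).1
          have hsub : ∀ A : Finset ℕ, A ∩ I.X (ord j') ∩ I.X (par (ord j')) ⊆ I.X (ord j') :=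
            fun A => Finset.inter_subset_left.trans Finset.inter_subset_right
          rw [← dec_enc (hsub (I.dec (ord j') z)) (resid_inter h1 _ _), he,
            dec_enc (hsub J) (resid_inter hi _ _)]
        · obtain ⟨z, hz, rfl⟩ := hcode J hJ hi
          exact absurd rfl (h'.2 z hz hi)
    · have hne : ord j' ≠ ord j := fun he => hjj (h.inj _ hj' _ hjN he)
      refine (hU.done j' hj' (by omega)).congr (hoff _ (h.lt j' hj') hne) fun u hu K => ?_
      have := hchild j' (by omega) hj' u hu
      exact (hoff u this.2 this.1 K).1

theorem IsOrder.sum_ord (h : I.IsOrder ord par) (f : ℕ → ℕ) :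
    ∑ i ∈ Finset.range I.N, f (ord i) = ∑ t ∈ Finset.range I.N, f t := by
  refine Finset.sum_nbij ord ?_ ?_ ?_ fun _ _ => rfl
  · intro i hi; simpa using h.lt i (by simpa using hi)
  · intro i hi j hj hij
    exact h.inj i (by simpa using hi) j (by simpa using hj) hij
  · intro t ht
    obtain ⟨i, hi, rfl⟩ := h.surj (show t < I.N by simpa using ht)
    exact ⟨i, by simpa using hi, rfl⟩

/-- The handshake identity `nb_total` makes the sum of `deg t + 1` equal to `3N - 2`. This replaces
a bound by the maximum degree. -/
theorem IsOrder.sum_unit (h : I.IsOrder ord par) :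
    ∑ i ∈ Finset.range I.N, I.unit (ord (I.N - 1 - i)) ≤ 3 * ((I.k + 1) * (I.n + 1)) * I.N := by
  rw [Finset.sum_range_reflect (fun i => I.unit (ord i)), h.sum_ord]
  have h2 : ∑ t ∈ Finset.range I.N, I.unit t = (I.k + 1) * (I.n + 1) * (3 * I.N - 2) := by
    simp only [unit, ← mul_assoc]
    rw [← Finset.mul_sum, Finset.sum_add_distrib]
    have := I.nb_total
    simp only [Finset.sum_const, Finset.card_range, smul_eq_mul, mul_one]
    congr 1
    omega
  rw [h2]
  calc (I.k + 1) * (I.n + 1) * (3 * I.N - 2) ≤ (I.k + 1) * (I.n + 1) * (3 * I.N) :=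
        Nat.mul_le_mul_left _ (by omega)
    _ = _ := by ring

theorem Holds.num (hs : I.Holds s) (hB : I.Fit B) : numE.Ev B s I.N := by
  have h1 := hB.N_le
  have h2 := hs.N
  exact ⟨by simp [numE, h2]; omega, by simp [numE, h2]⟩

theorem Holds.upP (hs : I.Holds s) (hB : I.Fit B) (h : I.IsOrder ord par)
    (ho : I.Ordered ord par s) (hw : ∀ a, s.wmem 1 a = 0) :
    Runs B (upP I.k) s (3400 * ((I.k + 1) * (2 ^ I.ℓ * (I.n + 1) ^ (I.k + 2) * I.N))) fun s' =>
      I.Up ord par I.N (s'.wmem 1) (s'.mem 10) := by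
  have hNB := hB.N_le
  have hN := I.N_pos
  set W := 2 ^ I.ℓ * (I.n + 1) ^ (I.k + 1) with hW
  have hW0 : 0 < W := by positivity
  -- Rounds have different lengths because degrees differ, so the invariant carries the accumulated
  -- time. The index `N - 1 - i` reflects the order from children to parents.
  refine (Runs.forP (m := I.N) (fun j r s' => I.Up ord par j (s'.wmem 1) (s'.mem 10) ∧
    r ≤ 1100 * (W * ∑ i ∈ Finset.range j, I.unit (ord (I.N - 1 - i)))) (by omega) (by omega) rfl
    ?_ ?_ ?_ ?_).mono le_rfl ?_
  · refine ⟨⟨fun a => by simp [hw], fun j _ c => by simp [hw], fun j h1 h2 => ?_⟩, by simp⟩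
    omega
  · intro j r s' _ _ _ hf
    exact (hs.frame hf rfl).num hB
  · rintro j r s' hj ⟨hU, hr⟩ h12 hf
    have hs' := hs.frame hf rfl
    have ho' := ho.congr (hf.1 8 rfl) (hf.1 7 rfl)
    have hidx : I.N - 1 - j < I.N := by omega
    have ht := h.lt _ hidx
    have hp := h.par_le ht
    have e8 := ho'.ord _ hidx
    have e7 := ho'.par _ ht
    have hnum := hs'.num hB
    set t := ord (I.N - 1 - j) with htd
    have hs2 : I.Holds ((s'.setMem 14 0 t).setMem 15 0 (par t)) :=
      (hs'.setMem (by norm_num) _ _).setMem (by norm_num) _ _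
    have hen := hs2.enumP hB ht hp (by simp) (by simp) (by simpa using hU.nonneg)
      (by simpa using hU.zero (I.N - 1 - j) (by omega))
    refine ⟨_, (Runs.setV_seq (ev := t)
      ⟨by simp [hnum.1, hnum.2, h12, e8]; omega, by simp [hnum.2, h12, e8]⟩
      (Runs.setV_seq (ev := par t) ⟨by simp [e7]; omega, by simp [e7]⟩ hen)).mono le_rfl ?_⟩
    intro s'' hT _
    simp only [State.setMem_wmem, State.setMem_mem, Nat.reduceEqDiff, if_false] at hT ⊢
    refine ⟨hU.step h (by omega) hT, ?_⟩
    -- The number of codes at `t` is at most `W`, uniformly in `t`, so only the factor `unit t` has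
    -- to be summed.
    have h1 : I.low t * ((I.n + 1) * I.unit t) ≤ W * I.unit t := by
      rw [← mul_assoc]; exact Nat.mul_le_mul_right _ (low_mul_le t)
    have h2 : 1 ≤ W * I.unit t := Nat.mul_pos hW0 (by unfold unit; positivity)
    rw [Finset.sum_range_succ, Nat.mul_add, ← htd]
    simp [numE]
    omega
  · rintro r s' ⟨-, hr⟩
    have h1 : 1100 * (W * ∑ i ∈ Finset.range I.N, I.unit (ord (I.N - 1 - i))) ≤
        1100 * (W * (3 * ((I.k + 1) * (I.n + 1)) * I.N)) :=
      Nat.mul_le_mul_left _ (Nat.mul_le_mul_left _ h.sum_unit)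
    have h2 : W * (3 * ((I.k + 1) * (I.n + 1)) * I.N) =
        3 * ((I.k + 1) * (2 ^ I.ℓ * (I.n + 1) ^ (I.k + 2) * I.N)) := by rw [hW]; ring
    have h3 : 1 ≤ (I.k + 1) * (2 ^ I.ℓ * (I.n + 1) ^ (I.k + 2) * I.N) :=
      Nat.succ_le_of_lt (by positivity)
    simp [numE]
    omega
  · rintro s' ⟨r, ⟨h, -⟩, -⟩ _
    exact h

theorem Holds.unionP (hs : I.Holds s) (hB : I.Fit B) {A O : Finset ℕ}
    (h9 : ∀ v < I.n, s.mem 9 v = flag (v ∈ A)) (h6 : ∀ v < I.n, s.mem 6 v = flag (v ∈ O)) :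
    Runs B unionP s (50 * (I.n + 1)) fun s' => ∀ v < I.n, s'.mem 6 v = flag (v ∈ O ∪ A) := by
  have hnB := hB.n_le
  refine (Runs.forP_const (m := I.n) (fun j s' => ∀ v < I.n,
    s'.mem 6 v = flag (v ∈ O ∨ v ∈ A ∧ v < j)) 8 (by omega) (by omega) rfl ?_ ?_ ?_).mono
    (by simp; omega) ?_
  · intro v hv
    simpa using h6 v hv
  · intro s' hf
    have := (hs.frame hf rfl).n
    exact ⟨by simp [this]; omega, by simp [this]⟩
  · intro j s' hj h6' h18 hf
    have h9' : s'.mem 9 j = flag (j ∈ A) := by rw [hf.1 9 rfl]; exact h9 j hj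
    have hfl := flag_le (j ∈ A)
    refine Runs.weaken (Runs.cond (v := flag (j ∈ A)) (T := 4) ⟨by simp [h18, h9']; omega,
      by simp [h18, h9']⟩ ?_ ?_) (by simp)
    · intro hA
      have hA : j ∈ A := by simpa using hA
      refine Runs.weaken (Runs.store (iv := j) (ev := 1) ⟨by simp [h18]; omega, by simp [h18]⟩
        ⟨by simp; omega, by simp⟩ ?_) (by simp)
      intro v hv
      simp only [State.setMem_mem, Nat.reduceEqDiff, if_false, if_true]
      by_cases hvj : v = j
      · subst hvj
        simp [flag, hA]
      · rw [Function.update_of_ne hvj, h6' v hv]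
        refine congrArg flag (propext (or_congr_right (and_congr_right fun _ => ?_)))
        omega
    · intro hA
      have hA : j ∉ A := by simpa using hA
      refine Runs.weaken (Runs.skip ?_) (by simp)
      intro v hv
      simp only [State.setMem_mem, Nat.reduceEqDiff, if_false]
      rw [h6' v hv]
      refine congrArg flag (propext (or_congr_right (and_congr_right fun hvA => ?_)))
      have : v ≠ j := fun he => hA (he ▸ hvA)
      omega
  · rintro s' ⟨h, -⟩ _ v hv
    rw [h v hv]
    congr 1
    simp [hv]

/-! ### The downward pass. -/

/-- The partial solution `O` after `i` rounds of the second pass. -/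
structure Down (I : Inst) (ord par : ℕ → ℕ) (m : ℕ → ℚ) (i : ℕ) (O : Finset ℕ) : Prop where
  sub : ∀ v ∈ O, ∃ j < i, v ∈ I.X (ord j)
  good : ∀ j < i, I.Indep (O ∩ I.X (ord j)) ∧
    I.cval par (fun u K => m (I.ad u K)) (ord j) (O ∩ I.X (ord j)) =
      m (I.ad (ord j) (O ∩ I.X (ord j) ∩ I.X (par (ord j))))

/-- The trace lies in the bag of the parent, where `O` is already known to be independent; at the
root it is empty. -/
theorem Down.indep {m : ℕ → ℚ} {i : ℕ} {O : Finset ℕ} (hD : I.Down ord par m i O)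
    (h : I.IsOrder ord par) (hi : i < I.N) :
    I.Indep (O ∩ I.X (ord i) ∩ I.X (par (ord i))) := by
  rcases Nat.eq_zero_or_pos i with rfl | hi0
  · rw [h.root, I.X_out _ le_rfl, Finset.inter_empty]
    intro u hu; simp at hu
  · obtain ⟨j, hj, hp, -⟩ := h.step i hi0 hi
    rw [hp]
    refine (hD.good j hj).1.mono fun v => ?_
    simp only [Finset.mem_inter]; tauto

/-- A vertex shared by `X_{ord i}` and an earlier bag lies in the bag of the parent by `rip`, and
there `O` and `A` agree. So adding `A` changes no earlier trace, and the trace on the new bag is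
exactly `A`. -/
theorem Down.step {m : ℕ → ℚ} {i : ℕ} {O A : Finset ℕ} (hD : I.Down ord par m i O)
    (h : I.IsOrder ord par) (hi : i < I.N) (hA : I.Indep A) (hAX : A ⊆ I.X (ord i))
    (hK : A ∩ I.X (ord i) ∩ I.X (par (ord i)) = O ∩ I.X (ord i) ∩ I.X (par (ord i)))
    (hv : m (I.ad (ord i) (O ∩ I.X (ord i) ∩ I.X (par (ord i)))) =
      I.cval par (fun u K => m (I.ad u K)) (ord i) A) :
    I.Down ord par m (i + 1) (O ∪ A) := by
  have hrip : ∀ j < i, ∀ v ∈ I.X (ord j), v ∈ I.X (ord i) → v ∈ I.X (par (ord i)) :=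
    fun j hj v h1 h2 => h.rip hj hi h1 h2
  have hmem : ∀ v, v ∈ I.X (ord i) → v ∈ I.X (par (ord i)) → (v ∈ A ↔ v ∈ O) := by
    intro v h1 h2
    have := Finset.ext_iff.1 hK v
    simp only [Finset.mem_inter] at this
    tauto
  have hnew : (O ∪ A) ∩ I.X (ord i) = A := by
    ext v
    simp only [Finset.mem_inter, Finset.mem_union]
    constructor
    · rintro ⟨hO | hA, hX⟩
      · obtain ⟨j, hj, hvj⟩ := hD.sub v hO
        exact (hmem v hX (hrip j hj v hvj hX)).2 hO
      · exact hA
    · exact fun hv => ⟨Or.inr hv, hAX hv⟩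
  have hold : ∀ j < i, (O ∪ A) ∩ I.X (ord j) = O ∩ I.X (ord j) := by
    intro j hj
    ext v
    simp only [Finset.mem_inter, Finset.mem_union]
    refine and_congr_left fun hvj => ⟨?_, Or.inl⟩
    rintro (hO | hA)
    · exact hO
    · exact (hmem v (hAX hA) (hrip j hj v hvj (hAX hA))).1 hA
  constructor
  · intro v hv
    rcases Finset.mem_union.1 hv with hv | hv
    · obtain ⟨j, hj, hvj⟩ := hD.sub v hv
      exact ⟨j, by omega, hvj⟩
    · exact ⟨i, by omega, hAX hv⟩
  · intro j hj
    rcases Nat.lt_succ_iff_lt_or_eq.1 hj with hj | rfl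
    · rw [hold j hj]; exact hD.good j hj
    · rw [hnew]
      refine ⟨hA, ?_⟩
      have : A ∩ I.X (par (ord j)) = A ∩ I.X (ord j) ∩ I.X (par (ord j)) := by
        rw [Finset.inter_eq_left.2 hAX]
      rw [this, hK, hv]

theorem Holds.downP (hs : I.Holds s) (hB : I.Fit B) (h : I.IsOrder ord par)
    (ho : I.Ordered ord par s) (hU : I.Up ord par I.N (s.wmem 1) (s.mem 10))
    (h6 : ∀ v < I.n, s.mem 6 v = 0) :
    Runs B (downP I.k) s (400 * ((I.k + 1) * (I.n + 1) * I.N)) fun s' => ∃ O : Finset ℕ,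
      I.Down ord par (s.wmem 1) I.N O ∧ ∀ v < I.n, s'.mem 6 v = flag (v ∈ O) := by
  have hNB := hB.N_le
  have hnB := hB.n_le
  have hN := I.N_pos
  have hkn : I.n + I.k + 1 ≤ (I.k + 1) * (I.n + 1) := by nlinarith
  have hn1 : I.n + 1 ≤ (I.k + 1) * (I.n + 1) := by nlinarith
  refine (Runs.forP_const (m := I.N) (fun i s' => ∃ O : Finset ℕ,
    I.Down ord par (s.wmem 1) i O ∧ ∀ v < I.n, s'.mem 6 v = flag (v ∈ O))
    (300 * ((I.k + 1) * (I.n + 1))) (by omega) (by omega) rfl ?_ ?_ ?_).mono ?_ ?_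
  · refine ⟨∅, ⟨by simp, by simp⟩, ?_⟩
    simpa using fun v hv => (h6 v hv).trans (flag_of_not id).symm
  · intro s' hf
    exact (hs.frame hf rfl).num hB
  · rintro i s' hi ⟨O, hD, h6'⟩ h12 hf
    have hs' := hs.frame hf rfl
    have ho' := ho.congr (hf.1 8 rfl) (hf.1 7 rfl)
    have e10 : s'.mem 10 = s.mem 10 := hf.1 10 rfl
    have ht := h.lt i hi
    have hp := h.par_le ht
    have e8 := ho'.ord _ hi
    have e7 := ho'.par _ ht
    have hloc := hU.done i hi (by omega)
    have hKi := hD.indep h hi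
    have hKX : O ∩ I.X (ord i) ∩ I.X (par (ord i)) ⊆ I.X (ord i) :=
      Finset.inter_subset_left.trans Finset.inter_subset_right
    have hKK : O ∩ I.X (ord i) ∩ I.X (par (ord i)) ∩ I.X (ord i) ∩ I.X (par (ord i)) =
        O ∩ I.X (ord i) ∩ I.X (par (ord i)) := by
      ext v; simp only [Finset.mem_inter]; tauto
    -- The witness property is applied to the trace itself: it is an independent subset of the bag
    -- and its own trace, so its entry has a recorded choice.
    obtain ⟨z, hz, hgz, hzi, hzK, hzv⟩ := hloc.wit _ hKX hKi
    rw [hKK] at hgz hzK hzv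
    have hc := I.resid _ _ hKX hKi
    set t := ord i with htd
    set K := O ∩ I.X t ∩ I.X (par t) with hK
    have hzB : z ≤ B := by
      have := hB.code' hz
      nlinarith
    have hs2 : I.Holds ((((s'.setMem 14 0 t).setMem 15 0 (par t)).setMem 32 0 t).setMem 33 0
        (par t)) :=
      (((hs'.setMem (by norm_num) _ _).setMem (by norm_num) _ _).setMem
        (by norm_num) _ _).setMem (by norm_num) _ _
    refine Runs.weaken (Runs.setV_seq (ev := t) ⟨by simp [h12, e8]; omega, by simp [h12, e8]⟩
      (Runs.setV_seq (ev := par t) ⟨by simp [e7]; omega, by simp [e7]⟩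
      (Runs.setV_seq (ev := t) ⟨by simp; omega, by simp⟩
      (Runs.setV_seq (ev := par t) ⟨by simp; omega, by simp⟩
      (Runs.seq (T₂ := 13 + (100 * (I.n + I.k + 1) + 50 * (I.n + 1))) (hs2.encP hB (Or.inl rfl)
        ht.le hp (by simp) (by simp) (A := O) (by simpa using h6') hK hc) ?_))))) ?_
    · intro s3 h30 hf3
      have hs3 := hs2.frame hf3 rfl
      have e14 : s3.mem 14 0 = t := by rw [hf3.1 14 rfl]; simp
      have e10' : s3.mem 10 = s.mem 10 := by rw [hf3.1 10 rfl]; simpa using e10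
      have e6 : ∀ v < I.n, s3.mem 6 v = flag (v ∈ O) := by rw [hf3.1 6 rfl]; simpa using h6'
      have hcode := hB.code (Inst.enc_lt hc) ht.le
      have hcode' := Nat.le_mul_of_pos_right (I.enc t K) (show 0 < I.N + 1 by omega)
      have had := hs3.addrE hB (c := V 30) (u := V 14) ht.le hc
        ⟨by rw [V_fits, h30]; omega, h30⟩ ⟨by simp [e14]; omega, by simp [e14]⟩
      have hs4 := hs3.setMem (show 5 < 16 by norm_num) 0 z
      refine Runs.weaken (Runs.setV_seq (ev := z) ⟨by simp [had.1, had.2, e10', hgz, hzB],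
        by simp [had.2, e10', hgz]⟩ (Runs.seq (T₂ := 50 * (I.n + 1))
        (hs4.decP hB ht.le (by simpa using e14) (by simp) hzB) ?_)) (by simp [MWIS.addrE])
      intro s5 h9 hf5
      have hs5 := hs4.frame hf5 rfl
      have e6' : ∀ v < I.n, s5.mem 6 v = flag (v ∈ O) := by rw [hf5.1 6 rfl]; simpa using e6
      refine (hs5.unionP hB h9 e6').mono le_rfl ?_
      intro s6 h6 _
      exact ⟨O ∪ I.dec t z, hD.step h hi hzi (dec_sub t z) hzK hzv, by simpa using h6⟩
    · generalize (I.k + 1) * (I.n + 1) = E at *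
      simp
      omega
  · simp [numE]
    have : I.N ≤ (I.k + 1) * (I.n + 1) * I.N := Nat.le_mul_of_pos_left _ (by positivity)
    nlinarith
  · rintro s' ⟨h, -⟩ _
    exact h

end Inst

/-! ### Breadth-first search -/

/-- Visit the neighbour number `V 13` of the node `V 14`. -/
def visitP : Prog :=
  setV 32 (.read 3 (.read 2 (V 14) +ₑ V 13)) ;;
  .cond (.read 7 (V 32)) .skip
    (.store 7 (V 32) (V 14 +ₑ .const 1) ;; .store 8 (V 11) (V 32) ;; setV 11 (V 11 +ₑ .const 1))

/-- Compute an order of the nodes in array `8` and the parents, increased by one, in array `7`. -/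
def bfsP : Prog :=
  .store 7 (.const 0) (numE +ₑ .const 1) ;; setV 11 (.const 1) ;;
  forP 12 numE (setV 14 (.read 8 (V 12)) ;;
    forP 13 (.read 2 (V 14 +ₑ .const 1) -ₑ .read 2 (V 14)) visitP)

namespace Inst

variable {I : Inst} {B : ℕ} {s : State}

/-- The queue `o` of length `c` and the parents `q` (increased by one, `0` for nodes that are not
visited) during the search. -/
structure Bfs (I : Inst) (c : ℕ) (o q : ℕ → ℕ) : Prop where
  pos : 0 < c
  head : o 0 = 0
  root : q 0 = I.N + 1
  lt : ∀ i < c, o i < I.N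
  inj : ∀ i < c, ∀ j < c, o i = o j → i = j
  vis : ∀ u < I.N, q u ≠ 0 → ∃ i < c, o i = u
  step : ∀ i, 0 < i → i < c → ∃ j < i, q (o i) = o j + 1 ∧ o i ∈ I.nb (o j)

namespace Bfs

variable {c h : ℕ} {o q : ℕ → ℕ}

theorem ne_zero (hb : I.Bfs c o q) {i : ℕ} (hi : i < c) : q (o i) ≠ 0 := by
  rcases Nat.eq_zero_or_pos i with rfl | h0
  · rw [hb.head, hb.root]; omega
  · obtain ⟨j, -, hq, -⟩ := hb.step i h0 hi
    omega

theorem le_N (hb : I.Bfs c o q) : c ≤ I.N := by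
  have := Finset.card_le_card_of_injOn (s := Finset.range c) (t := Finset.range I.N) o
    (fun i hi => by simpa using hb.lt i (by simpa using hi))
    (fun i hi j hj => hb.inj i (by simpa using hi) j (by simpa using hj))
  simpa using this

/-- If all neighbours of queued nodes are visited, the queue is closed under neighbours and contains
node `0`, so connectedness makes it contain every node. -/
theorem N_le (hb : I.Bfs c o q) (hc : ∀ i < c, ∀ u ∈ I.nb (o i), q u ≠ 0) : I.N ≤ c := by
  have hall := I.conn_nodes {a | ∃ i < c, o i = a} ⟨0, hb.pos, hb.head⟩ (by
    rintro _ ⟨i, hi, rfl⟩ u hu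
    exact hb.vis u (I.nb_lt _ u hu) (hc i hi u hu))
  have := Finset.card_le_card (s := Finset.range I.N) (t := (Finset.range c).image o) (by
    intro t ht
    obtain ⟨i, hi, rfl⟩ := hall t (by simpa using ht)
    exact Finset.mem_image_of_mem _ (by simpa using hi))
  simpa using this.trans Finset.card_image_le

theorem visit (hb : I.Bfs c o q) (hh : h < c) {u : ℕ} (hu : u ∈ I.nb (o h)) (hq : q u = 0) :
    I.Bfs (c + 1) (Function.update o c u) (Function.update q u (o h + 1)) := by
  have huN := I.nb_lt _ u hu
  have hne : ∀ i < c, o i ≠ u := fun i hi he => hb.ne_zero hi (he ▸ hq)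
  have ho : ∀ i < c, Function.update o c u i = o i := fun i hi => Function.update_of_ne hi.ne _ _
  have hq' : ∀ i < c, Function.update q u (o h + 1) (o i) = q (o i) := fun i hi =>
    Function.update_of_ne (hne i hi) _ _
  refine ⟨by omega, by rw [ho 0 hb.pos, hb.head], ?_, ?_, ?_, ?_, ?_⟩
  · have := hq' 0 hb.pos
    rwa [hb.head, hb.root] at this
  · intro i hi
    rcases Nat.lt_succ_iff_lt_or_eq.1 hi with hi | rfl
    · rw [ho i hi]; exact hb.lt i hi
    · rwa [Function.update_self]
  · intro i hi j hj hij
    rcases Nat.lt_succ_iff_lt_or_eq.1 hi with hi | rfl <;>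
      rcases Nat.lt_succ_iff_lt_or_eq.1 hj with hj | rfl
    · rw [ho i hi, ho j hj] at hij; exact hb.inj i hi j hj hij
    · rw [ho i hi, Function.update_self] at hij; exact absurd hij (hne i hi)
    · rw [ho j hj, Function.update_self] at hij; exact absurd hij.symm (hne j hj)
    · rfl
  · intro v hv hqv
    by_cases hvu : v = u
    · exact ⟨c, by omega, by rw [Function.update_self, hvu]⟩
    · rw [Function.update_of_ne hvu] at hqv
      obtain ⟨i, hi, rfl⟩ := hb.vis v hv hqv
      exact ⟨i, by omega, ho i hi⟩
  · intro i h0 hi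
    rcases Nat.lt_succ_iff_lt_or_eq.1 hi with hi | rfl
    · obtain ⟨j, hj, h1, h2⟩ := hb.step i h0 hi
      refine ⟨j, hj, ?_⟩
      rw [ho i hi, ho j (by omega), hq' i hi]
      exact ⟨h1, h2⟩
    · refine ⟨h, hh, ?_⟩
      rw [Function.update_self, Function.update_self, ho h hh]
      exact ⟨rfl, hu⟩

/-- Stored parents are shifted by one so that `0` can mean unvisited; undoing the shift turns the
root mark `N + 1` into the fictitious parent `N`. -/
theorem isOrder (hb : I.Bfs I.N o q) : I.IsOrder o (fun t => q t - 1) where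
  lt := hb.lt
  inj := hb.inj
  root := by simp [hb.head, hb.root]
  step i h0 hi := by
    obtain ⟨j, hj, h1, h2⟩ := hb.step i h0 hi
    exact ⟨j, hj, by simp [h1], h2⟩

end Bfs

theorem Holds.visitP (hs : I.Holds s) (hB : I.Fit B) {t c h j : ℕ} (ht : t < I.N)
    (hj : j < (I.nb t).length) (h14 : s.mem 14 0 = t) (h13 : s.mem 13 0 = j)
    (h11 : s.mem 11 0 = c) (hb : I.Bfs c (s.mem 8) (s.mem 7)) (hh : h < c) (ho : s.mem 8 h = t) :
    Runs B visitP s 31 fun s' => ∃ c', s'.mem 11 0 = c' ∧ c ≤ c' ∧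
      I.Bfs c' (s'.mem 8) (s'.mem 7) ∧ (∀ i < c, s'.mem 8 i = s.mem 8 i) ∧
      (∀ u, s.mem 7 u ≠ 0 → s'.mem 7 u ≠ 0) ∧ s'.mem 7 (I.nb t)[j] ≠ 0 := by
  have hNB := hB.N_le
  have ho1 := hs.off_le t ht.le
  have hoff := hs.off t ht
  have ho2 := hs.off_le (t + 1) ht
  have hnbr := hs.nbr t ht j hj
  have hmem : (I.nb t)[j] ∈ I.nb t := List.getElem_mem hj
  have hu := I.nb_lt t _ hmem
  have hcN := hb.le_N
  set u := (I.nb t)[j] with hud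
  -- Reading the mark requires that its content fits into a word: it is `0`, the root mark `N + 1`,
  -- or a node plus one.
  have hq : s.mem 7 u ≤ B := by
    by_cases h0 : s.mem 7 u = 0
    · omega
    · obtain ⟨i, hi, he⟩ := hb.vis u hu h0
      rcases Nat.eq_zero_or_pos i with rfl | hi0
      · rw [← he, hb.head, hb.root]; omega
      · obtain ⟨i', hi', h1, -⟩ := hb.step i hi0 hi
        have := hb.lt i' (by omega)
        rw [← he, h1]; omega
  refine Runs.weaken (Runs.setV_seq (ev := u)
    ⟨by simp [h14, h13, hnbr]; omega, by simp [h14, h13, hnbr]⟩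
    (Runs.cond (v := s.mem 7 u) (T := 18) ⟨by simp [hq]; omega, by simp⟩ ?_ ?_)) (by simp)
  · intro h0
    refine Runs.weaken (Runs.skip ⟨c, ?_⟩) (by simp)
    simp [h11, hb, h0]
  · intro h0
    refine Runs.weaken (Runs.store_seq (iv := u) (ev := t + 1) ⟨by simp; omega, by simp⟩
      ⟨by simp [h14]; omega, by simp [h14]⟩ (Runs.store_seq (iv := c) (ev := u)
      ⟨by simp [h11]; omega, by simp [h11]⟩ ⟨by simp; omega, by simp⟩
      (Runs.setV (ev := c + 1) ⟨by simp [h11]; omega, by simp [h11]⟩ ⟨c + 1, ?_⟩))) (by simp)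
    have hv := hb.visit hh (ho ▸ hmem) h0
    rw [ho] at hv
    simp only [State.setMem_mem, Nat.reduceEqDiff, if_false, if_true, Function.update_self]
    refine ⟨trivial, by omega, hv, fun i hi => Function.update_of_ne hi.ne _ _, ?_, by omega⟩
    intro v hv
    by_cases hvu : v = u
    · rw [hvu, Function.update_self]; omega
    · rwa [Function.update_of_ne hvu]

/-- Scanning a node costs time linear in its degree plus one, so the whole search is linear in `N`
by `nb_total`. -/
theorem Holds.bfsP (hs : I.Holds s) (hB : I.Fit B) (h7 : ∀ i, s.mem 7 i = 0)
    (h8 : ∀ i, s.mem 8 i = 0) :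
    Runs B bfsP s (220 * I.N) fun s' => ∃ ord par, I.IsOrder ord par ∧ I.Ordered ord par s' := by
  have hNB := hB.N_le
  have hN := I.N_pos
  have hnum := hs.num hB
  have hs0 := (hs.setMem (show 5 < 7 by norm_num) 0 (I.N + 1)).setMem (show 5 < 11 by norm_num) 0 1
  refine (Runs.store_seq (iv := 0) (ev := I.N + 1) ⟨by simp, by simp⟩
    ⟨by simp [hnum.1, hnum.2]; omega, by simp [hnum.2]⟩ (Runs.setV_seq (ev := 1)
    ⟨by simp; omega, by simp⟩ (Runs.forP (T := 180 * I.N + 20) (m := I.N) (fun h r s' =>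
      ∃ c, s'.mem 11 0 = c ∧ I.Bfs c (s'.mem 8) (s'.mem 7) ∧ h ≤ c ∧
        (∀ i < h, ∀ u ∈ I.nb (s'.mem 8 i), s'.mem 7 u ≠ 0) ∧
        r ≤ ∑ i ∈ Finset.range h, (60 * (I.nb (s'.mem 8 i)).length + 60))
      (by omega) (by omega) rfl ?_ ?_ ?_ ?_))).mono ?_ ?_
  · refine ⟨1, by simp, ?_, by omega, by simp, by simp⟩
    simp only [State.setMem_mem, Nat.reduceEqDiff, if_false, if_true]
    refine ⟨by omega, h8 0, by simp, ?_, ?_, ?_, ?_⟩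
    · intro i _; rw [h8]; exact hN
    · intro i hi j hj _; omega
    · intro u _ hu
      refine ⟨0, by omega, ?_⟩
      by_contra hne
      rw [h8] at hne
      rw [Function.update_of_ne (Ne.symm hne), h7] at hu
      exact hu rfl
    · intro i h0 h1; omega
  · intro j r s' _ _ _ hf
    exact (hs0.frame hf rfl).num hB
  · rintro h r s' hh ⟨c, h11, hb, hhc, hcl, hr⟩ h12 hf
    have hs' := hs0.frame hf rfl
    -- The queue cannot run empty before `N` rounds: with all queued nodes scanned, `N_le` would
    -- give `N ≤ c = h`.
    have hhc' : h < c := by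
      rcases hhc.lt_or_eq with hlt | rfl
      · exact hlt
      · have := hb.N_le hcl; omega
    have ht := hb.lt h hhc'
    obtain ⟨t, htd⟩ : ∃ t, s'.mem 8 h = t := ⟨_, rfl⟩
    rw [htd] at ht
    have hoff := hs'.off t ht
    have ho1 := hs'.off_le t ht.le
    have ho2 := hs'.off_le (t + 1) ht
    have hs1 := hs'.setMem (show 5 < 14 by norm_num) 0 t
    refine ⟨_, (Runs.setV_seq (ev := t) ⟨by simp [h12, htd]; omega, by simp [h12, htd]⟩
      (Runs.forP_const (m := (I.nb t).length) (fun j s'' => ∃ c, s''.mem 11 0 = c ∧ h < c ∧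
        I.Bfs c (s''.mem 8) (s''.mem 7) ∧ (∀ i ≤ h, s''.mem 8 i = s'.mem 8 i) ∧
        (∀ u, s'.mem 7 u ≠ 0 → s''.mem 7 u ≠ 0) ∧
        ∀ i < j, ∀ hi : i < (I.nb t).length, s''.mem 7 (I.nb t)[i] ≠ 0)
        31 (by omega) (by omega) rfl ?_ ?_ ?_)).mono le_rfl ?_⟩
    · exact ⟨c, by simp [h11, hhc', hb]⟩
    · intro s'' hf'
      have e2 : s''.mem 2 = s'.mem 2 := by rw [hf'.1 2 rfl]; simp
      have e14 : s''.mem 14 0 = t := by rw [hf'.1 14 rfl]; simp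
      exact ⟨by simp [e14, e2, hoff]; omega, by simp [e14, e2, hoff]⟩
    · rintro j s'' hj ⟨c', h11', hhc'', hb', ho, hq, hdone⟩ h13 hf'
      have hs'' := hs1.frame hf' rfl
      have e14 : s''.mem 14 0 = t := by rw [hf'.1 14 rfl]; simp
      refine (hs''.visitP hB ht hj e14 h13 h11' hb' hhc'' ((ho h le_rfl).trans htd)).mono le_rfl ?_
      rintro s3 ⟨c3, h1, h2, h3, h4, h5, h6⟩ _
      simp only [State.setMem_mem, Nat.reduceEqDiff, if_false]
      refine ⟨c3, h1, by omega, h3, fun i hi => (h4 i (by omega)).trans (ho i hi),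
        fun u hu => h5 u (hq u hu), fun i hi hi' => ?_⟩
      rcases Nat.lt_succ_iff_lt_or_eq.1 hi with hi | rfl
      exacts [h5 _ (hdone i hi hi'), h6]
    · rintro s'' ⟨⟨c', h11', hhc'', hb', ho, hq, hdone⟩, -⟩ _
      simp only [State.setMem_mem, Nat.reduceEqDiff, if_false]
      refine ⟨c', h11', hb', hhc'', ?_, ?_⟩
      · intro i hi u hu
        rcases Nat.lt_succ_iff_lt_or_eq.1 hi with hi | rfl
        · rw [ho i hi.le] at hu
          exact hq u (hcl i hi u hu)
        · rw [ho i le_rfl, htd] at hu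
          obtain ⟨n, hn, rfl⟩ := List.getElem_of_mem hu
          exact hdone n hn hn
      · rw [Finset.sum_range_succ, ho h le_rfl, htd]
        rw [Finset.sum_congr rfl fun i hi => by rw [ho i (Finset.mem_range.1 hi).le]]
        simp [numE]
        omega
  · rintro r s' ⟨c, -, hb, hc, hcl, hr⟩
    obtain rfl : I.N = c := le_antisymm hc hb.le_N
    have h1 := hb.isOrder.sum_ord fun t => 60 * (I.nb t).length + 60
    rw [h1, Finset.sum_add_distrib, ← Finset.mul_sum] at hr
    have := I.nb_total
    simp [numE] at hr ⊢
    omega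
  · simp [numE]; omega
  · rintro s' ⟨r, ⟨c, -, hb, hc, -⟩, -⟩ _
    obtain rfl : I.N = c := le_antisymm hc hb.le_N
    refine ⟨_, _, hb.isOrder, fun i _ => rfl, fun t ht => ?_⟩
    obtain ⟨i, hi, he⟩ := hb.isOrder.surj ht
    have := hb.ne_zero hi
    rw [he] at this
    omega

end Inst

/-! ### The whole program -/

/-- The program solving Max Weight Independent Set for residual independence number `k + 1`. -/
def mainP (k : ℕ) : Prog := .cond (V 0) (bfsP ;; upP k ;; downP k) .skip

theorem Inst.Holds.mainP {I : Inst} {B : ℕ} {s : State} (hs : I.Holds s) (hB : I.Fit B)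
    (hn : I.n ≠ 0) (h6 : ∀ i, s.mem 6 i = 0) (h7 : ∀ i, s.mem 7 i = 0) (h8 : ∀ i, s.mem 8 i = 0)
    (hw : ∀ a, s.wmem 1 a = 0) :
    Runs B (mainP I.k) s (5000 * ((I.k + 1) * (2 ^ I.ℓ * (I.n + 1) ^ (I.k + 2) * I.N)))
      fun s' => ∃ O ⊆ Finset.range I.n, (∀ v < I.n, s'.mem 6 v = flag (v ∈ O)) ∧ I.Indep O ∧
        ∀ J ⊆ Finset.range I.n, I.Indep J → ∑ v ∈ J, I.w v ≤ ∑ v ∈ O, I.w v := by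
  have hnB := hB.n_le
  have hN := I.N_pos
  have hn' := hs.n
  refine Runs.weaken (Runs.cond (v := I.n) (T := 220 * I.N + (3400 * ((I.k + 1) *
      (2 ^ I.ℓ * (I.n + 1) ^ (I.k + 2) * I.N)) + 400 * ((I.k + 1) * (I.n + 1) * I.N)))
    ⟨by simp [hn']; omega, by simp [hn']⟩ (fun _ => Runs.seq (hs.bfsP hB h7 h8) ?_)
    (fun h => absurd h hn)) ?_
  · rintro s1 ⟨ord, par, h, ho⟩ hf1
    have hs1 := hs.frame hf1 rfl
    refine Runs.seq (hs1.upP hB h ho (by rw [hf1.2 1 rfl]; exact hw)) ?_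
    intro s2 hU hf2
    have hs2 := hs1.frame hf2 rfl
    refine (hs2.downP hB h (ho.congr (hf2.1 8 rfl) (hf2.1 7 rfl)) hU
      (by rw [hf2.1 6 rfl, hf1.1 6 rfl]; exact fun v _ => h6 v)).mono le_rfl ?_
    rintro s3 ⟨O, hD, hO⟩ -
    have hsub : O ⊆ Finset.range I.n := fun v hv => by
      obtain ⟨j, -, hj⟩ := hD.sub v hv
      exact I.X_sub _ hj
    -- The computed tables serve as the certificate `μ`: the upward pass supplies the inequalities
    -- and the downward pass the equalities.
    refine ⟨O, hsub, hO, h.optimal (μ := fun u K => s2.wmem 1 (I.ad u K)) hsub ?_ ?_⟩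
    · intro t ht
      obtain ⟨j, hj, rfl⟩ := h.surj ht
      exact (hU.done j hj (by omega)).le
    · intro t ht
      obtain ⟨j, hj, rfl⟩ := h.surj ht
      exact hD.good j hj
  · have h1 : I.n + 1 ≤ (I.n + 1) ^ (I.k + 2) := Nat.le_self_pow (by omega) _
    have h2 : (I.n + 1) ^ (I.k + 2) ≤ 2 ^ I.ℓ * (I.n + 1) ^ (I.k + 2) :=
      Nat.le_mul_of_pos_left _ (by positivity)
    have h3 : (I.k + 1) * (I.n + 1) * I.N ≤
        (I.k + 1) * (2 ^ I.ℓ * (I.n + 1) ^ (I.k + 2) * I.N) := by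
      rw [mul_assoc]
      exact Nat.mul_le_mul_left _ (Nat.mul_le_mul_right _ (h1.trans h2))
    have h4 : I.N ≤ (I.k + 1) * (I.n + 1) * I.N := Nat.le_mul_of_pos_left _ (by positivity)
    simp only [V_cost]
    omega

/-! ### From decompositions to the abstract setting -/

/-- A family of sets of vertices, with vertices and nodes regarded as natural numbers. -/
def lift {n N : ℕ} (f : Fin N → Finset (Fin n)) (t : ℕ) : Finset ℕ :=
  if h : t < N then (f ⟨t, h⟩).map Fin.valEmbedding else ∅

theorem mem_lift {n N : ℕ} {f : Fin N → Finset (Fin n)} {t v : ℕ} :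
    v ∈ lift f t ↔ ∃ (ht : t < N) (hv : v < n), (⟨v, hv⟩ : Fin n) ∈ f ⟨t, ht⟩ := by
  unfold lift
  split_ifs with h
  · simp only [Finset.mem_map, Fin.valEmbedding_apply]
    constructor
    · rintro ⟨a, ha, rfl⟩
      exact ⟨h, a.2, ha⟩
    · rintro ⟨_, hv, hm⟩
      exact ⟨_, hm, rfl⟩
  · simp [h]

/-- The row index `a` is not bounded by `m`: a row beyond the matrix reads as zeros. In particular
row `N` provides the empty bag of the fictitious parent of the root. -/
theorem bitMatrix_apply {m n : ℕ} (R : Fin m → Fin n → Prop) (a b : ℕ) (hb : b < n) :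
    bitMatrix R (a * n + b) = flag (∃ (ha : a < m) (hb : b < n), R ⟨a, ha⟩ ⟨b, hb⟩) := by
  unfold bitMatrix flag
  congr 1
  apply propext
  constructor
  · rintro ⟨a', b', he, hR⟩
    have h1 : (a * n + b) / n = a := by
      rw [Nat.add_comm, Nat.add_mul_div_right _ _ (by omega), Nat.div_eq_of_lt hb, zero_add]
    have h2 : (a' * n + b' : ℕ) / n = a' := by
      rw [Nat.add_comm, Nat.add_mul_div_right _ _ (by omega), Nat.div_eq_of_lt b'.2, zero_add]
    obtain rfl : a = a' := by rw [← h1, he, h2]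
    obtain rfl : b = b' := by omega
    exact ⟨a'.2, b'.2, hR⟩
  · rintro ⟨ha, hb, hR⟩
    exact ⟨_, _, rfl, hR⟩

/-- Connectedness in the form of closed sets, which translates to natural numbers without
transporting walks; it yields the fields `conn_nodes` and `conn` of `Inst`. -/
theorem mem_of_closed {α : Type*} {H : SimpleGraph α} (hH : H.Preconnected) {A : Set α} {a : α}
    (ha : a ∈ A) (hA : ∀ x ∈ A, ∀ y, H.Adj x y → y ∈ A) (b : α) : b ∈ A := by
  obtain ⟨p⟩ := hH a b
  induction p with
  | nil => exact ha
  | cons h _ ih => exact ih (hA _ ha _ h)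

section

variable {n N ℓ : ℕ} {G : SimpleGraph (Fin n)}

/-- The handshake lemma together with the `N - 1` edges of a tree. -/
theorem sum_length_nbrs {T : SimpleGraph (Fin N)} (hT : T.IsTree) (L : AdjLists T) :
    ∑ t, (L.nbrs t).length + 2 = 2 * N := by
  classical
  have h1 := hT.card_edgeFinset
  have h2 := T.sum_degrees_eq_twice_card_edges
  have h3 : ∀ t, (L.nbrs t).length = T.degree t := by
    intro t
    rw [← List.toFinset_card_of_nodup (L.nodup t), ← SimpleGraph.card_neighborFinset_eq_degree]
    congr 1
    ext u
    simp [L.mem_nbrs]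
  simp only [h3, h2]
  rw [Fintype.card_fin] at h1
  omega

theorem RefinedTreeDecomposition.card_le (D : RefinedTreeDecomposition G (Fin N) ℓ) {k : ℕ}
    (hk : D.residualIndepNumber ≤ k) (t : Fin N) {A : Finset (Fin n)} (hA : A ⊆ D.bag t)
    (hi : G.IsIndepSet (A : Set (Fin n))) : (A \ D.sub t).card ≤ k := by
  classical
  set S : Set (Fin n) := (D.bag t : Set (Fin n)) \ D.sub t with hS
  let A' : Finset S := (A \ D.sub t).subtype (· ∈ S)
  have hind : (G.induce S).IsIndepSet (A' : Set S) := by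
    intro x hx y hy hxy hadj
    simp only [A', Finset.mem_coe, Finset.mem_subtype, Finset.mem_sdiff] at hx hy
    exact hi hx.1 hy.1 (fun h => hxy (Subtype.ext h)) hadj
  have hcard : A'.card = (A \ D.sub t).card := by
    rw [Finset.card_subtype, Finset.filter_true_of_mem]
    intro x hx
    rw [Finset.mem_sdiff] at hx
    exact ⟨hA hx.1, hx.2⟩
  rw [← hcard]
  refine (SimpleGraph.IsIndepSet.card_le_indepNum hind).trans (le_trans ?_ hk)
  exact Finset.le_sup (f := fun t => (G.induce ((D.bag t : Set (Fin n)) \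
    (D.sub t : Set (Fin n)))).indepNum) (Finset.mem_univ t)

/-- The abstract form of a weighted graph with a refined tree decomposition. -/
noncomputable def toInst (k : ℕ) (w : Fin n → ℚ≥0) (D : RefinedTreeDecomposition G (Fin N) ℓ)
    (L : AdjLists D.tree) (hk : D.residualIndepNumber ≤ k + 1) : Inst where
  n := n
  N := N
  k := k
  ℓ := ℓ
  adj u v := ∃ (hu : u < n) (hv : v < n), G.Adj ⟨u, hu⟩ ⟨v, hv⟩
  X := lift D.bag
  U := lift D.sub
  w v := if h : v < n then (w ⟨v, h⟩ : ℚ) else 0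
  nb t := if h : t < N then (L.nbrs ⟨t, h⟩).map Fin.val else []
  adj_symm := fun u v ⟨hu, hv, h⟩ => ⟨hv, hu, h.symm⟩
  w_nonneg v := by split_ifs <;> positivity
  X_sub t v hv := by
    obtain ⟨_, hv, _⟩ := mem_lift.1 hv
    simpa using hv
  X_out t ht := by simp [lift, not_lt.2 ht]
  U_sub t v hv := by
    obtain ⟨ht, hv, h⟩ := mem_lift.1 hv
    exact mem_lift.2 ⟨ht, hv, D.sub_subset_bag _ h⟩
  U_card t := by
    unfold lift
    split_ifs with h
    · rw [Finset.card_map]; exact D.card_sub_le _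
    · simp
  resid t A hA hi := by
    by_cases ht : t < N
    · let A' : Finset (Fin n) := Finset.univ.filter fun v => (v : ℕ) ∈ A
      have h1 : A' ⊆ D.bag ⟨t, ht⟩ := by
        intro v hv
        obtain ⟨_, _, h⟩ := mem_lift.1 (hA (Finset.mem_filter.1 hv).2)
        exact h
      have h2 : G.IsIndepSet (A' : Set (Fin n)) := by
        intro x hx y hy _ hxy
        simp only [A', Finset.coe_filter, Set.mem_ofPred_eq, Finset.mem_univ, true_and] at hx hy
        exact hi x hx y hy ⟨x.2, y.2, hxy⟩
      have h3 := D.card_le hk ⟨t, ht⟩ h1 h2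
      refine le_trans (Eq.le ?_) h3
      rw [← Finset.card_map Fin.valEmbedding]
      congr 1
      ext v
      simp only [Finset.mem_sdiff, Finset.mem_map, Finset.mem_filter, Finset.mem_univ, true_and,
        Fin.valEmbedding_apply, A']
      constructor
      · rintro ⟨hv, hU⟩
        obtain ⟨_, hvn, _⟩ := mem_lift.1 (hA hv)
        exact ⟨⟨v, hvn⟩, ⟨hv, fun h => hU (mem_lift.2 ⟨ht, hvn, h⟩)⟩, rfl⟩
      · rintro ⟨v, ⟨hv, hU⟩, rfl⟩
        refine ⟨hv, fun h => hU ?_⟩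
        obtain ⟨_, _, h⟩ := mem_lift.1 h
        exact h
    · have : A = ∅ := by
        rw [← Finset.subset_empty]
        refine hA.trans ?_
        simp [lift, ht]
      simp [this]
  cover v hv := by
    obtain ⟨t, ht⟩ := D.exists_mem_bag ⟨v, hv⟩
    exact ⟨t, t.2, mem_lift.2 ⟨t.2, hv, ht⟩⟩
  edge u _ v _ := by
    rintro ⟨hu, hv, h⟩
    obtain ⟨t, h1, h2⟩ := D.exists_edge_bag _ _ h
    exact ⟨t, t.2, mem_lift.2 ⟨t.2, hu, h1⟩, mem_lift.2 ⟨t.2, hv, h2⟩⟩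
  N_pos := by
    obtain ⟨t⟩ := D.isTree.connected.nonempty
    exact t.pos
  nb_lt t u hu := by
    split_ifs at hu with h
    · obtain ⟨u', -, rfl⟩ := List.mem_map.1 hu
      exact u'.2
    · simp at hu
  nb_symm t u hu := by
    split_ifs at hu with h
    · obtain ⟨u', hu', rfl⟩ := List.mem_map.1 hu
      rw [dif_pos u'.2]
      exact List.mem_map.2 ⟨⟨t, h⟩, (L.mem_nbrs _ _).2 ((L.mem_nbrs _ _).1 hu').symm, rfl⟩
    · simp at hu
  nb_nodup t := by
    split_ifs with h
    · exact (L.nodup _).map Fin.val_injective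
    · simp
  nb_irrefl t ht := by
    split_ifs at ht with h
    · obtain ⟨u', hu', he⟩ := List.mem_map.1 ht
      have := ((L.mem_nbrs _ _).1 hu').ne
      exact this (Fin.ext he.symm)
    · simp at ht
  nb_total := by
    rw [← sum_length_nbrs D.isTree L, Finset.sum_range]
    congr 1
    refine Finset.sum_congr rfl fun t _ => ?_
    simp
  conn_nodes A hA hcl t ht := by
    have h0 : 0 < N := by omega
    refine mem_of_closed (A := {x : Fin N | (x : ℕ) ∈ A}) D.isTree.connected.preconnected
      (a := ⟨0, h0⟩) hA ?_ ⟨t, ht⟩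
    intro x hx y hxy
    refine hcl x hx y ?_
    rw [dif_pos x.2]
    exact List.mem_map.2 ⟨y, (L.mem_nbrs _ _).2 hxy, rfl⟩
  conn v A s hs hv hcl s' hv' := by
    obtain ⟨hsN, hvn, h1⟩ := mem_lift.1 hv
    obtain ⟨hsN', _, h2⟩ := mem_lift.1 hv'
    have := mem_of_closed (A := {x : {t | (⟨v, hvn⟩ : Fin n) ∈ D.bag t} | ((x : Fin N) : ℕ) ∈ A})
      (D.connected ⟨v, hvn⟩).preconnected (a := ⟨⟨s, hsN⟩, h1⟩) hs ?_ ⟨⟨s', hsN'⟩, h2⟩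
    · exact this
    · rintro ⟨x, hx⟩ hxA ⟨y, hy⟩ hxy
      refine hcl x hxA y ?_ (mem_lift.2 ⟨y.2, hvn, hy⟩)
      rw [dif_pos x.2]
      exact List.mem_map.2 ⟨y, (L.mem_nbrs _ _).2 hxy, rfl⟩

theorem refinedInput_holds (k : ℕ) (w : Fin n → ℚ≥0) (D : RefinedTreeDecomposition G (Fin N) ℓ)
    (L : AdjLists D.tree) (hk : D.residualIndepNumber ≤ k + 1) :
    (toInst k w D L hk).Holds (refinedInput w D L) := by
  have hsplit : ∀ t (ht : t < N), (List.finRange N).take (t + 1) =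
      (List.finRange N).take t ++ [⟨t, ht⟩] := by
    intro t ht
    rw [← List.take_append_getElem (by simpa using ht)]
    simp
  constructor
  · simp [refinedInput, treeDecompositionInput, toInst]
  · simp [refinedInput, treeDecompositionInput, toInst]
  · intro u hu v hv
    exact bitMatrix_apply G.Adj u v hv
  · intro t ht
    have ht : t < N := ht
    simp [refinedInput, treeDecompositionInput, toInst, ht]
  · intro t _
    have h1 := sum_length_nbrs D.isTree L
    rw [Fin.sum_univ_def, ← List.length_flatMap] at h1
    have h2 : (List.finRange N).flatMap L.nbrs = ((List.finRange N).take t).flatMap L.nbrs ++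
        ((List.finRange N).drop t).flatMap L.nbrs := by
      rw [← List.flatMap_append, List.take_append_drop]
    rw [h2, List.length_append] at h1
    have h3 : (refinedInput w D L).mem 2 t =
        (((List.finRange N).take t).flatMap L.nbrs).length := by
      simp [refinedInput, treeDecompositionInput]
    rw [h3]
    show _ ≤ 2 * N
    omega
  · intro t ht i hi
    have ht : t < N := ht
    have hnb : (toInst k w D L hk).nb t = (L.nbrs ⟨t, ht⟩).map Fin.val := dif_pos ht
    simp only [hnb, List.length_map] at hi ⊢
    -- The concatenation is cut into the lists before node `t`, the list of `t` and the rest, so the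
    -- offset of `t` lands at the start of its own list.
    have h2 : (List.finRange N).flatMap L.nbrs = ((List.finRange N).take t).flatMap L.nbrs ++
        (L.nbrs ⟨t, ht⟩ ++ ((List.finRange N).drop (t + 1)).flatMap L.nbrs) := by
      conv_lhs => rw [← List.take_append_drop (t + 1) (List.finRange N), hsplit t ht]
      simp
    have h3 : (refinedInput w D L).mem 3 ((refinedInput w D L).mem 2 t + i) =
        (((List.finRange N).flatMap L.nbrs).map Fin.val).getD
          ((((List.finRange N).take t).flatMap L.nbrs).length + i) 0 := by
      simp [refinedInput, treeDecompositionInput]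
    rw [h3, h2, List.map_append, List.map_append, List.getD_append_right _ _ _ _ (by simp),
      List.getD_append _ _ _ _ (by simpa using hi)]
    rw [List.getD_eq_getElem _ _ (by simpa using hi)]
    simp
  · intro t _ v hv
    have := bitMatrix_apply (fun t v => v ∈ D.bag t) t v hv
    simpa [refinedInput, treeDecompositionInput, toInst, mem_lift] using this
  · intro t _ v hv
    have := bitMatrix_apply (fun t v => v ∈ D.sub t) t v hv
    simpa [refinedInput, treeDecompositionInput, toInst, mem_lift] using this
  · intro v hv
    simp [refinedInput, treeDecompositionInput, toInst]

end

/-- A tree has a node, so the base is at least `2`. Two of its `k + 4` powers absorb the factor `4`,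
and the others dominate the factors one by one. -/
theorem fit_bound (k ℓ n N : ℕ) (hN : 0 < N) :
    4 * (2 ^ ℓ * (n + 1) ^ (k + 2) * (N + 1)) ≤ (2 ^ ℓ * (n + 1) * (N + 1)) ^ (k + 4) ∧
      k + 1 ≤ (2 ^ ℓ * (n + 1) * (N + 1)) ^ (k + 4) := by
  have h1 : 1 ≤ 2 ^ ℓ * (n + 1) := Nat.succ_le_of_lt (by positivity)
  have h2 : 2 ≤ 2 ^ ℓ * (n + 1) * (N + 1) := by nlinarith
  constructor
  · calc 4 * (2 ^ ℓ * (n + 1) ^ (k + 2) * (N + 1))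
        ≤ (2 ^ ℓ * (n + 1) * (N + 1)) ^ 2 *
          ((2 ^ ℓ) ^ (k + 2) * (n + 1) ^ (k + 2) * (N + 1) ^ (k + 2)) := by
          refine Nat.mul_le_mul (by nlinarith) (Nat.mul_le_mul (Nat.mul_le_mul ?_ le_rfl) ?_)
          · exact Nat.le_self_pow (by omega) _
          · exact Nat.le_self_pow (by omega) _
      _ = _ := by rw [← mul_pow, ← mul_pow, ← pow_add]; congr 1; ring
  · calc k + 1 ≤ 2 ^ (k + 1) := Nat.lt_two_pow_self.le
      _ ≤ 2 ^ (k + 4) := Nat.pow_le_pow_right (by omega) (by omega)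
      _ ≤ _ := Nat.pow_le_pow_left h2 _

/-- For `n ≥ 1` one has `n + 1 ≤ 2n`, which costs the constant `2 ^ (k + 2)`. -/
theorem time_bound (k ℓ n N : ℕ) (hn : n ≠ 0) :
    5000 * ((k + 1) * (2 ^ ℓ * (n + 1) ^ (k + 2) * N)) ≤
      5000 * ((k + 1) * 2 ^ (k + 2)) * (2 ^ ℓ * n ^ (k + 2) * N + 1) := by
  have h1 : (n + 1) ^ (k + 2) ≤ 2 ^ (k + 2) * n ^ (k + 2) := by
    rw [← mul_pow]; exact Nat.pow_le_pow_left (by omega) _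
  calc 5000 * ((k + 1) * (2 ^ ℓ * (n + 1) ^ (k + 2) * N))
      ≤ 5000 * ((k + 1) * (2 ^ ℓ * (2 ^ (k + 2) * n ^ (k + 2)) * N)) := by gcongr
    _ = 5000 * ((k + 1) * 2 ^ (k + 2)) * (2 ^ ℓ * n ^ (k + 2) * N) := by ring
    _ ≤ _ := Nat.mul_le_mul_left _ (by omega)

/-- The program solves Max Weight Independent Set within the time bound. -/
theorem mainP_correct (k ℓ n N : ℕ) (G : SimpleGraph (Fin n)) (w : Fin n → ℚ≥0)
    (D : RefinedTreeDecomposition G (Fin N) ℓ) (L : AdjLists D.tree)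
    (hk : D.residualIndepNumber ≤ k + 1) :
    Runs ((2 ^ ℓ * (n + 1) * (N + 1)) ^ (k + 4)) (mainP k) (refinedInput w D L)
      (5000 * ((k + 1) * 2 ^ (k + 2)) * (2 ^ ℓ * n ^ (k + 2) * N + 1))
      (OutputsMaxWeightIndepSet G w) := by
  have hs := refinedInput_holds k w D L hk
  have hN : 0 < N := (toInst k w D L hk).N_pos
  have hfit := fit_bound k ℓ n N hN
  -- For the empty graph the time bound is a constant while `N` may be arbitrarily large, so the
  -- program must stop before looking at the tree; hence the test of `n` at the start of `mainP`.
  by_cases hn : n = 0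
  · subst hn
    have h0 : (refinedInput w D L).mem 0 0 = 0 := hs.n
    refine Runs.weaken (Runs.cond (v := 0) (T := 1) ⟨by simp [h0], by simp [h0]⟩
      (fun h => absurd rfl h) fun _ => Runs.skip ⟨∅, fun v => v.elim0, by simp, ?_⟩) ?_
    · intro J _
      rw [Finset.eq_empty_of_isEmpty J]
    · have : 1 ≤ (k + 1) * 2 ^ (k + 2) * (2 ^ ℓ * 0 ^ (k + 2) * N + 1) :=
        Nat.succ_le_of_lt (by positivity)
      rw [mul_assoc]
      simp only [V_cost]
      omega
  · refine (hs.mainP ⟨hfit.1, hfit.2⟩ hn ?_ ?_ ?_ ?_).mono (time_bound k ℓ n N hn) ?_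
    · intro i; simp [refinedInput, treeDecompositionInput]
    · intro i; simp [refinedInput, treeDecompositionInput]
    · intro i; simp [refinedInput, treeDecompositionInput]
    · intro i; simp [refinedInput, treeDecompositionInput]
    · rintro s' ⟨O, hO, h6, hi, hmax⟩ -
      have hsum : ∀ J : Finset (Fin n), ∑ v ∈ J.map Fin.valEmbedding, (toInst k w D L hk).w v =
          ((∑ v ∈ J, w v : ℚ≥0) : ℚ) := by
        intro J
        rw [Finset.sum_map, NNRat.cast_sum]
        refine Finset.sum_congr rfl fun v _ => ?_
        simp [toInst]
      have hOm : (Finset.univ.filter fun v : Fin n => (v : ℕ) ∈ O).map Fin.valEmbedding = O := by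
        ext v
        simp only [Finset.mem_map, Finset.mem_filter, Finset.mem_univ, true_and,
          Fin.valEmbedding_apply]
        constructor
        · rintro ⟨v, hv, rfl⟩; exact hv
        · intro hv
          have hvn : v < n := Finset.mem_range.1 (hO hv)
          exact ⟨⟨v, hvn⟩, hv, rfl⟩
      refine ⟨Finset.univ.filter fun v : Fin n => (v : ℕ) ∈ O, ?_, ?_, ?_⟩
      · intro v
        rw [h6 v v.2]
        simp [flag]
      · intro x hx y hy _ hxy
        simp only [Finset.coe_filter, Set.mem_ofPred_eq, Finset.mem_univ, true_and] at hx hy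
        exact hi x hx y hy ⟨x.2, y.2, hxy⟩
      · intro J hJ
        have := hmax (J.map Fin.valEmbedding) ?_ ?_
        · rw [hsum, ← hOm, hsum] at this
          exact_mod_cast this
        · intro v hv
          obtain ⟨v, -, rfl⟩ := Finset.mem_map.1 hv
          exact Finset.mem_range.2 v.2
        · rintro x hx y hy ⟨_, _, hxy⟩
          obtain ⟨x', hx', rfl⟩ := Finset.mem_map.1 hx
          obtain ⟨y', hy', rfl⟩ := Finset.mem_map.1 hy
          exact hJ (x := x') hx' (y := y') hy' hxy.ne hxy

/-- A tree decomposition as a refined tree decomposition with empty sets `U_t`. -/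
def TreeDecomposition.toRefined {n N : ℕ} {G : SimpleGraph (Fin n)}
    (D : TreeDecomposition G (Fin N)) : RefinedTreeDecomposition G (Fin N) 0 where
  toTreeDecomposition := D
  sub _ := ∅
  sub_subset_bag _ := Finset.empty_subset _
  card_sub_le _ := le_rfl

theorem TreeDecomposition.residualIndepNumber_toRefined {n N : ℕ} {G : SimpleGraph (Fin n)}
    (D : TreeDecomposition G (Fin N)) : D.toRefined.residualIndepNumber = D.indepNumber := by
  unfold RefinedTreeDecomposition.residualIndepNumber TreeDecomposition.indepNumber
  refine Finset.sup_congr rfl fun t _ => ?_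
  have : ((D.toRefined.bag t : Set (Fin n)) \ (D.toRefined.sub t : Set (Fin n))) =
      (D.bag t : Set (Fin n)) := by
    simp [TreeDecomposition.toRefined]
  rw [this]

/-- With all `U_t` empty, array `5` is zero, as it already is in the unrefined input; hence one
program serves both parts. -/
theorem refinedInput_toRefined {n N : ℕ} {G : SimpleGraph (Fin n)} (w : Fin n → ℚ≥0)
    (D : TreeDecomposition G (Fin N)) (L : AdjLists D.tree) :
    refinedInput w D.toRefined L = treeDecompositionInput w D L := by
  apply State.ext
  · funext a
    by_cases ha : a = 5
    · subst ha
      funext i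
      simp [refinedInput, treeDecompositionInput, TreeDecomposition.toRefined, bitMatrix]
    · simp [refinedInput, ha, TreeDecomposition.toRefined]
  · rfl

end MWIS

theorem mainTheorem2 (k : ℕ) (hk : 1 ≤ k) :
    (∃ (P : MWIS.Prog) (C c : ℕ), ∀ (ℓ n N : ℕ) (G : SimpleGraph (Fin n)) (w : Fin n → ℚ≥0)
      (D : MWIS.RefinedTreeDecomposition G (Fin N) ℓ) (L : MWIS.AdjLists D.tree),
      D.residualIndepNumber ≤ k →
        ∃ (t : ℕ) (s : MWIS.State),
          MWIS.Exec ((2 ^ ℓ * (n + 1) * (N + 1)) ^ c) P (MWIS.refinedInput w D L) t s ∧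
          MWIS.OutputsMaxWeightIndepSet G w s ∧
          t ≤ C * (2 ^ ℓ * n ^ (k + 1) * N + 1)) ∧
    (∃ (P : MWIS.Prog) (C c : ℕ), ∀ (n N : ℕ) (G : SimpleGraph (Fin n)) (w : Fin n → ℚ≥0)
      (D : MWIS.TreeDecomposition G (Fin N)) (L : MWIS.AdjLists D.tree),
      D.indepNumber ≤ k →
        ∃ (t : ℕ) (s : MWIS.State),
          MWIS.Exec (((n + 1) * (N + 1)) ^ c) P (MWIS.treeDecompositionInput w D L) t s ∧
          MWIS.OutputsMaxWeightIndepSet G w s ∧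
          t ≤ C * (n ^ (k + 1) * N + 1)) := by
  -- This is where `1 ≤ k` enters: the program singles out one top digit, so it is indexed by the
  -- number of the remaining digits.
  obtain ⟨k, rfl⟩ : ∃ k', k = k' + 1 := ⟨k - 1, by omega⟩
  refine ⟨⟨MWIS.mainP k, 5000 * ((k + 1) * 2 ^ (k + 2)), k + 4, ?_⟩,
    ⟨MWIS.mainP k, 5000 * ((k + 1) * 2 ^ (k + 2)), k + 4, ?_⟩⟩
  · intro ℓ n N G w D L hD
    obtain ⟨t, s, h1, h2, h3⟩ := MWIS.mainP_correct k ℓ n N G w D L hD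
    exact ⟨t, s, h1, h3, h2⟩
  · intro n N G w D L hD
    obtain ⟨t, s, h1, h2, h3⟩ := MWIS.mainP_correct k 0 n N G w D.toRefined L
      (by rwa [D.residualIndepNumber_toRefined])
    rw [MWIS.refinedInput_toRefined] at h1
    rw [pow_zero, one_mul] at h1 h2
    exact ⟨t, s, h1, h3, h2⟩
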